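/- **Setting.** Let $n,\mu\ge 1$, $N\ge 0$ be integers, $a(0),\dots,a(N)\in\mathbb C$, $P_0>0$, and let $v\le u$ (a.e.) be spectral densities on $(-\pi,\pi]$ (nonnegative integrable functions). Put $$D_v^u=\Big\{f \text{ a spectral density}: v\le f\le u \text{ a.e.},\ \tfrac1{2\pi}\int_{-\pi}^{\pi}f(\lambda)\,d\lambda\le P_0\Big\}.$$ A (complex) stochastic sequence $\xi$ has stationary $n$th increments with spectral density $f$ if the increments $\xi^{(n)}(m,s)=\sum_{l=0}^n(-1)^l\binom nl\xi(m-ls)$ are centred, square integrable, and for all integers $m_0,m,s_1,s_2$ $$E\,\xi^{(n)}(m_0+m,s_1)\overline{\xi^{(n)}(m_0,s_2)}=\tfrac1{2\pi}\int_{-\pi}^{\pi}e^{i\lambda m}(1-e^{-is_1\lambda})^n(1-e^{is_2\lambda})^n\lambda^{-2n}f(\lambda)\,d\lambda .$$ Let $\sum_k d_\mu(k)x^k=(\sum_j x^{\mu j})^n$ and let $w_\mu(k)$ be the Taylor coefficients at $0$ of $$w_\mu(z)=\exp\Big\{\tfrac1{4\pi}\int_{-\pi}^{\pi}\tfrac{e^{i\lambda}+z}{e^{i\lambda}-z}\ln\tfrac{|1-e^{-i\lambda\mu}|^{2n}}{\lambda^{2n}}\,d\lambda\Big\}.$$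 For $0\le k,j\le N$ set $(D_N^\mu)_{k,j}=d_\mu(j-k)$ if $k\le j$, $(\hat D_N^\mu)_{k,j}=d_\mu(k+j-N)$ if $k+j\ge N$, $(A_N)_{k,j}=a(k+j)$ if $k+j\le N$, $(W_N^\mu)_{j,k}=w_\mu(j-k)$ if $k\le j$, and all other entries $0$. For a sequence $\varphi=(\varphi(k))_{k\ge0}$ put $\varphi_N=(\varphi(0),\dots,\varphi(N))$, $\varphi_\mu(k)=\sum_{j=0}^k w_\mu(k-j)\varphi(j)$ and $\Phi_\mu(z)=\sum_{k\ge0}\varphi_\mu(k)z^k$. The sequence $\varphi$ *defines the canonical factorization* of $f$ if $\sum_k\varphi(k)z^k$ has radius of convergence $>1$ and no zeros in $|z|\le1$, and $f(\lambda)=|\sum_k\varphi(k)e^{-i\lambda k}|^2$ a.e. Put $$B_N(\lambda)=\sum_{k=0}^N(D_N^\mu a_N)_k e^{i\lambda k},\qquad r_\varphi(\lambda)=\sum_{j=0}^N(D_N^\mu A_NW_N^\mu\varphi_N)_je^{i\lambda j},\qquad h_\varphi(\lambda)=B_N(\lambda)-r_\varphi(\lambda)\,\Phi_\mu(e^{-i\lambda})^{-1}.$$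 A linear estimate of $A_N\xi=\sum_{k=0}^Na(k)\xi(k)$ from $\xi(m)$, $m\le-1$, is $-\sum_{k=-\mu n}^{-1}v_{\mu,N}(k)\xi(k)$ plus a linear combination (or mean square limit of such) of $\xi^{(n)}(k,\mu)$, $k\le-1$; here $v_{\mu,N}(k)=\sum_{0\le l\le n,\ 0\le l\mu+k\le N}(-1)^l\binom nl(D_N^\mu a_N)_{l\mu+k}$. Write $\mathcal L(f)$ for the set of spectral characteristics, i.e. measurable $h$ such that $h(\lambda)(1-e^{-i\lambda\mu})^n(i\lambda)^{-n}$ is in the closed span in $L_2(f)$ of $e^{i\lambda k}(1-e^{-i\lambda\mu})^n(i\lambda)^{-n}$, $k\le-1$, and $$\Delta(h;f)=\tfrac1{2\pi}\int_{-\pi}^{\pi}|B_N(\lambda)-h(\lambda)|^2\,\tfrac{|1-e^{-i\lambda\mu}|^{2n}}{\lambda^{2n}}f(\lambda)\,d\lambda,\qquad \Delta(f)=\inf_{h\in\mathcal L(f)}\Delta(h;f).$$ A density $f^0\in D_v^u$ is *least favorable* if $\Delta(f^0)=\max_{f\in D_v^u}\Delta(f)$, where, for each $f\in D_v^u$, $\Delta(f)$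 is the infimum of $E|A_N\xi-\hat A_N\xi|^2$ over linear estimates $\hat A_N\xi$, for every $\xi$ with stationary $n$th increments of spectral density $f$. A function $h^0$ is *minimax-robust* if $h^0\in H=\bigcap_{f\in D_v^u}\mathcal L(f)$, the maximum of $\Delta(h^0;\cdot)$ over $D_v^u$ is attained, and it equals $\min_{h\in H}\sup_{f\in D_v^u}\Delta(h;f)$. Consider the equations $$(\mathrm i)\ D_N^\mu A_NW_N^\mu\varphi_N=\alpha\overline{\varphi_N},\ \alpha\in\mathbb C;\qquad(\mathrm{ii})\ \hat D_N^\mu A_NW_N^\mu\varphi_N=\beta\overline{\varphi_N},\ \beta\in\mathbb C.$$ Let $S$ be the set of $\varphi$ with $\varphi(k)=0$ for $k>N$ such that $\varphi_N$ solves (i) or (ii), $\|\varphi_N\|^2=P_0$, $v(\lambda)\le|\sum_{k\le N}\varphi(k)e^{-i\lambda k}|^2\le u(\lambda)$ a.e., and $\varphi$ defines the canonical factorization of this density. Let $S^+$ be the set of pairs $(c,\varphi)$, $c\in\mathbb C$, with $\sum_{k\ge0}|\varphi(k)|^2=P_0$ such that $\varphi$ defines the canonical factorization of $$f_{c,\varphi}(\lambda)=\max\Big\{v(\lambda),\min\Big\{u(\lambda),\Big|c\sum_{k=0}^N(D_N^\mu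 A_NW_N^\mu\varphi_N)_ke^{i\lambda k}\Big|^2\Big\}\Big\}.$$ Let $\nu_u^N$ and $\nu_u^{N+}$ be the suprema of $\|D_N^\mu A_NW_N^\mu\varphi_N\|^2/P_0$ over $\varphi\in S$ and over $(c,\varphi)\in S^+$ respectively ($\sup\emptyset=-\infty$). **Theorem.** (1) Suppose that $\varphi^0\in S$ and $\nu_u^NP_0=\nu_u^{N+}P_0=\|D_N^\mu A_NW_N^\mu\varphi_N^0\|^2$. Then the moving average density of order $N$, $f^0(\lambda)=|\sum_{k=0}^N\varphi^0(k)e^{-i\lambda k}|^2$, is least favorable in $D_v^u$. For every $\xi$ with stationary $n$th increments of spectral density $f^0$ the increments have the one-sided moving average representation $\xi^{(n)}(m,\mu)=\sum_{k\ge0}\varphi^0_\mu(k)\varepsilon(m-k)$ with an innovation sequence $\varepsilon$ (centred, orthonormal, with the closed span of $\varepsilon(j)$, $j\le t$, equal to that of $\xi^{(n)}(j,s)$, $j\le t$, $s>0$, for every $t$), and $\xi^{(n)}(m,\mu)=\sum_{k=0}^N\varphi^0(k)\eta(m-k)$, where $\eta(m)=\sum_{k\ge0}w_\mu(k)\varepsilon(m-k)$.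 (2) If $\nu_u^N<\nu_u^{N+}$, then $S^+\ne\emptyset$, and for every $(c,\varphi^0)\in S^+$ the density $f^0=f_{c,\varphi^0}$ is least favorable in $D_v^u$. Moreover $(\varphi^0_\mu(0),\dots,\varphi^0_\mu(N))=W_N^\mu\varphi^0_N$, $\int_{-\pi}^{\pi}f^0(\lambda)\,d\lambda=2\pi P_0$, and for every $\xi$ with stationary $n$th increments of spectral density $f^0$ one has $\xi^{(n)}(m,\mu)=\sum_{k\ge0}\varphi^0_\mu(k)\varepsilon(m-k)$ with an innovation sequence $\varepsilon$. In both cases $\varphi^0$ solves the extremum problem $\|D_N^\mu A_NW_N^\mu\varphi_N\|^2\to\max$ over absolutely summable $\varphi$ with $|\sum_{k}\varphi(k)e^{-i\lambda k}|^2\in D_v^u$, and $h_{\varphi^0}$ is the spectral characteristic of the optimal estimate for $f^0$ (it lies in $\mathcal L(f^0)$ and $\Delta(h_{\varphi^0};f^0)=\Delta(f^0)$) and is minimax-robust. -/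

import Mathlib

open MeasureTheory Complex Filter Topology
open scoped ENNReal Real

universe w

namespace RobustExtrapolation

noncomputable section

/-! ### Stochastic sequences with stationary increments -/

/-- The `n`th increment with step `s` at time `m`, namely `(1 - B_s)^n ξ (m)`. -/
def increment {Ω : Type w} (n : ℕ) (s : ℤ) (ξ : ℤ → Ω → ℂ) (m : ℤ) : Ω → ℂ :=
  fun ω => ∑ l ∈ Finset.range (n + 1), (-1 : ℂ) ^ l * (n.choose l : ℂ) * ξ (m - l * s) ω

/-- Spectral densities on `(-π, π]`: nonnegative integrable functions. -/
def IsSpectralDensity (f : ℝ → ℝ) : Prop :=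
  IntegrableOn f (Set.Ioc (-π) π) ∧ ∀ᵐ x ∂volume.restrict (Set.Ioc (-π) π), 0 ≤ f x

/-- `ξ` is a (complex) stochastic sequence whose `n`th increments are wide sense stationary with
mean zero and with spectral density `f` (with respect to `dx / 2π`). -/
structure HasSpectralDensity {Ω : Type w} [MeasurableSpace Ω] (P : Measure Ω) (n : ℕ)
    (ξ : ℤ → Ω → ℂ) (f : ℝ → ℝ) : Prop where
  memLp : ∀ s m : ℤ, MemLp (increment n s ξ m) 2 P
  mean : ∀ s m : ℤ, ∫ ω, increment n s ξ m ω ∂P = 0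
  structural : ∀ m₀ m s₁ s₂ : ℤ,
    ∫ ω, increment n s₁ ξ (m₀ + m) ω * (starRingEnd ℂ) (increment n s₂ ξ m₀ ω) ∂P =
      (1 / (2 * π) : ℂ) * ∫ x in (-π)..π, cexp (I * x * m) * (1 - cexp (-(I * s₁ * x))) ^ n *
        (1 - cexp (I * s₂ * x)) ^ n / (x : ℂ) ^ (2 * n) * (f x : ℂ)

/-- `X` lies in the closed linear subspace of `L₂(P)` generated by the variables in `S`. -/
def InClosedSpan {Ω : Type w} [MeasurableSpace Ω] (P : Measure Ω) (S : Set (Ω → ℂ))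
    (X : Ω → ℂ) : Prop :=
  ∀ δ : ℝ≥0∞, 0 < δ → ∃ Y ∈ Submodule.span ℂ S, ∫⁻ ω, ‖X ω - Y ω‖ₑ ^ 2 ∂P < δ

/-- `ε` is an innovation sequence of the `n`th increments of `ξ`: it is centred and orthonormal,
and for every `t` it generates, up to time `t`, the same closed subspace as the increments
`ξ^{(n)}(m, s)`, `m ≤ t`, `s > 0`. -/
structure IsInnovation {Ω : Type w} [MeasurableSpace Ω] (P : Measure Ω) (n : ℕ)
    (ξ ε : ℤ → Ω → ℂ) : Prop where
  memLp : ∀ m, MemLp (ε m) 2 P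
  mean : ∀ m, ∫ ω, ε m ω ∂P = 0
  orthonormal : ∀ m k, ∫ ω, ε m ω * (starRingEnd ℂ) (ε k ω) ∂P = if m = k then 1 else 0
  mem_past : ∀ t m : ℤ, m ≤ t →
    InClosedSpan P {X | ∃ j s : ℤ, j ≤ t ∧ 0 < s ∧ X = increment n s ξ j} (ε m)
  past_mem : ∀ t m s : ℤ, m ≤ t → 0 < s →
    InClosedSpan P {X | ∃ j : ℤ, j ≤ t ∧ X = ε j} (increment n s ξ m)

/-- `η (m) = ∑_{k ≥ 0} c (k) ε (m - k)` for all `m`, with convergence in mean square. -/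
def IsMovingAverage {Ω : Type w} [MeasurableSpace Ω] (P : Measure Ω)
    (η ε : ℤ → Ω → ℂ) (c : ℕ → ℂ) : Prop :=
  ∀ m : ℤ, Tendsto
    (fun K : ℕ => ∫⁻ ω, ‖η m ω - ∑ k ∈ Finset.range K, c k * ε (m - k) ω‖ₑ ^ 2 ∂P)
    atTop (𝓝 0)

/-! ### Coefficients and matrices -/

/-- `|1 - e^{-iμx}|^{2n} / x^{2n}`. -/
def weight (n μ : ℕ) (x : ℝ) : ℝ := ‖1 - cexp (-(I * x * μ))‖ ^ (2 * n) / x ^ (2 * n)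

/-- The function `w_μ` on the unit disk, with `|w_μ(e^{-ix})|² = |1 - e^{-iμx}|^{2n} / x^{2n}`. -/
def wFun (n μ : ℕ) (z : ℂ) : ℂ :=
  cexp ((1 / (4 * π) : ℂ) * ∫ x in (-π)..π,
    (cexp (I * x) + z) / (cexp (I * x) - z) * (Real.log (weight n μ x) : ℂ))

/-- The Taylor coefficients of `w_μ` at `0`. -/
def wCoeff (n μ k : ℕ) : ℂ := iteratedDeriv k (wFun n μ) 0 / (k.factorial : ℂ)

/-- The coefficients `d_μ(k)` of `(∑_j x^{μ j})^n`. -/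
def dCoeff (n μ k : ℕ) : ℂ :=
  PowerSeries.coeff k ((PowerSeries.mk fun j => if μ ∣ j then (1 : ℂ) else 0) ^ n)

/-- The matrix `D_N^μ`. -/
def matD (n μ N : ℕ) : Matrix (Fin (N + 1)) (Fin (N + 1)) ℂ :=
  Matrix.of fun k j => if (k : ℕ) ≤ j then dCoeff n μ (j - k) else 0

/-- The matrix `\hat D_N^μ`. -/
def matDhat (n μ N : ℕ) : Matrix (Fin (N + 1)) (Fin (N + 1)) ℂ :=
  Matrix.of fun k l => if N ≤ (k : ℕ) + l then dCoeff n μ (l + k - N) else 0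

/-- The matrix `A_N`. -/
def matA (N : ℕ) (a : ℕ → ℂ) : Matrix (Fin (N + 1)) (Fin (N + 1)) ℂ :=
  Matrix.of fun k j => if (k : ℕ) + j ≤ N then a (k + j) else 0

/-- The matrix `W_N^μ`. -/
def matW (n μ N : ℕ) : Matrix (Fin (N + 1)) (Fin (N + 1)) ℂ :=
  Matrix.of fun j k => if (k : ℕ) ≤ j then wCoeff n μ (j - k) else 0

/-- The vector of the first `N + 1` terms of a sequence. -/
def head (N : ℕ) (φ : ℕ → ℂ) : Fin (N + 1) → ℂ := fun k => φ k

/-- `φ_μ = W^μ φ`, the convolution of `w_μ` and `φ`. -/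
def phiMu (n μ : ℕ) (φ : ℕ → ℂ) (k : ℕ) : ℂ :=
  ∑ j ∈ Finset.range (k + 1), wCoeff n μ (k - j) * φ j

/-- The vector `D_N^μ A_N W_N^μ φ_N`. -/
def errVec (n μ N : ℕ) (a φ : ℕ → ℂ) : Fin (N + 1) → ℂ :=
  (matD n μ N).mulVec ((matA N a).mulVec ((matW n μ N).mulVec (head N φ)))

/-- `‖D_N^μ A_N W_N^μ φ_N‖²`. -/
def errNormSq (n μ N : ℕ) (a φ : ℕ → ℂ) : ℝ := ∑ j, ‖errVec n μ N a φ j‖ ^ 2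

/-! ### Spectral functions -/

/-- `∑_{k ≥ 0} φ(k) e^{-ixk}`. -/
def symbol (φ : ℕ → ℂ) (x : ℝ) : ℂ := ∑' k : ℕ, φ k * cexp (-(I * x * k))

/-- `∑_{k ≥ 0} φ(k) z^k` is a canonical factor of `f`: it converges in a disk of radius `> 1`, has
no zeros in the closed unit disk, and `f (x) = |∑ φ(k) e^{-ixk}|²`. -/
structure IsCanonicalFactor (φ : ℕ → ℂ) (f : ℝ → ℝ) : Prop where
  radius : ∃ R : ℝ, 1 < R ∧ Summable fun k => ‖φ k‖ * R ^ k
  ne_zero : ∀ z : ℂ, ‖z‖ ≤ 1 → ∑' k : ℕ, φ k * z ^ k ≠ 0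
  eq : ∀ᵐ x ∂volume.restrict (Set.Ioc (-π) π), f x = ‖symbol φ x‖ ^ 2

/-- `b_{μ,N} = D_N^μ a_N`. -/
def bVec (n μ N : ℕ) (a : ℕ → ℂ) : Fin (N + 1) → ℂ := (matD n μ N).mulVec (head N a)

/-- `A_N(e^{ix}) = ∑_{k ≤ N} (D_N^μ a_N)_k e^{ixk}`. -/
def specA (n μ N : ℕ) (a : ℕ → ℂ) (x : ℝ) : ℂ :=
  ∑ k : Fin (N + 1), bVec n μ N a k * cexp (I * x * (k : ℕ))

/-- `r_{μ,N}(e^{ix}) = ∑_{j ≤ N} (D_N^μ A_N φ_{μ,N})_j e^{ixj}`, where `φ_{μ,N} = W_N^μ φ_N`. -/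
def specR (n μ N : ℕ) (a φ : ℕ → ℂ) (x : ℝ) : ℂ :=
  ∑ j : Fin (N + 1), errVec n μ N a φ j * cexp (I * x * (j : ℕ))

/-- `h_{μ,N}(x) = A_N(e^{ix}) - r_{μ,N}(e^{ix}) Φ_μ(e^{-ix})⁻¹`. -/
def specChar (n μ N : ℕ) (a φ : ℕ → ℂ) (x : ℝ) : ℂ :=
  specA n μ N a x - specR n μ N a φ x * (symbol (phiMu n μ φ) x)⁻¹

/-- `max{v, min{u, |c ∑_{k ≤ N} (D_N^μ A_N φ_{μ,N})_k e^{ixk}|²}}`. -/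
def truncDensity (n μ N : ℕ) (a : ℕ → ℂ) (v u : ℝ → ℝ) (c : ℂ) (φ : ℕ → ℂ) (x : ℝ) : ℝ :=
  max (v x) (min (u x) (‖c * specR n μ N a φ x‖ ^ 2))

/-! ### Estimates and errors -/

/-- `Δ(h; f)`, the mean square error at the density `f` of the estimate with spectral
characteristic `h`. -/
def specError (n μ N : ℕ) (a : ℕ → ℂ) (h : ℝ → ℂ) (f : ℝ → ℝ) : ℝ≥0∞ :=
  ENNReal.ofReal (1 / (2 * π)) * ∫⁻ x in Set.Ioc (-π) π,
    ‖specA n μ N a x - h x‖ₑ ^ 2 * ENNReal.ofReal (weight n μ x * f x)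

/-- `h (x) (1 - e^{-ixμ})^n / (ix)^n` belongs to `L₂^{0-}(f)`, the closed subspace of `L₂(f)`
generated by the functions `e^{ixk} (1 - e^{-ixμ})^n / (ix)^n`, `k ≤ -1`. -/
def IsSpectralCharacteristic (n μ : ℕ) (f : ℝ → ℝ) (h : ℝ → ℂ) : Prop :=
  AEMeasurable h (volume.restrict (Set.Ioc (-π) π)) ∧
  ∀ δ : ℝ≥0∞, 0 < δ → ∃ c : ℕ →₀ ℂ,
    ∫⁻ x in Set.Ioc (-π) π,
      ‖h x - c.sum fun k z => z * cexp (-(I * x * (k + 1)))‖ₑ ^ 2 *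
        ENNReal.ofReal (weight n μ x * f x) < δ

/-- `Δ(f) = Δ(h(f); f)`, the least value of `Δ(h; f)`. -/
def optError (n μ N : ℕ) (a : ℕ → ℂ) (f : ℝ → ℝ) : ℝ≥0∞ :=
  ⨅ h : {h : ℝ → ℂ // IsSpectralCharacteristic n μ f h}, specError n μ N a h f

/-- `h` is the spectral characteristic of the optimal linear estimate at the density `f`. -/
def IsOptimal (n μ N : ℕ) (a : ℕ → ℂ) (f : ℝ → ℝ) (h : ℝ → ℂ) : Prop :=
  IsSpectralCharacteristic n μ f h ∧ specError n μ N a h f = optError n μ N a f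

/-- `v_{μ,N}(-i)` for `1 ≤ i ≤ μ n`. -/
def vCoeff (n μ N : ℕ) (a : ℕ → ℂ) (i : ℕ) : ℂ :=
  ∑ l ∈ Finset.range (n + 1), ∑ k : Fin (N + 1),
    if l * μ = i + k then (-1 : ℂ) ^ l * (n.choose l : ℂ) * bVec n μ N a k else 0

/-- The linear estimate of `A_N ξ` from the values `ξ (m)`, `m ≤ -1`, given by
`-∑_{k=-μn}^{-1} v_{μ,N}(k) ξ(k)` plus a linear combination of `ξ^{(n)}(k, μ)`, `k ≤ -1`. -/
def linEstimate {Ω : Type w} (n μ N : ℕ) (a : ℕ → ℂ) (ξ : ℤ → Ω → ℂ) (c : ℕ →₀ ℂ) : Ω → ℂ :=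
  fun ω => -(∑ i ∈ Finset.Icc 1 (μ * n), vCoeff n μ N a i * ξ (-(i : ℤ)) ω) +
    c.sum fun k z => z * increment n μ ξ (-1 - (k : ℤ)) ω

/-- The mean square error of the optimal linear estimate of `A_N ξ = ∑_{k ≤ N} a(k) ξ(k)`: the
infimum of `E |A_N ξ - \hat A_N ξ|²` over the linear estimates. -/
def meanSquareError {Ω : Type w} [MeasurableSpace Ω] (P : Measure Ω) (n μ N : ℕ) (a : ℕ → ℂ)
    (ξ : ℤ → Ω → ℂ) : ℝ≥0∞ :=
  ⨅ c : ℕ →₀ ℂ, ∫⁻ ω, ‖∑ k ∈ Finset.range (N + 1), a k * ξ (k : ℤ) ω -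
    linEstimate n μ N a ξ c ω‖ₑ ^ 2 ∂P

/-- `f₀` is least favorable in the class `D` for the optimal linear estimation of `A_N ξ`: it
maximizes `Δ(f)` over `D`, where `Δ(f)` is the mean square error of the optimal linear estimate of
`A_N ξ` for every stochastic sequence `ξ` with stationary increments of spectral density `f`. -/
structure IsLeastFavorable (n μ N : ℕ) (a : ℕ → ℂ) (D : Set (ℝ → ℝ)) (f₀ : ℝ → ℝ) : Prop where
  mem : f₀ ∈ D
  le : ∀ f ∈ D, optError n μ N a f ≤ optError n μ N a f₀
  error_eq : ∀ f ∈ D, ∀ (Ω : Type w) [MeasurableSpace Ω] (P : Measure Ω) [IsProbabilityMeasure P]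
    (ξ : ℤ → Ω → ℂ), HasSpectralDensity P n ξ f →
      meanSquareError P n μ N a ξ = optError n μ N a f

/-- `h₀` is minimax-robust for the class `D`: it belongs to `H_D = ⋂_{f ∈ D} L₂^{0-}(f)`, the
maximum of `Δ(h₀; f)` over `f ∈ D` is attained, and it is the least possible one over `H_D`. -/
structure IsMinimaxRobust (n μ N : ℕ) (a : ℕ → ℂ) (D : Set (ℝ → ℝ)) (h₀ : ℝ → ℂ) : Prop where
  mem : ∀ f ∈ D, IsSpectralCharacteristic n μ f h₀
  max_attained : ∃ f₁ ∈ D, ∀ f ∈ D, specError n μ N a h₀ f ≤ specError n μ N a h₀ f₁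
  le : ∀ h : ℝ → ℂ, (∀ f ∈ D, IsSpectralCharacteristic n μ f h) →
    ⨆ f ∈ D, specError n μ N a h₀ f ≤ ⨆ f ∈ D, specError n μ N a h f

/-! ### The class of densities and the quantities of the theorem -/

/-- The class `D_v^u`. -/
def bandClass (v u : ℝ → ℝ) (P₀ : ℝ) : Set (ℝ → ℝ) :=
  {f | IsSpectralDensity f ∧
    (∀ᵐ x ∂volume.restrict (Set.Ioc (-π) π), v x ≤ f x ∧ f x ≤ u x) ∧
    1 / (2 * π) * ∫ x in (-π)..π, f x ≤ P₀}

/-- `φ` solves the extremum problem `‖D_N^μ A_N W_N^μ φ_N‖² → max`, `|∑ φ(k) e^{-ixk}|² ∈ D`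
(over absolutely summable sequences, in particular over those that vanish after index `N`). -/
def SolvesExtremum (n μ N : ℕ) (a : ℕ → ℂ) (D : Set (ℝ → ℝ)) (φ : ℕ → ℂ) : Prop :=
  (Summable fun k => ‖φ k‖) ∧ (fun x => ‖symbol φ x‖ ^ 2) ∈ D ∧
  ∀ ψ : ℕ → ℂ, (Summable fun k => ‖ψ k‖) → (fun x => ‖symbol ψ x‖ ^ 2) ∈ D →
    errNormSq n μ N a ψ ≤ errNormSq n μ N a φ

/-- The sequences `φ = (φ(0), …, φ(N), 0, 0, …)` with `‖φ‖² = P₀` such that `φ_N` solves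
`D_N^μ A_N W_N^μ φ_N = α \bar φ_N` or `\hat D_N^μ A_N W_N^μ φ_N = β \bar φ_N`, such that
`v ≤ |∑ φ(k) e^{-ixk}|² ≤ u`, and such that `φ` is a canonical factor of this density. -/
def solutionSet (n μ N : ℕ) (a : ℕ → ℂ) (v u : ℝ → ℝ) (P₀ : ℝ) : Set (ℕ → ℂ) :=
  {φ | (∀ k, N < k → φ k = 0) ∧
    ((∃ α : ℂ, errVec n μ N a φ = α • star (head N φ)) ∨
      (∃ β : ℂ, (matDhat n μ N).mulVec ((matA N a).mulVec ((matW n μ N).mulVec (head N φ))) =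
        β • star (head N φ))) ∧
    (∀ᵐ x ∂volume.restrict (Set.Ioc (-π) π), v x ≤ ‖symbol φ x‖ ^ 2 ∧ ‖symbol φ x‖ ^ 2 ≤ u x) ∧
    ∑ k : Fin (N + 1), ‖φ k‖ ^ 2 = P₀ ∧
    IsCanonicalFactor φ fun x => ‖symbol φ x‖ ^ 2}

/-- The pairs `(c, φ)` with `‖φ‖² = P₀` such that `φ` is a canonical factor of the truncated
density with the parameters `c` and `φ_{μ,N} = W_N^μ φ_N`. -/
def truncSet (n μ N : ℕ) (a : ℕ → ℂ) (v u : ℝ → ℝ) (P₀ : ℝ) : Set (ℂ × (ℕ → ℂ)) :=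
  {p | ∑' k : ℕ, ‖p.2 k‖ ^ 2 = P₀ ∧
    IsCanonicalFactor p.2 (truncDensity n μ N a v u p.1 p.2)}

/-- `ν_u^N`; the supremum of the empty set is `-∞`. -/
def nuSol (n μ N : ℕ) (a : ℕ → ℂ) (v u : ℝ → ℝ) (P₀ : ℝ) : EReal :=
  sSup ((fun φ => ((errNormSq n μ N a φ / P₀ : ℝ) : EReal)) '' solutionSet n μ N a v u P₀)

/-- `ν_u^{N+}`; the supremum of the empty set is `-∞`. -/
def nuTrunc (n μ N : ℕ) (a : ℕ → ℂ) (v u : ℝ → ℝ) (P₀ : ℝ) : EReal :=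
  sSup ((fun p => ((errNormSq n μ N a p.2 / P₀ : ℝ) : EReal)) '' truncSet n μ N a v u P₀)

end

end RobustExtrapolation

open RobustExtrapolation

namespace RobustExtrapolation

noncomputable section

/-! Everything takes place in the algebra of absolutely summable power series, evaluated at `circ x`
= e^{-ix}. The function w_μ belongs to it: log(|x| / |1 - e^{-ix}|) is even and analytic on [-π, π],
so its Fourier coefficients are absolutely summable, and w_μ = ((1 - z^μ) / (1 - z))^n exp(-n L),
where L is the series whose boundary values have that logarithm as real part (`wFun_eq`). Hence for
f = |Φ|² the weighted density is |Φ_μ|² almost everywhere (`weight_mul_eq`).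

Multiply B_N - h by Φ_μ. For h in the span of the past, h Φ_μ contains only strictly negative powers
of e^{ix}, so the part of the product with powers 0, ..., N of e^{ix} is r_φ for every h. Parseval
gives Δ(h; f) ≥ ‖D A W φ_N‖², for any absolutely summable φ (`ofReal_errNormSq_le_optError`). The
function h_φ removes the remaining part exactly. It lies in L(f) for every spectral density f,
although w_μ vanishes on the unit circle when μ > 1; this takes an Abel type regularization
(`isSpectralCharacteristic_specChar`). Thus Δ(f) = ‖D A W φ_N‖² for a canonical factor φ of f.

The maximization is a bang-bang argument (`specError_specChar_le`). One has Δ(h_φ; f) = (1/2π) ∫ g f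
with g = |r_φ|² / |Φ|². For a truncated density f₀ with c ≠ 0, g ≥ |c|⁻² where f₀ is at its upper
bound, g ≤ |c|⁻² where it is at its lower bound, and equality holds elsewhere; so (g - |c|⁻²)(f -
f₀) ≤ 0. Since ∫ f ≤ ∫ f₀, the pair (h_φ, f₀) is a saddle point.

Therefore all pairs in S⁺ share one value ‖D A W φ_N‖², the maximum of Δ over the class, and it
equals ν_u^{N+} P₀. This is part (2). In part (1), φ⁰ attains the same value. The saddle
characteristic of a pair in S⁺ is then optimal at f⁰ too, so by uniqueness (`ae_eq_of_isOptimal`) it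
agrees a.e. with h_{φ⁰}, which inherits the saddle inequality.

On the probabilistic side, D_N^μ inverts the difference operator, so estimation errors are
combinations of increments (`sub_linEstimate_eq`), and the spectral isometry identifies the two
notions of error (`meanSquareError_eq`). The innovations come from inverting the filter of the step
1 increments, whose symbol has no zeros on the closed disk (`exists_innovation`). -/

/-! ### Absolutely summable power series -/

/-- A power series with absolutely summable coefficients. -/
def AbsSummable (F : PowerSeries ℂ) : Prop := Summable fun k => ‖PowerSeries.coeff k F‖

/-- The value of a power series at a point (of the closed unit disk). -/
def evalAt (F : PowerSeries ℂ) (z : ℂ) : ℂ := ∑' k, PowerSeries.coeff k F * z ^ k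

/-- The point `e^{-ix}` of the unit circle. -/
def circ (x : ℝ) : ℂ := cexp (-(I * x))

/-- The sum of the absolute values of the coefficients. -/
def coeffNorm (F : PowerSeries ℂ) : ℝ := ∑' k, ‖PowerSeries.coeff k F‖

lemma norm_circ (x : ℝ) : ‖circ x‖ = 1 := by
  rw [circ, Complex.norm_exp]; simp

lemma circ_pow (x : ℝ) (k : ℕ) : circ x ^ k = cexp (-(I * x * k)) := by
  rw [circ, ← Complex.exp_nat_mul]; congr 1; ring

lemma continuous_circ : Continuous circ := by unfold circ; fun_prop

lemma circ_ne_zero (x : ℝ) : circ x ≠ 0 := Complex.exp_ne_zero _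

lemma symbol_eq_evalAt (φ : ℕ → ℂ) (x : ℝ) : symbol φ x = evalAt (PowerSeries.mk φ) (circ x) := by
  simp [symbol, evalAt, circ_pow]

namespace AbsSummable

variable {F G : PowerSeries ℂ}

lemma summable_norm (hF : AbsSummable F) {z : ℂ} (hz : ‖z‖ ≤ 1) :
    Summable fun k => ‖PowerSeries.coeff k F * z ^ k‖ := by
  refine Summable.of_nonneg_of_le (fun _ => norm_nonneg _) (fun k => ?_) hF
  rw [norm_mul, norm_pow]
  exact mul_le_of_le_one_right (norm_nonneg _) (pow_le_one₀ (norm_nonneg _) hz)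

lemma summable (hF : AbsSummable F) {z : ℂ} (hz : ‖z‖ ≤ 1) :
    Summable fun k => PowerSeries.coeff k F * z ^ k := (hF.summable_norm hz).of_norm

lemma add (hF : AbsSummable F) (hG : AbsSummable G) : AbsSummable (F + G) := by
  refine Summable.of_nonneg_of_le (fun _ => norm_nonneg _) (fun k => ?_) (Summable.add hF hG)
  simpa using norm_add_le _ _

lemma neg (hF : AbsSummable F) : AbsSummable (-F) := by
  simpa [AbsSummable] using hF

lemma sub (hF : AbsSummable F) (hG : AbsSummable G) : AbsSummable (F - G) := by
  rw [sub_eq_add_neg]; exact hF.add hG.neg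

lemma mul (hF : AbsSummable F) (hG : AbsSummable G) : AbsSummable (F * G) := by
  simpa [AbsSummable, PowerSeries.coeff_mul] using
    summable_norm_sum_mul_antidiagonal_of_summable_norm hF hG

lemma smul (hF : AbsSummable F) (c : ℂ) : AbsSummable (c • F) := by
  simpa [AbsSummable] using Summable.mul_left ‖c‖ hF

lemma of_polynomial (P : Polynomial ℂ) : AbsSummable (P : PowerSeries ℂ) := by
  refine summable_of_ne_finset_zero (s := Finset.range (P.natDegree + 1)) (fun k hk => ?_)
  simp only [Finset.mem_range, not_lt] at hk
  simp [Polynomial.coeff_eq_zero_of_natDegree_lt (show P.natDegree < k by omega)]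

lemma one : AbsSummable 1 := by
  simpa using of_polynomial 1

lemma X : AbsSummable PowerSeries.X := by
  simpa using of_polynomial Polynomial.X

lemma pow (hF : AbsSummable F) (m : ℕ) : AbsSummable (F ^ m) := by
  induction m with
  | zero => simpa using one
  | succ m ih => rw [pow_succ]; exact ih.mul hF

lemma sum {ι : Type*} {s : Finset ι} {F : ι → PowerSeries ℂ} (h : ∀ i ∈ s, AbsSummable (F i)) :
    AbsSummable (∑ i ∈ s, F i) := by
  classical
  induction s using Finset.induction_on with
  | empty => simpa using of_polynomial 0
  | insert i s hi ih =>
    rw [Finset.sum_insert hi]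
    exact (h i (by simp)).add (ih fun j hj => h j (by simp [hj]))

lemma eval_add (hF : AbsSummable F) (hG : AbsSummable G) {z : ℂ} (hz : ‖z‖ ≤ 1) :
    evalAt (F + G) z = evalAt F z + evalAt G z := by
  simp only [evalAt, map_add, add_mul]
  exact (hF.summable hz).tsum_add (hG.summable hz)

lemma eval_mul (hF : AbsSummable F) (hG : AbsSummable G) {z : ℂ} (hz : ‖z‖ ≤ 1) :
    evalAt (F * G) z = evalAt F z * evalAt G z := by
  simp only [evalAt]
  rw [tsum_mul_tsum_eq_tsum_sum_antidiagonal_of_summable_norm (hF.summable_norm hz)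
    (hG.summable_norm hz)]
  refine tsum_congr fun k => ?_
  rw [PowerSeries.coeff_mul, Finset.sum_mul]
  refine Finset.sum_congr rfl fun p hp => ?_
  rw [← Finset.HasAntidiagonal.mem_antidiagonal.mp hp, pow_add]; ring

end AbsSummable

lemma evalAt_smul (F : PowerSeries ℂ) (c z : ℂ) : evalAt (c • F) z = c * evalAt F z := by
  simp [evalAt, mul_assoc, tsum_mul_left]

lemma evalAt_neg (F : PowerSeries ℂ) (z : ℂ) : evalAt (-F) z = -evalAt F z := by
  simp [evalAt, tsum_neg]

lemma evalAt_polynomial (P : Polynomial ℂ) (z : ℂ) :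
    evalAt (P : PowerSeries ℂ) z = P.eval z := by
  rw [evalAt, Polynomial.eval_eq_sum_range, tsum_eq_sum (s := Finset.range (P.natDegree + 1))]
  · simp
  · intro k hk
    simp only [Finset.mem_range, not_lt] at hk
    simp [Polynomial.coeff_eq_zero_of_natDegree_lt (show P.natDegree < k by omega)]

lemma evalAt_one (z : ℂ) : evalAt 1 z = 1 := by simpa using evalAt_polynomial 1 z

lemma evalAt_X (z : ℂ) : evalAt PowerSeries.X z = z := by
  simpa using evalAt_polynomial Polynomial.X z

namespace AbsSummable

variable {F G : PowerSeries ℂ}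

lemma eval_sub (hF : AbsSummable F) (hG : AbsSummable G) {z : ℂ} (hz : ‖z‖ ≤ 1) :
    evalAt (F - G) z = evalAt F z - evalAt G z := by
  rw [sub_eq_add_neg, hF.eval_add hG.neg hz, evalAt_neg, sub_eq_add_neg]

lemma eval_pow (hF : AbsSummable F) (m : ℕ) {z : ℂ} (hz : ‖z‖ ≤ 1) :
    evalAt (F ^ m) z = evalAt F z ^ m := by
  induction m with
  | zero => simp [evalAt_one]
  | succ m ih => rw [pow_succ, (hF.pow m).eval_mul hF hz, ih, pow_succ]

lemma norm_eval_le (hF : AbsSummable F) {z : ℂ} (hz : ‖z‖ ≤ 1) : ‖evalAt F z‖ ≤ coeffNorm F := by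
  refine (norm_tsum_le_tsum_norm (hF.summable_norm hz)).trans
    ((hF.summable_norm hz).tsum_le_tsum (fun k => ?_) hF)
  rw [norm_mul, norm_pow]
  exact mul_le_of_le_one_right (norm_nonneg _) (pow_le_one₀ (norm_nonneg _) hz)

lemma continuousOn (hF : AbsSummable F) : ContinuousOn (evalAt F) (Metric.closedBall 0 1) := by
  refine continuousOn_tsum (u := fun k => ‖PowerSeries.coeff k F‖) (fun k => by fun_prop) hF ?_
  intro k z hz
  rw [norm_mul, norm_pow]
  exact mul_le_of_le_one_right (norm_nonneg _) (pow_le_one₀ (norm_nonneg _) (by simpa using hz))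

lemma continuous_eval_circ (hF : AbsSummable F) : Continuous fun x => evalAt F (circ x) :=
  hF.continuousOn.comp_continuous continuous_circ
    (fun x => by simp [norm_circ])

lemma coeffNorm_mul_le (hF : AbsSummable F) (hG : AbsSummable G) :
    coeffNorm (F * G) ≤ coeffNorm F * coeffNorm G := by
  have hs : Summable fun p : ℕ × ℕ => ‖PowerSeries.coeff p.1 F‖ * ‖PowerSeries.coeff p.2 G‖ :=
    Summable.mul_of_nonneg (f := fun k => ‖PowerSeries.coeff k F‖)
      (g := fun k => ‖PowerSeries.coeff k G‖) hF hG (fun _ => norm_nonneg _)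
      (fun _ => norm_nonneg _)
  have h := Summable.tsum_mul_tsum_eq_tsum_sum_antidiagonal (f := fun k => ‖PowerSeries.coeff k F‖)
    (g := fun k => ‖PowerSeries.coeff k G‖) hF hG hs
  rw [coeffNorm, coeffNorm, coeffNorm, h]
  refine Summable.tsum_le_tsum (fun k => ?_) (hF.mul hG)
    (summable_sum_mul_antidiagonal_of_summable_mul (f := fun k => ‖PowerSeries.coeff k F‖)
      (g := fun k => ‖PowerSeries.coeff k G‖) hs)
  rw [PowerSeries.coeff_mul]
  refine (norm_sum_le _ _).trans (le_of_eq ?_)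
  simp

lemma coeffNorm_nonneg (F : PowerSeries ℂ) : 0 ≤ coeffNorm F := tsum_nonneg fun _ => norm_nonneg _

lemma coeffNorm_pow_le (hF : AbsSummable F) (m : ℕ) : coeffNorm (F ^ m) ≤ coeffNorm F ^ m := by
  induction m with
  | zero =>
    rw [pow_zero, pow_zero, coeffNorm, tsum_eq_single 0]
    · simp
    · intro k hk; simp [PowerSeries.coeff_one, hk]
  | succ m ih =>
    rw [pow_succ, pow_succ]
    exact ((hF.pow m).coeffNorm_mul_le hF).trans
      (mul_le_mul_of_nonneg_right ih (coeffNorm_nonneg _))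

end AbsSummable

/-! ### Exponentials of absolutely summable power series. -/

/-- The exponential of an absolutely summable power series. -/
def expSeries (F : PowerSeries ℂ) : PowerSeries ℂ :=
  PowerSeries.mk fun k => ∑' m : ℕ, ((m.factorial : ℂ))⁻¹ * PowerSeries.coeff k (F ^ m)

namespace AbsSummable

variable {F : PowerSeries ℂ}

/-- `coeffNorm` is submultiplicative, so the double series is dominated by the exponential series of
`coeffNorm F`. This justifies exchanging the two summations in `eval_exp`. -/
lemma summable_exp_terms (hF : AbsSummable F) :
    Summable fun p : ℕ × ℕ =>
      ‖((p.1.factorial : ℂ))⁻¹ * PowerSeries.coeff p.2 (F ^ p.1)‖ := by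
  rw [summable_prod_of_nonneg (fun _ => norm_nonneg _)]
  refine ⟨fun m => ?_, ?_⟩
  · simp only [norm_mul]
    exact Summable.mul_left _ (hF.pow m)
  · refine Summable.of_nonneg_of_le (fun m => tsum_nonneg fun _ => norm_nonneg _) (fun m => ?_)
      (Real.summable_pow_div_factorial (coeffNorm F))
    simp only [norm_mul, tsum_mul_left, norm_inv, Complex.norm_natCast]
    rw [div_eq_inv_mul]
    exact mul_le_mul_of_nonneg_left (hF.coeffNorm_pow_le m) (by positivity)

lemma exp (hF : AbsSummable F) : AbsSummable (expSeries F) := by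
  have h := hF.summable_exp_terms.prod_symm
  have h2 := (summable_prod_of_nonneg (fun _ => norm_nonneg _)).mp h
  refine Summable.of_nonneg_of_le (fun _ => norm_nonneg _) (fun k => ?_) h2.2
  simp only [expSeries, PowerSeries.coeff_mk]
  exact norm_tsum_le_tsum_norm (h2.1 k)

lemma eval_exp (hF : AbsSummable F) {z : ℂ} (hz : ‖z‖ ≤ 1) :
    evalAt (expSeries F) z = cexp (evalAt F z) := by
  have h : Summable fun p : ℕ × ℕ =>
      ((p.1.factorial : ℂ))⁻¹ * PowerSeries.coeff p.2 (F ^ p.1) * z ^ p.2 := by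
    refine Summable.of_norm_bounded hF.summable_exp_terms (fun p => ?_)
    rw [norm_mul _ (z ^ p.2), norm_pow]
    exact mul_le_of_le_one_right (norm_nonneg _) (pow_le_one₀ (norm_nonneg _) hz)
  have h2 : Summable (Function.uncurry fun m k : ℕ =>
      ((m.factorial : ℂ))⁻¹ * PowerSeries.coeff k (F ^ m) * z ^ k) := h
  have e1 : evalAt (expSeries F) z = ∑' k : ℕ, ∑' m : ℕ,
      ((m.factorial : ℂ))⁻¹ * PowerSeries.coeff k (F ^ m) * z ^ k := by
    simp only [evalAt, expSeries, PowerSeries.coeff_mk]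
    refine tsum_congr fun k => ?_
    rw [tsum_mul_right]
  rw [e1, h2.tsum_comm, Complex.exp_eq_exp_ℂ, NormedSpace.exp_eq_tsum_div]
  refine tsum_congr fun m => ?_
  simp only [mul_assoc, tsum_mul_left]
  rw [← hF.eval_pow m hz, evalAt]
  ring

end AbsSummable

/-! ### Fourier and Taylor coefficients -/

lemma circ_zpow (x : ℝ) (m : ℤ) : circ x ^ m = cexp (-(I * m) * x) := by
  rw [circ, ← Complex.exp_int_mul]; congr 1; ring

lemma conj_circ (x : ℝ) : (starRingEnd ℂ) (circ x) = (circ x)⁻¹ := by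
  rw [Complex.inv_def, Complex.normSq_eq_norm_sq, norm_circ]; simp

lemma integral_circ_zpow (m : ℤ) :
    ∫ x in (-π)..π, circ x ^ m = if m = 0 then (2 * π : ℂ) else 0 := by
  split_ifs with h
  · subst h; simp; ring
  · have hm : -(I * (m : ℂ)) ≠ 0 := by simp [h]
    simp only [circ_zpow]
    rw [integral_exp_mul_complex hm, div_eq_zero_iff]
    left
    have : -(I * (m : ℂ)) * ((-π : ℝ) : ℂ) = -(I * (m : ℂ)) * (π : ℂ) + m * (2 * π * I) := by
      push_cast; ring
    rw [this, Complex.exp_add, Complex.exp_int_mul_two_pi_mul_I]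
    simp

lemma continuous_circ_zpow (m : ℤ) : Continuous fun x => circ x ^ m :=
  continuous_circ.zpow₀ m fun x => Or.inl (circ_ne_zero x)

/-- Iterated derivatives of a function given on the unit disk by a summable power series. -/
lemma AbsSummable.hasFPowerSeriesOnBall {F : PowerSeries ℂ} (hF : AbsSummable F) {f : ℂ → ℂ}
    (hf : ∀ z : ℂ, ‖z‖ < 1 → f z = evalAt F z) :
    HasFPowerSeriesOnBall f
      (FormalMultilinearSeries.ofScalars ℂ fun k => PowerSeries.coeff k F) 0 1 := by
  refine ⟨?_, by simp, ?_⟩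
  · refine FormalMultilinearSeries.le_radius_of_summable (r := 1) _ ?_
    simpa [AbsSummable, FormalMultilinearSeries.ofScalars_norm] using hF
  · intro y hy
    have hy1 : ‖y‖ < 1 := by
      simpa [Metric.mem_eball, edist_zero_right, enorm_eq_nnnorm, ← NNReal.coe_lt_coe] using hy
    have := (hF.summable hy1.le).hasSum
    rw [zero_add, hf y hy1]
    simpa [FormalMultilinearSeries.ofScalars_apply_eq, evalAt, mul_comm] using this

lemma AbsSummable.iteratedDeriv_eq {F : PowerSeries ℂ} (hF : AbsSummable F) {f : ℂ → ℂ}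
    (hf : ∀ z : ℂ, ‖z‖ < 1 → f z = evalAt F z) (k : ℕ) :
    iteratedDeriv k f 0 / (k.factorial : ℂ) = PowerSeries.coeff k F := by
  have h := hF.hasFPowerSeriesOnBall hf
  have h1 := h.hasFPowerSeriesAt.eq_formalMultilinearSeries
    (h.hasFPowerSeriesAt.analyticAt.hasFPowerSeriesAt)
  have := congrArg (fun p => FormalMultilinearSeries.coeff p k) h1
  simpa [FormalMultilinearSeries.coeff_ofScalars] using this.symm

namespace AbsSummable

variable {F G : PowerSeries ℂ}

/-- Termwise integration by dominated convergence. Fourier coefficients, Parseval, Herglotz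
integrals and Gram matrices of filtered sequences are all obtained from it by choosing `b`. -/
lemma hasSum_integral (hF : AbsSummable F) {b : ℝ → ℂ}
    (hb : IntervalIntegrable b volume (-π) π) :
    HasSum (fun k => PowerSeries.coeff k F * ∫ x in (-π)..π, b x * circ x ^ k)
      (∫ x in (-π)..π, b x * evalAt F (circ x)) := by
  have key : HasSum (fun k => ∫ x in (-π)..π, PowerSeries.coeff k F * (b x * circ x ^ k))
      (∫ x in (-π)..π, b x * evalAt F (circ x)) := by
    refine intervalIntegral.hasSum_integral_of_dominated_convergence
      (fun k x => ‖PowerSeries.coeff k F‖ * ‖b x‖) (fun k => ?_) (fun k => ?_) ?_ ?_ ?_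
    · exact ((intervalIntegrable_iff.mp hb).aestronglyMeasurable.mul
        (continuous_circ.pow k).aestronglyMeasurable).const_mul _
    · refine Eventually.of_forall fun x _ => ?_
      simp [norm_circ]
    · exact Eventually.of_forall fun x _ => Summable.mul_right _ hF
    · simp only [tsum_mul_right]
      exact hb.norm.const_mul _
    · refine Eventually.of_forall fun x _ => ?_
      have := ((hF.summable (norm_circ x).le).hasSum).mul_left (b x)
      refine this.congr_fun ?_ |> fun h => h
      intro k; ring
  simpa only [intervalIntegral.integral_const_mul] using key

lemma integral_eval_mul_zpow (hF : AbsSummable F) (k : ℕ) :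
    ∫ x in (-π)..π, circ x ^ (-(k : ℤ)) * evalAt F (circ x) =
      2 * π * PowerSeries.coeff k F := by
  have h := hF.hasSum_integral ((continuous_circ_zpow (-(k : ℤ))).intervalIntegrable (-π) π)
  rw [← h.tsum_eq, tsum_eq_single k]
  · simp [circ_ne_zero, ← two_mul]; ring
  · intro j hj
    have : ∀ x, circ x ^ (-(k : ℤ)) * circ x ^ j = circ x ^ ((j : ℤ) - k) := fun x => by
      rw [sub_eq_neg_add, zpow_add₀ (circ_ne_zero x), zpow_natCast]
    simp only [this, integral_circ_zpow]
    rw [if_neg (by omega), mul_zero]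

/-- Boundary values determine the Fourier coefficients. Algebraic identities between series, such as
inverses, can therefore be verified pointwise on the circle. -/
lemma ext_circ (hF : AbsSummable F) (hG : AbsSummable G)
    (h : ∀ x, evalAt F (circ x) = evalAt G (circ x)) : F = G := by
  ext k
  have h1 := hF.integral_eval_mul_zpow k
  simp only [h, hG.integral_eval_mul_zpow k] at h1
  have : (2 * π : ℂ) ≠ 0 := by simp [Real.pi_ne_zero]
  exact (mul_left_cancel₀ this h1).symm

/-- Parseval: termwise integration of `F` against its own conjugate. -/
lemma hasSum_sq_norm (hF : AbsSummable F) :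
    HasSum (fun k => 2 * π * ‖PowerSeries.coeff k F‖ ^ 2)
      (∫ x in (-π)..π, ‖evalAt F (circ x)‖ ^ 2) := by
  have hc : Continuous fun x => (starRingEnd ℂ) (evalAt F (circ x)) :=
    Complex.continuous_conj.comp hF.continuous_eval_circ
  have h := hF.hasSum_integral (hc.intervalIntegrable (-π) π)
  have e1 : ∀ k : ℕ, ∫ x in (-π)..π, (starRingEnd ℂ) (evalAt F (circ x)) * circ x ^ k =
      (starRingEnd ℂ) (2 * π * PowerSeries.coeff k F) := by
    intro k
    rw [← hF.integral_eval_mul_zpow k, intervalIntegral.integral_of_le (by linarith [Real.pi_pos]),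
      intervalIntegral.integral_of_le (by linarith [Real.pi_pos]), ← integral_conj]
    refine integral_congr_ae (Eventually.of_forall fun x => ?_)
    simp [conj_circ, mul_comm]
  have e2 : ∀ x : ℝ, (starRingEnd ℂ) (evalAt F (circ x)) * evalAt F (circ x) =
      ((‖evalAt F (circ x)‖ ^ 2 : ℝ) : ℂ) := by
    intro x; rw [Complex.conj_mul']; push_cast; rfl
  simp only [e1, e2, intervalIntegral.integral_ofReal] at h
  rw [← Complex.hasSum_ofReal]
  refine h.congr_fun ?_ |> fun h => h
  intro k
  simp only [map_mul, Complex.conj_ofReal, map_ofNat]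
  have := Complex.conj_mul' (PowerSeries.coeff k F)
  push_cast
  rw [← this]; ring

end AbsSummable

/-! ### Inverses of zero-free power series. -/

/-- The reciprocal of a zero free power series of radius of convergence `> 1`. -/
lemma exists_inverse {φ : ℕ → ℂ} (hr : ∃ R : ℝ, 1 < R ∧ Summable fun k => ‖φ k‖ * R ^ k)
    (h0 : ∀ z : ℂ, ‖z‖ ≤ 1 → ∑' k : ℕ, φ k * z ^ k ≠ 0) :
    AbsSummable (PowerSeries.mk φ) ∧
      ∃ Q : PowerSeries ℂ, AbsSummable Q ∧ Q * PowerSeries.mk φ = 1 := by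
  obtain ⟨R, hR, hs⟩ := hr
  have hR0 : 0 < R := by linarith
  have habs : AbsSummable (PowerSeries.mk φ) := by
    refine Summable.of_nonneg_of_le (fun _ => norm_nonneg _) (fun k => ?_) hs
    simp only [PowerSeries.coeff_mk]
    exact le_mul_of_one_le_right (norm_nonneg _) (one_le_pow₀ hR.le)
  refine ⟨habs, ?_⟩
  have hdiff : DifferentiableOn ℂ (evalAt (PowerSeries.mk φ)) (Metric.ball 0 R) := by
    refine differentiableOn_tsum_of_summable_norm hs (fun k => by fun_prop) Metric.isOpen_ball ?_
    intro k z hz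
    rw [norm_mul, norm_pow, PowerSeries.coeff_mk]
    exact mul_le_mul_of_nonneg_left (pow_le_pow_left₀ (norm_nonneg _) (by simpa using (Metric.mem_ball.mp hz).le) _)
      (norm_nonneg _)
  -- By compactness of the closed unit disk, the series stays zero-free on a disk of radius `δ + 1`.
  have hopen : IsOpen (Metric.ball (0 : ℂ) R ∩ evalAt (PowerSeries.mk φ) ⁻¹' {0}ᶜ) :=
    hdiff.continuousOn.isOpen_inter_preimage Metric.isOpen_ball isOpen_compl_singleton
  obtain ⟨δ, hδ, hsub⟩ := (isCompact_closedBall (0 : ℂ) 1).exists_thickening_subset_open hopen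
    (fun z hz => by
      have hz1 : ‖z‖ ≤ 1 := by simpa using hz
      refine ⟨by simpa using lt_of_le_of_lt hz1 hR, ?_⟩
      simpa [evalAt] using h0 z hz1)
  rw [thickening_closedBall hδ zero_le_one] at hsub
  have hinv : DifferentiableOn ℂ (fun z => (evalAt (PowerSeries.mk φ) z)⁻¹)
      (Metric.ball 0 (δ + 1)) :=
    (hdiff.mono fun z hz => (hsub hz).1).inv fun z hz => (hsub hz).2
  -- A radius strictly between 1 and `δ + 1`: the reciprocal is holomorphic beyond it, and its
  -- Taylor coefficients are absolutely summable at radius 1.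
  obtain ⟨r, hr⟩ : ∃ r : NNReal, (r : ℝ) = 1 + δ / 2 :=
    ⟨(1 + δ / 2).toNNReal, Real.coe_toNNReal _ (by positivity)⟩
  have hps := (hinv.mono (Metric.closedBall_subset_ball
    (show (r : ℝ) < δ + 1 by rw [hr]; linarith))).hasFPowerSeriesOnBall
    (show 0 < r by rw [← NNReal.coe_pos, hr]; positivity)
  set p := cauchyPowerSeries (fun z => (evalAt (PowerSeries.mk φ) z)⁻¹) 0 r
  have hQ : AbsSummable (PowerSeries.mk p.coeff) := by
    have := p.summable_norm_mul_pow (r := 1) (lt_of_lt_of_le (by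
      rw [ENNReal.coe_lt_coe, ← NNReal.coe_lt_coe, hr]; simpa using hδ) hps.r_le)
    refine Summable.of_nonneg_of_le (fun _ => norm_nonneg _) (fun k => ?_) this
    simp [p.norm_apply_eq_norm_coef]
  refine ⟨_, hQ, AbsSummable.ext_circ (hQ.mul habs) AbsSummable.one fun x => ?_⟩
  have hsum := hps.hasSum (y := circ x) (by
    simp only [Metric.mem_eball, edist_zero_right, enorm_eq_nnnorm, ENNReal.coe_lt_coe,
      ← NNReal.coe_lt_coe, coe_nnnorm, norm_circ, hr]
    simpa using hδ)
  have e : evalAt (PowerSeries.mk p.coeff) (circ x) =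
      (evalAt (PowerSeries.mk φ) (circ x))⁻¹ := by
    rw [zero_add] at hsum
    rw [← hsum.tsum_eq, evalAt]
    refine tsum_congr fun k => ?_
    rw [FormalMultilinearSeries.apply_eq_pow_smul_coeff]
    simp [mul_comm]
  rw [hQ.eval_mul habs (norm_circ x).le, e, evalAt_one, inv_mul_cancel₀]
  simpa [evalAt] using h0 (circ x) (norm_circ x).le

/-! ### The function `log (|x| / |1 - e^{-ix}|)` and its Fourier series -/

/-- The continuous function `-log (sinc (x / 2))`, equal to `log (|x| / |1 - e^{-ix}|)`. -/
def logRatio (x : ℝ) : ℝ := -Real.log (Real.sinc (x / 2))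

/-- At 0 the singularity of sin y / y is removable: `sinc` is the slope of `sin` there, with a
shifted power series. -/
lemma analyticAt_sinc (x : ℝ) : AnalyticAt ℝ Real.sinc x := by
  by_cases hx : x = 0
  · subst hx
    rw [Real.sinc_eq_dslope]
    obtain ⟨p, hp⟩ := (Real.analyticAt_sin (x := 0))
    exact hp.has_fpower_series_dslope_fslope.analyticAt
  · have h : AnalyticAt ℝ (fun y => Real.sin y / y) x :=
      Real.analyticAt_sin.div analyticAt_id hx
    refine h.congr ?_
    filter_upwards [isOpen_ne.mem_nhds hx] with y hy
    rw [Real.sinc_of_ne_zero hy]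

lemma sinc_half_pos {x : ℝ} (hx : x ∈ Set.Icc (-π) π) : 0 < Real.sinc (x / 2) := by
  have hπ := Real.pi_pos
  rcases lt_trichotomy x 0 with h | h | h
  · rw [← Real.sinc_neg, Real.sinc_of_ne_zero (by linarith)]
    exact div_pos (Real.sin_pos_of_pos_of_lt_pi (by linarith) (by linarith [hx.1])) (by linarith)
  · simp [h]
  · rw [Real.sinc_of_ne_zero (by linarith)]
    exact div_pos (Real.sin_pos_of_pos_of_lt_pi (by linarith) (by linarith [hx.2])) (by linarith)

lemma analyticAt_logRatio {x : ℝ} (hx : x ∈ Set.Icc (-π) π) : AnalyticAt ℝ logRatio x := by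
  have h1 : AnalyticAt ℝ (fun y : ℝ => Real.sinc (y / 2)) x :=
    (analyticAt_sinc (x / 2)).fun_comp (f := fun y : ℝ => y / 2) (by fun_prop)
  exact (h1.log (sinc_half_pos hx)).neg

lemma continuousOn_logRatio : ContinuousOn logRatio (Set.Icc (-π) π) := fun _ hx =>
  (analyticAt_logRatio hx).continuousAt.continuousWithinAt

lemma logRatio_neg (x : ℝ) : logRatio (-x) = logRatio x := by
  rw [logRatio, logRatio, neg_div, Real.sinc_neg]

lemma norm_one_sub_circ (x : ℝ) : ‖1 - circ x‖ = |x| * |Real.sinc (x / 2)| := by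
  have h : ‖1 - circ x‖ = ‖cexp (I * ((-x : ℝ) : ℂ)) - 1‖ := by
    rw [norm_sub_rev, circ]; push_cast; ring_nf
  rw [h, Complex.norm_exp_I_mul_ofReal_sub_one, neg_div, Real.sin_neg, ← abs_mul, Real.norm_eq_abs,
    mul_neg, abs_neg]
  congr 1
  by_cases hx : x = 0
  · simp [hx]
  · rw [Real.sinc_of_ne_zero (by simpa using hx)]; field_simp

/-- The Fourier coefficients of `logRatio`. -/
def logRatioCoeff (k : ℤ) : ℂ := (1 / (2 * π) : ℂ) * ∫ x in (-π)..π, (logRatio x : ℂ) * circ x ^ k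

lemma intervalIntegrable_logRatio : IntervalIntegrable (fun x => (logRatio x : ℂ)) volume (-π) π := by
  refine ContinuousOn.intervalIntegrable ?_
  rw [Set.uIcc_of_le (by linarith [Real.pi_pos])]
  exact Complex.continuous_ofReal.comp_continuousOn continuousOn_logRatio

lemma logRatioCoeff_neg (k : ℤ) : logRatioCoeff (-k) = logRatioCoeff k := by
  rw [logRatioCoeff, logRatioCoeff]
  congr 1
  have := intervalIntegral.integral_comp_neg (a := -π) (b := π)
    (fun x => (logRatio x : ℂ) * circ x ^ (-k))
  rw [neg_neg] at this
  rw [← this]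
  refine intervalIntegral.integral_congr fun x _ => ?_
  simp only [logRatio_neg, circ_zpow]
  congr 2
  push_cast; ring

lemma conj_logRatioCoeff (k : ℤ) : (starRingEnd ℂ) (logRatioCoeff k) = logRatioCoeff k := by
  conv_rhs => rw [← logRatioCoeff_neg k]
  rw [logRatioCoeff, logRatioCoeff, map_mul]
  congr 1
  · have := map_ofNat (starRingEnd ℂ) 2
    simp [this]
  · rw [intervalIntegral.integral_of_le (by linarith [Real.pi_pos]),
      intervalIntegral.integral_of_le (by linarith [Real.pi_pos]), ← integral_conj]
    refine integral_congr_ae (Eventually.of_forall fun x => ?_)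
    simp [conj_circ]

/-- The endpoint is a variable because `AddCircle` supplies it in the form -π + 2π. Since `circ x`
is e^{-ix}, the k-th coefficient carries the power `k`, not `-k`. -/
lemma fourierCoeffOn_eq_integral_circ {b : ℝ} (hb : b = π) (hab : -π < b) (f : ℝ → ℂ) (k : ℤ) :
    fourierCoeffOn hab f k = (1 / (2 * π) : ℂ) * ∫ x in (-π)..π, f x * circ x ^ k := by
  subst hb
  rw [fourierCoeffOn_eq_integral, Complex.real_smul]
  congr 1
  · push_cast; ring
  · refine intervalIntegral.integral_congr fun x _ => ?_
    simp only [fourier_coe_apply, circ_zpow, smul_eq_mul]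
    rw [mul_comm]
    congr 2
    have : (π : ℂ) ≠ 0 := by simp [Real.pi_ne_zero]
    push_cast; field_simp; ring

/-- Integration by parts: the boundary terms cancel because `logRatio` is even, so |c_k| = |c'_k| /
|k| for k ≠ 0, with c' the coefficients of the derivative. These are square summable by Parseval,
and |c'_k| / |k| ≤ k⁻² + |c'_k|². -/
lemma summable_logRatioCoeff : Summable logRatioCoeff := by
  have hπ := Real.pi_pos
  have hab : -π < π := by linarith
  set f' : ℝ → ℂ := fun x => ((deriv logRatio x : ℝ) : ℂ)
  have hcont : ContinuousOn f' (Set.Icc (-π) π) := Complex.continuous_ofReal.comp_continuousOn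
    fun x hx => (analyticAt_logRatio hx).deriv.continuousAt.continuousWithinAt
  obtain ⟨C, hC⟩ := isCompact_Icc.exists_bound_of_continuousOn hcont
  have hL2 : MemLp f' 2 (volume.restrict (Set.Ioc (-π) π)) :=
    MemLp.of_bound ((hcont.mono Set.Ioc_subset_Icc_self).aestronglyMeasurable measurableSet_Ioc) C
      ((ae_restrict_iff' measurableSet_Ioc).mpr
        (Eventually.of_forall fun x hx => hC x (Set.Ioc_subset_Icc_self hx)))
  have hs := (hasSum_sq_fourierCoeffOn hab hL2).summable
  have hs2 : Summable fun k : ℤ => ((k : ℝ) ^ 2)⁻¹ := by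
    simpa using (Real.summable_one_div_int_pow (p := 2)).mpr one_lt_two
  have hb : ∀ k : ℤ, k ≠ 0 → ‖logRatioCoeff k‖ ≤
      ((k : ℝ) ^ 2)⁻¹ + ‖fourierCoeffOn hab f' k‖ ^ 2 := by
    intro k hk
    have h := fourierCoeffOn_of_hasDerivAt hab (f := fun x => (logRatio x : ℂ)) (f' := f') hk
      (fun x hx => by
        rw [Set.uIcc_of_le hab.le] at hx
        exact (analyticAt_logRatio hx).differentiableAt.hasDerivAt.ofReal_comp)
      (by
        refine ContinuousOn.intervalIntegrable ?_
        rwa [Set.uIcc_of_le hab.le])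
    rw [logRatioCoeff, ← fourierCoeffOn_eq_integral_circ rfl hab, h, logRatio_neg, sub_self,
      mul_zero, zero_sub]
    have hk' : (0 : ℝ) < |(k : ℝ)| := by simpa using hk
    have e : ‖1 / (-2 * π * I * k : ℂ) * -(((π : ℂ) - ((-π : ℝ) : ℂ)) * fourierCoeffOn hab f' k)‖ =
        |(k : ℝ)|⁻¹ * ‖fourierCoeffOn hab f' k‖ := by
      have h2 : (π : ℂ) - ((-π : ℝ) : ℂ) = ((2 * π : ℝ) : ℂ) := by push_cast; ring
      rw [h2, norm_mul, norm_neg, norm_mul, norm_div, norm_mul, norm_mul, norm_mul]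
      simp only [norm_one, norm_neg, Complex.norm_ofNat, Complex.norm_real, Complex.norm_I,
        Complex.norm_intCast, Real.norm_eq_abs, abs_mul, abs_of_pos hπ, abs_two]
      field_simp
    rw [e, ← sq_abs (k : ℝ), ← inv_pow]
    nlinarith [sq_nonneg (|(k : ℝ)|⁻¹ - ‖fourierCoeffOn hab f' k‖),
      sq_nonneg (|(k : ℝ)|⁻¹), sq_nonneg ‖fourierCoeffOn hab f' k‖]
  refine Summable.of_norm_bounded_eventually (hs2.add hs) ?_
  filter_upwards [(Set.finite_singleton (0 : ℤ)).compl_mem_cofinite] with k hk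
  exact hb k hk

/-- Evenness gives equal values at ±π, hence a continuous function on the circle; with summable
coefficients its Fourier series converges to it everywhere. -/
lemma hasSum_logRatio {x : ℝ} (hx : x ∈ Set.Ico (-π) π) :
    HasSum (fun k : ℤ => logRatioCoeff k * circ x ^ (-k)) (logRatio x : ℂ) := by
  have hπ := Real.pi_pos
  have : Fact (0 < 2 * π) := ⟨by linarith⟩
  have hp : -π + 2 * π = π := by ring
  let F : C(AddCircle (2 * π), ℂ) := ⟨AddCircle.liftIco (2 * π) (-π) fun x => (logRatio x : ℂ), by
    refine AddCircle.liftIco_continuous ?_ ?_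
    · rw [hp, logRatio_neg]
    · rw [hp]; exact Complex.continuous_ofReal.comp_continuousOn continuousOn_logRatio⟩
  have hF : ∀ k, fourierCoeff F k = logRatioCoeff k := by
    intro k
    change fourierCoeff (AddCircle.liftIco (2 * π) (-π) fun x => (logRatio x : ℂ)) k = _
    rw [fourierCoeff_liftIco_eq, fourierCoeffOn_eq_integral_circ hp, logRatioCoeff]
  have h := has_pointwise_sum_fourier_series_of_summable (f := F)
    (by simpa only [funext hF] using summable_logRatioCoeff) (x : AddCircle (2 * π))
  have hval : F (x : AddCircle (2 * π)) = (logRatio x : ℂ) := by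
    change AddCircle.liftIco (2 * π) (-π) (fun x => (logRatio x : ℂ)) x = _
    exact AddCircle.liftIco_coe_apply (by rwa [hp])
  rw [hval] at h
  refine h.congr_fun ?_ |> fun h => h
  intro k
  rw [hF, fourier_coe_apply, circ_zpow, smul_eq_mul]
  congr 2
  have : (π : ℂ) ≠ 0 := by simp [Real.pi_ne_zero]
  push_cast; field_simp

/-- The power series whose boundary values have the real part `logRatio`. -/
def logSeries : PowerSeries ℂ :=
  PowerSeries.mk fun k => 2 * logRatioCoeff k - if k = 0 then logRatioCoeff 0 else 0

lemma summable_norm_logRatioCoeff_nat : Summable fun k : ℕ => ‖logRatioCoeff (k : ℤ)‖ :=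
  summable_logRatioCoeff.norm.comp_injective Nat.cast_injective

lemma absSummable_logSeries : AbsSummable logSeries := by
  have h : Summable fun k : ℕ => ‖(if k = 0 then logRatioCoeff 0 else 0 : ℂ)‖ :=
    summable_of_ne_finset_zero (s := {0}) fun k hk => by
      simp only [Finset.mem_singleton] at hk; simp [hk]
  refine Summable.of_nonneg_of_le (fun _ => norm_nonneg _) (fun k => ?_)
    ((summable_norm_logRatioCoeff_nat.mul_left 2).add h)
  simp only [logSeries, PowerSeries.coeff_mk]
  exact (norm_sub_le _ _).trans (by simp)

lemma evalAt_logSeries {z : ℂ} (hz : ‖z‖ ≤ 1) :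
    evalAt logSeries z = 2 * ∑' k : ℕ, logRatioCoeff k * z ^ k - logRatioCoeff 0 := by
  have h1 : AbsSummable (PowerSeries.mk fun k : ℕ => logRatioCoeff k) := by
    simpa [AbsSummable] using summable_norm_logRatioCoeff_nat
  have e : logSeries = (2 : ℂ) • (PowerSeries.mk fun k : ℕ => logRatioCoeff k) -
      logRatioCoeff 0 • (1 : PowerSeries ℂ) := by
    ext k
    simp [logSeries, PowerSeries.coeff_one]
  rw [e, (h1.smul 2).eval_sub (AbsSummable.one.smul _) hz, evalAt_smul, evalAt_smul, evalAt_one,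
    mul_one]
  simp [evalAt]

lemma re_evalAt_logSeries {x : ℝ} (hx : x ∈ Set.Ico (-π) π) :
    (evalAt logSeries (circ x)).re = logRatio x := by
  -- Pairing the indices k and -k counts index 0 twice; this is compensated by the correction at
  -- index 0 in `logSeries`.
  have h := (hasSum_logRatio hx).nat_add_neg
  have h1 : AbsSummable (PowerSeries.mk fun k : ℕ => logRatioCoeff k) := by
    simpa [AbsSummable] using summable_norm_logRatioCoeff_nat
  have h2 := (h1.summable (norm_circ x).le).hasSum
  have h3 := (Complex.hasSum_re h2).mul_left 2
  have h4 := Complex.hasSum_re h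
  have e : ∀ k : ℕ, 2 * (PowerSeries.coeff k (PowerSeries.mk fun k : ℕ => logRatioCoeff k) *
      circ x ^ k).re = (logRatioCoeff k * circ x ^ (-(k : ℤ)) +
        logRatioCoeff (-(k : ℤ)) * circ x ^ (-(-(k : ℤ)))).re := by
    intro k
    have hc : (starRingEnd ℂ) (logRatioCoeff k * circ x ^ k) =
        logRatioCoeff k * circ x ^ (-(k : ℤ)) := by
      rw [map_mul, conj_logRatioCoeff, map_pow, conj_circ, zpow_neg, zpow_natCast, inv_pow]
    rw [← hc, logRatioCoeff_neg, neg_neg, zpow_natCast, Complex.add_re, Complex.conj_re,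
      PowerSeries.coeff_mk]
    ring
  have h5 := h3.congr_fun (g := fun k : ℕ => _) (fun k => (e k).symm)
  have h6 := h5.unique h4
  rw [evalAt_logSeries (norm_circ x).le, Complex.sub_re]
  simp only [neg_zero, zpow_zero, mul_one, Complex.add_re, Complex.ofReal_re,
    PowerSeries.coeff_mk] at h6
  have h7 : (2 * ∑' k : ℕ, logRatioCoeff k * circ x ^ k).re =
      2 * (∑' k : ℕ, logRatioCoeff k * circ x ^ k).re := by simp
  rw [h7]
  linarith

/-! ### The outer function `w_μ` -/

/-- The Herglotz kernel on the unit circle. -/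
def herglotz (z : ℂ) (x : ℝ) : ℂ := (cexp (I * x) + z) / (cexp (I * x) - z)

lemma exp_I_mul_eq (x : ℝ) : cexp (I * x) = (circ x)⁻¹ := by
  rw [circ, ← Complex.exp_neg, neg_neg]

lemma one_sub_ne_zero_of_norm_lt {z : ℂ} (hz : ‖z‖ < 1) : 1 - z ≠ 0 := by
  intro h
  rw [← sub_eq_zero.mp h] at hz
  simp at hz

lemma exp_sub_ne_zero {z : ℂ} (hz : ‖z‖ < 1) (x : ℝ) : cexp (I * x) - z ≠ 0 := by
  intro h
  rw [← sub_eq_zero.mp h, exp_I_mul_eq, norm_inv, norm_circ] at hz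
  simp at hz

lemma continuous_herglotz {z : ℂ} (hz : ‖z‖ < 1) : Continuous (herglotz z) := by
  unfold herglotz
  exact Continuous.div (by fun_prop) (by fun_prop) (exp_sub_ne_zero hz)

lemma evalAt_geometric {z w : ℂ} (hz : ‖z * w‖ < 1) :
    evalAt (PowerSeries.mk fun k => z ^ k) w = (1 - z * w)⁻¹ := by
  rw [← tsum_geometric_of_norm_lt_one hz, evalAt]
  exact tsum_congr fun k => by rw [PowerSeries.coeff_mk, mul_pow]

lemma absSummable_geometric {z : ℂ} (hz : ‖z‖ < 1) :
    AbsSummable (PowerSeries.mk fun k => z ^ k) := by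
  simpa [AbsSummable] using summable_geometric_of_lt_one (norm_nonneg z) hz

/-- The kernel is 1 + 2 ∑_{k ≥ 1} z^k e^{-ixk}, so integrating against it produces Taylor
coefficients from Fourier coefficients. -/
lemma herglotz_eq {z : ℂ} (hz : ‖z‖ < 1) (x : ℝ) :
    herglotz z x = 2 * evalAt (PowerSeries.mk fun k => z ^ k) (circ x) - 1 := by
  have hzc : ‖z * circ x‖ < 1 := by rwa [norm_mul, norm_circ, mul_one]
  rw [evalAt_geometric hzc, herglotz, exp_I_mul_eq]
  have h1 := one_sub_ne_zero_of_norm_lt hzc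
  have h2 := circ_ne_zero x
  have h3 : (circ x)⁻¹ - z = (1 - z * circ x) * (circ x)⁻¹ := by field_simp
  have h4 : (1 - z * circ x) * (1 - z * circ x)⁻¹ = 1 := mul_inv_cancel₀ h1
  have h5 : circ x * (circ x)⁻¹ = 1 := mul_inv_cancel₀ h2
  rw [h3, div_eq_iff (mul_ne_zero h1 (inv_ne_zero h2))]
  linear_combination (-2 * (circ x)⁻¹) * h4 - z * h5

lemma integral_herglotz_logRatio {z : ℂ} (hz : ‖z‖ < 1) :
    ∫ x in (-π)..π, herglotz z x * logRatio x = 2 * π * evalAt logSeries z := by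
  have h := (absSummable_geometric hz).hasSum_integral intervalIntegrable_logRatio
  have hint : IntervalIntegrable (fun x => (logRatio x : ℂ) *
      evalAt (PowerSeries.mk fun k => z ^ k) (circ x)) volume (-π) π :=
    intervalIntegrable_logRatio.mul_continuousOn
      ((absSummable_geometric hz).continuous_eval_circ.continuousOn)
  have e : ∀ x, herglotz z x * logRatio x = 2 * ((logRatio x : ℂ) *
      evalAt (PowerSeries.mk fun k => z ^ k) (circ x)) - logRatio x := fun x => by
    rw [herglotz_eq hz]; ring
  simp only [e]
  rw [intervalIntegral.integral_sub (hint.const_mul 2) intervalIntegrable_logRatio,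
    intervalIntegral.integral_const_mul, ← h.tsum_eq, evalAt_logSeries hz.le]
  have hπ : (2 * π : ℂ) ≠ 0 := by simp [Real.pi_ne_zero]
  have h0 : ∫ x in (-π)..π, (logRatio x : ℂ) = 2 * π * logRatioCoeff 0 := by
    rw [logRatioCoeff]; field_simp
  have hk : ∀ k : ℕ, PowerSeries.coeff k (PowerSeries.mk fun k => z ^ k) *
      (∫ x in (-π)..π, (logRatio x : ℂ) * circ x ^ k) = 2 * π * (logRatioCoeff k * z ^ k) := by
    intro k
    rw [logRatioCoeff, PowerSeries.coeff_mk]; field_simp; simp only [zpow_natCast]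
  simp only [h0, hk, tsum_mul_left]
  ring

lemma integral_exp_eq_circleAverage (f : ℂ → ℂ) :
    ∫ x in (-π)..π, f (cexp (I * x)) = 2 * π * Real.circleAverage f 0 1 := by
  rw [Real.circleAverage_def]
  have hper : Function.Periodic (fun x : ℝ => f (cexp (I * x))) (2 * π) := by
    intro x
    have : I * ((x + 2 * π : ℝ) : ℂ) = I * x + 2 * π * I := by push_cast; ring
    simp only [this, Complex.exp_add, Complex.exp_two_pi_mul_I, mul_one]
  have h := hper.intervalIntegral_add_eq (-π) 0
  rw [show -π + 2 * π = π by ring, zero_add] at h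
  rw [h, Complex.real_smul]
  have hπ : (π : ℂ) ≠ 0 := by simp [Real.pi_ne_zero]
  push_cast
  rw [mul_inv_cancel_left₀ (by simp [hπ])]
  refine intervalIntegral.integral_congr fun x _ => ?_
  simp [circleMap, mul_comm]

/-- The Schwarz integral formula for functions that vanish at the origin. -/
lemma integral_herglotz_re {F : ℂ → ℂ} (hF : DiffContOnCl ℂ F (Metric.ball 0 1)) (hF0 : F 0 = 0)
    {z : ℂ} (hz : ‖z‖ < 1) :
    ∫ x in (-π)..π, herglotz z x * (F (cexp (I * x))).re = 2 * π * F z := by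
  have hcF : Continuous fun x : ℝ => F (cexp (I * x)) :=
    hF.continuousOn.comp_continuous (by fun_prop) fun x => by
      rw [closure_ball _ one_ne_zero, exp_I_mul_eq]; simp [norm_circ]
  have hcH := continuous_herglotz hz
  have h1 : ∫ x in (-π)..π, herglotz z x * F (cexp (I * x)) = 2 * π * (2 * F z) := by
    have hF' : DiffContOnCl ℂ F (Metric.ball 0 |(1 : ℝ)|) := by simpa only [abs_one] using hF
    have a1 := hF'.circleAverage_smul_div (w := z) (by simpa only [abs_one, Metric.mem_ball, dist_zero_right] using hz)
    have a2 := hF'.circleAverage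
    have b1 := integral_exp_eq_circleAverage fun ζ => ((ζ - 0) / (ζ - z)) • F ζ
    have b2 := integral_exp_eq_circleAverage F
    rw [a1] at b1
    rw [a2, hF0, mul_zero] at b2
    have e : ∀ x : ℝ, herglotz z x * F (cexp (I * x)) =
        2 * (((cexp (I * x) - 0) / (cexp (I * x) - z)) • F (cexp (I * x))) - F (cexp (I * x)) := by
      intro x
      have := exp_sub_ne_zero hz x
      rw [herglotz, smul_eq_mul]; field_simp; ring
    simp only [e]
    rw [intervalIntegral.integral_sub, intervalIntegral.integral_const_mul, b1, b2]
    · ring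
    · refine Continuous.intervalIntegrable ?_ _ _
      exact continuous_const.mul ((Continuous.div (by fun_prop) (by fun_prop)
        (exp_sub_ne_zero hz)).smul hcF)
    · exact hcF.intervalIntegrable _ _
  have h2 : ∫ x in (-π)..π, herglotz z x * (starRingEnd ℂ) (F (cexp (I * x))) = 0 := by
    -- On the unit circle the conjugate of the kernel is the boundary value of `K`, holomorphic on
    -- the closed disk. The mean value property for `K • F`, which vanishes at 0, removes the
    -- conjugate half of the real part.
    set K : ℂ → ℂ := fun ζ => (1 + (starRingEnd ℂ) z * ζ) / (1 - (starRingEnd ℂ) z * ζ)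
    have hK : DiffContOnCl ℂ K (Metric.ball 0 |(1 : ℝ)|) := by
      refine DifferentiableOn.diffContOnCl ?_
      rw [abs_one, closure_ball _ one_ne_zero]
      refine DifferentiableOn.div (by fun_prop) (by fun_prop) fun ζ hζ => ?_
      refine one_sub_ne_zero_of_norm_lt ?_
      rw [norm_mul, RCLike.norm_conj]
      exact mul_lt_one_of_nonneg_of_lt_one_left (norm_nonneg _) hz (by simpa using hζ)
    have hKF : DiffContOnCl ℂ (fun ζ => K ζ • F ζ) (Metric.ball 0 |(1 : ℝ)|) :=
      hK.smul (by simpa using hF)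
    have b := integral_exp_eq_circleAverage fun ζ => K ζ • F ζ
    rw [hKF.circleAverage, hF0, smul_zero, mul_zero] at b
    have e : ∀ x : ℝ, herglotz z x * (starRingEnd ℂ) (F (cexp (I * x))) =
        (starRingEnd ℂ) (K (cexp (I * x)) • F (cexp (I * x))) := by
      intro x
      rw [smul_eq_mul, map_mul]
      congr 1
      simp only [K, herglotz, map_div₀, map_add, map_sub, map_one, map_mul, Complex.conj_conj,
        exp_I_mul_eq, map_inv₀, conj_circ, inv_inv]
      have h3 := circ_ne_zero x
      have h4 : (circ x)⁻¹ - z = (1 - z * circ x) * (circ x)⁻¹ := by field_simp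
      have h5 : 1 - z * circ x ≠ 0 := one_sub_ne_zero_of_norm_lt (by
        rwa [norm_mul, norm_circ, mul_one])
      rw [h4]; field_simp
    simp only [e]
    rw [intervalIntegral.integral_of_le (by linarith [Real.pi_pos]), integral_conj,
      ← intervalIntegral.integral_of_le (by linarith [Real.pi_pos]), b, map_zero]
  have e : ∀ x : ℝ, herglotz z x * (F (cexp (I * x))).re =
      (1 / 2 : ℂ) * (herglotz z x * F (cexp (I * x))) +
        (1 / 2 : ℂ) * (herglotz z x * (starRingEnd ℂ) (F (cexp (I * x)))) := by
    intro x
    rw [Complex.re_eq_add_conj]; ring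
  simp only [e]
  rw [intervalIntegral.integral_add, intervalIntegral.integral_const_mul,
    intervalIntegral.integral_const_mul, h1, h2]
  · ring
  · exact (continuous_const.mul (hcH.mul hcF)).intervalIntegrable _ _
  · exact (continuous_const.mul (hcH.mul (Complex.continuous_conj.comp hcF))).intervalIntegrable _ _

/-- A radial comparison used for dominated convergence. -/
lemma norm_one_sub_le_two_mul {ζ : ℂ} (hζ : ‖ζ‖ = 1) {ρ : ℝ} (h0 : 0 ≤ ρ)
    (h1 : ρ ≤ 1) : ‖1 - ζ‖ ≤ 2 * ‖1 - ρ * ζ‖ := by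
  have a : ‖1 - ζ‖ ≤ ‖1 - ρ * ζ‖ + (1 - ρ) := by
    have : 1 - ζ = (1 - ρ * ζ) - ((1 - ρ : ℝ) : ℂ) * ζ := by push_cast; ring
    rw [this]
    refine (norm_sub_le _ _).trans (add_le_add le_rfl ?_)
    rw [norm_mul, hζ, mul_one, Complex.norm_real, Real.norm_eq_abs, abs_of_nonneg (by linarith)]
  have b : 1 - |ρ| ≤ ‖1 - ρ * ζ‖ := by
    have := norm_sub_norm_le (1 : ℂ) (ρ * ζ)
    rwa [norm_one, norm_mul, hζ, mul_one, Complex.norm_real, Real.norm_eq_abs] at this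
  rw [abs_of_nonneg h0] at b
  linarith

/-- A bound uniform in ρ: it is the integrable majorant for the radial limit in
`integral_herglotz_log_norm`. -/
lemma abs_log_norm_le {ζ : ℂ} (hζ : ‖ζ‖ = 1) (hζ1 : ζ ≠ 1) {ρ : ℝ} (h0 : 0 ≤ ρ) (h1 : ρ ≤ 1) :
    |Real.log ‖1 - ρ * ζ‖| ≤ Real.log 2 + |Real.log ‖1 - ζ‖| := by
  have hpos : 0 < ‖1 - ζ‖ := norm_pos_iff.mpr (sub_ne_zero.mpr (Ne.symm hζ1))
  have hle := norm_one_sub_le_two_mul hζ h0 h1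
  have hpos2 : 0 < ‖1 - ρ * ζ‖ := by linarith
  have hup : ‖1 - ρ * ζ‖ ≤ 2 := by
    refine (norm_sub_le _ _).trans ?_
    rw [norm_one, norm_mul, hζ, mul_one, Complex.norm_real, Real.norm_eq_abs, abs_of_nonneg h0]
    linarith
  rw [abs_le]
  constructor
  · have := Real.log_le_log hpos hle
    rw [Real.log_mul two_ne_zero hpos2.ne'] at this
    have := neg_abs_le (Real.log ‖1 - ζ‖)
    linarith
  · have := Real.log_le_log hpos2 hup
    have := abs_nonneg (Real.log ‖1 - ζ‖)
    linarith

lemma norm_circ_pow (x : ℝ) (k : ℕ) : ‖circ x ^ k‖ = 1 := by rw [norm_pow, norm_circ, one_pow]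

lemma norm_one_sub_mul_exp_pow (ρ : ℝ) (μ : ℕ) (x : ℝ) :
    ‖1 - (ρ : ℂ) * cexp (I * x) ^ μ‖ = ‖1 - (ρ : ℂ) * circ x ^ μ‖ := by
  rw [← RCLike.norm_conj, exp_I_mul_eq, ← conj_circ]
  simp

lemma countable_circ_pow_eq_one {μ : ℕ} (hμ : 1 ≤ μ) : {x : ℝ | circ x ^ μ = 1}.Countable := by
  refine (Set.countable_range fun k : ℤ => -(2 * π * k / μ : ℝ)).mono fun x hx => ?_
  have hx' : circ x ^ μ = 1 := hx
  rw [circ_pow, Complex.exp_eq_one_iff] at hx'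
  obtain ⟨k, hk⟩ := hx'
  refine ⟨k, ?_⟩
  have h2 : -((x : ℂ) * μ) = k * (2 * π) := by
    have : I * (-((x : ℂ) * μ)) = I * (k * (2 * π)) := by linear_combination hk
    exact mul_left_cancel₀ I_ne_zero this
  have h3 : -(x * μ) = k * (2 * π) := by exact_mod_cast h2
  have hμ0 : (μ : ℝ) ≠ 0 := by positivity
  simp only
  field_simp
  linarith

lemma ae_circ_pow_ne_one {μ : ℕ} (hμ : 1 ≤ μ) : ∀ᵐ x : ℝ, circ x ^ μ ≠ 1 := by
  have := (countable_circ_pow_eq_one hμ).ae_notMem volume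
  simpa using this

lemma intervalIntegrable_log_norm_one_sub (μ : ℕ) :
    IntervalIntegrable (fun x => Real.log ‖1 - circ x ^ μ‖) volume (-π) π := by
  have h : CircleIntegrable (fun z => Real.log ‖1 - z ^ μ‖) 0 1 :=
    MeromorphicOn.circleIntegrable_log_norm (fun z _ => by fun_prop)
  have e : (fun x : ℝ => Real.log ‖1 - circleMap 0 1 x ^ μ‖) =
      fun x => Real.log ‖1 - circ x ^ μ‖ := by
    ext x
    have := norm_one_sub_mul_exp_pow 1 μ x
    simp only [Complex.ofReal_one, one_mul] at this
    rw [← this, circleMap, mul_comm I]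
    simp
  have h' : IntervalIntegrable (fun x => Real.log ‖1 - circ x ^ μ‖) volume 0 (2 * π) := by
    rw [← e]; exact h
  refine Function.Periodic.intervalIntegrable₀ (T := 2 * π) (fun x => ?_)
    (by simp [Real.pi_ne_zero]) h' _ _
  have : circ (x + 2 * π) = circ x := by
    rw [circ, circ, show -(I * ((x + 2 * π : ℝ) : ℂ)) = -(I * x) - 2 * π * I by push_cast; ring,
      Complex.exp_sub, Complex.exp_two_pi_mul_I, div_one]
  rw [this]

/-- For 0 < ρ < 1 the function log(1 - ρ w^μ) is holomorphic on the closed disk and vanishes at 0,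
so the Schwarz formula applies. Letting ρ tend to 1 handles the logarithmic singularities on the
circle. -/
lemma integral_herglotz_log_norm {μ : ℕ} (hμ : 1 ≤ μ) {z : ℂ} (hz : ‖z‖ < 1) :
    ∫ x in (-π)..π, herglotz z x * Real.log ‖1 - circ x ^ μ‖ = 2 * π * Complex.log (1 - z ^ μ) := by
  have hslit : ∀ {w : ℂ}, ‖w‖ < 1 → 1 - w ∈ Complex.slitPlane := fun {w} hw => by
    left
    have := (Complex.re_le_norm w)
    simp only [Complex.sub_re, Complex.one_re]; linarith
  have hev : ∀ᶠ ρ in 𝓝[<] (1 : ℝ), 0 < ρ ∧ ρ < 1 := by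
    filter_upwards [Ioo_mem_nhdsLT (show (0 : ℝ) < 1 by norm_num)] with ρ hρ using hρ
  have hρval : ∀ ρ : ℝ, 0 < ρ → ρ < 1 →
      ∫ x in (-π)..π, herglotz z x * Real.log ‖1 - (ρ : ℂ) * circ x ^ μ‖ =
        2 * π * Complex.log (1 - ρ * z ^ μ) := by
    intro ρ h0 h1
    have hlt : ∀ w : ℂ, ‖w‖ ≤ 1 → ‖(ρ : ℂ) * w ^ μ‖ < 1 := by
      intro w hw
      rw [norm_mul, norm_pow, Complex.norm_real, Real.norm_eq_abs, abs_of_pos h0]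
      have := pow_le_one₀ (n := μ) (norm_nonneg w) hw
      nlinarith
    have hF : DiffContOnCl ℂ (fun w : ℂ => Complex.log (1 - ρ * w ^ μ)) (Metric.ball 0 1) := by
      refine DifferentiableOn.diffContOnCl ?_
      rw [closure_ball _ one_ne_zero]
      exact DifferentiableOn.clog (by fun_prop) fun w hw => hslit (hlt w (by simpa using hw))
    have := integral_herglotz_re hF (by simp [show μ ≠ 0 by omega]) hz
    rw [← this]
    refine intervalIntegral.integral_congr fun x _ => ?_
    simp only [Complex.log_re, norm_one_sub_mul_exp_pow]
  have hlim1 : Tendsto (fun ρ : ℝ => ∫ x in (-π)..π,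
      herglotz z x * Real.log ‖1 - (ρ : ℂ) * circ x ^ μ‖) (𝓝[<] 1)
      (𝓝 (∫ x in (-π)..π, herglotz z x * Real.log ‖1 - circ x ^ μ‖)) := by
    have hint := intervalIntegrable_log_norm_one_sub μ
    refine intervalIntegral.tendsto_integral_filter_of_dominated_convergence
      (fun x => ‖herglotz z x‖ * (Real.log 2 + |Real.log ‖1 - circ x ^ μ‖|)) ?_ ?_ ?_ ?_
    · refine Eventually.of_forall fun ρ => Measurable.aestronglyMeasurable ?_
      have h1 := (continuous_herglotz hz).measurable
      have h2 : Measurable circ := continuous_circ.measurable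
      fun_prop
    · filter_upwards [hev] with ρ hρ
      filter_upwards [ae_circ_pow_ne_one hμ] with x hx _
      rw [norm_mul, Complex.norm_real, Real.norm_eq_abs]
      exact mul_le_mul_of_nonneg_left
        (abs_log_norm_le (norm_circ_pow x μ) hx hρ.1.le hρ.2.le) (norm_nonneg _)
    · exact (intervalIntegrable_const.add hint.abs).continuousOn_mul
        (continuous_herglotz hz).norm.continuousOn
    · filter_upwards [ae_circ_pow_ne_one hμ] with x hx _
      have hne : ‖1 - circ x ^ μ‖ ≠ 0 := norm_ne_zero_iff.mpr (sub_ne_zero.mpr (Ne.symm hx))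
      have hc : ContinuousAt (fun ρ : ℝ => ‖1 - (ρ : ℂ) * circ x ^ μ‖) 1 := by fun_prop
      have hc2 := hc.log (by simpa using hne)
      have hc3 : Tendsto (fun ρ : ℝ => Real.log ‖1 - (ρ : ℂ) * circ x ^ μ‖) (𝓝[<] 1)
          (𝓝 (Real.log ‖1 - circ x ^ μ‖)) := by
        simpa using hc2.tendsto.mono_left nhdsWithin_le_nhds
      exact ((Complex.continuous_ofReal.tendsto _).comp hc3).const_mul _
  have hlim2 : Tendsto (fun ρ : ℝ => 2 * π * Complex.log (1 - ρ * z ^ μ)) (𝓝[<] 1)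
      (𝓝 (2 * π * Complex.log (1 - z ^ μ))) := by
    have hc : ContinuousAt (fun ρ : ℝ => (1 : ℂ) - ρ * z ^ μ) 1 := by fun_prop
    have hzμ : ‖z ^ μ‖ < 1 := by
      rw [norm_pow]; exact pow_lt_one₀ (norm_nonneg _) hz (by omega)
    have hc2 := hc.clog (by simpa using hslit hzμ)
    have hc3 : Tendsto (fun ρ : ℝ => Complex.log (1 - ρ * z ^ μ)) (𝓝[<] 1)
        (𝓝 (Complex.log (1 - z ^ μ))) := by
      simpa using hc2.tendsto.mono_left nhdsWithin_le_nhds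
    exact hc3.const_mul _
  refine tendsto_nhds_unique hlim1 (hlim2.congr' ?_)
  filter_upwards [hev] with ρ hρ
  exact (hρval ρ hρ.1 hρ.2).symm

/-! ### The power series of w_μ. -/

/-- `∑_{j < μ} X^j`. -/
def geomPoly (μ : ℕ) : PowerSeries ℂ := ∑ j ∈ Finset.range μ, PowerSeries.X ^ j

lemma absSummable_geomPoly (μ : ℕ) : AbsSummable (geomPoly μ) :=
  AbsSummable.sum fun _ _ => AbsSummable.X.pow _

lemma geomPoly_mul (μ : ℕ) :
    geomPoly μ * (1 - PowerSeries.X) = 1 - PowerSeries.X ^ μ :=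
  geom_sum_mul_neg _ _

lemma absSummable_one_sub_X : AbsSummable (1 - PowerSeries.X) := AbsSummable.one.sub AbsSummable.X

lemma evalAt_one_sub_X {z : ℂ} (hz : ‖z‖ ≤ 1) : evalAt (1 - PowerSeries.X) z = 1 - z := by
  rw [AbsSummable.one.eval_sub AbsSummable.X hz, evalAt_one, evalAt_X]

lemma evalAt_geomPoly_mul (μ : ℕ) {z : ℂ} (hz : ‖z‖ ≤ 1) :
    evalAt (geomPoly μ) z * (1 - z) = 1 - z ^ μ := by
  rw [← evalAt_one_sub_X hz, ← (absSummable_geomPoly μ).eval_mul absSummable_one_sub_X hz,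
    geomPoly_mul, AbsSummable.one.eval_sub (AbsSummable.X.pow μ) hz, evalAt_one,
    AbsSummable.X.eval_pow μ hz, evalAt_X]

/-- The factor `s^{-n}` of `w_μ`, with `|s(e^{-ix})| = |x| / |1 - e^{-ix}|`. -/
def ratioSeries (n : ℕ) : PowerSeries ℂ := expSeries ((-(n : ℂ)) • logSeries)

/-- The inverse of `ratioSeries`. -/
def ratioInvSeries (n : ℕ) : PowerSeries ℂ := expSeries ((n : ℂ) • logSeries)

lemma absSummable_ratioSeries (n : ℕ) : AbsSummable (ratioSeries n) :=
  (absSummable_logSeries.smul _).exp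

lemma absSummable_ratioInvSeries (n : ℕ) : AbsSummable (ratioInvSeries n) :=
  (absSummable_logSeries.smul _).exp

lemma evalAt_ratioSeries (n : ℕ) {z : ℂ} (hz : ‖z‖ ≤ 1) :
    evalAt (ratioSeries n) z = cexp (-(n * evalAt logSeries z)) := by
  rw [ratioSeries, (absSummable_logSeries.smul _).eval_exp hz, evalAt_smul, neg_mul]

lemma ratioSeries_mul_inv (n : ℕ) : ratioInvSeries n * ratioSeries n = 1 := by
  refine ((absSummable_ratioInvSeries n).mul (absSummable_ratioSeries n)).ext_circ
    AbsSummable.one fun x => ?_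
  rw [(absSummable_ratioInvSeries n).eval_mul (absSummable_ratioSeries n) (norm_circ x).le,
    evalAt_ratioSeries n (norm_circ x).le, ratioInvSeries,
    (absSummable_logSeries.smul _).eval_exp (norm_circ x).le, evalAt_smul, ← Complex.exp_add,
    add_neg_cancel, Complex.exp_zero, evalAt_one]

/-- The power series of `w_μ`. -/
def wSeries (n μ : ℕ) : PowerSeries ℂ := geomPoly μ ^ n * ratioSeries n

lemma absSummable_wSeries (n μ : ℕ) : AbsSummable (wSeries n μ) :=
  ((absSummable_geomPoly μ).pow n).mul (absSummable_ratioSeries n)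

lemma evalAt_wSeries (n μ : ℕ) {z : ℂ} (hz : ‖z‖ ≤ 1) :
    evalAt (wSeries n μ) z = evalAt (geomPoly μ) z ^ n * evalAt (ratioSeries n) z := by
  rw [wSeries, ((absSummable_geomPoly μ).pow n).eval_mul (absSummable_ratioSeries n) hz,
    (absSummable_geomPoly μ).eval_pow n hz]

lemma abs_mul_exp_neg_logRatio {x : ℝ} (hx : x ∈ Set.Ioc (-π) π) :
    |x| * Real.exp (-logRatio x) = ‖1 - circ x‖ := by
  have hs := sinc_half_pos (Set.Ioc_subset_Icc_self hx)
  rw [norm_one_sub_circ, logRatio, neg_neg, Real.exp_log hs, abs_of_pos hs]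

lemma ae_restrict_Ioc {p : ℝ → Prop} (h : ∀ᵐ x : ℝ, x ∈ Set.Ioo (-π) π → p x) :
    ∀ᵐ x ∂volume.restrict (Set.Ioc (-π) π), p x := by
  rw [Measure.restrict_congr_set Ioo_ae_eq_Ioc.symm]
  exact (ae_restrict_iff' measurableSet_Ioo).mpr h

lemma ae_restrict_Ioc_ne_zero :
    ∀ᵐ x ∂volume.restrict (Set.Ioc (-π) π), x ∈ Set.Ioo (-π) π ∧ x ≠ 0 := by
  refine ae_restrict_Ioc ?_
  filter_upwards [(Set.countable_singleton (0 : ℝ)).ae_notMem volume] with x hx hx2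
  exact ⟨hx2, by simpa using hx⟩

lemma norm_evalAt_ratioSeries (n : ℕ) {x : ℝ} (hx : x ∈ Set.Ioo (-π) π) :
    ‖evalAt (ratioSeries n) (circ x)‖ = Real.exp (-logRatio x) ^ n := by
  rw [evalAt_ratioSeries n (norm_circ x).le, Complex.norm_exp, ← Real.exp_nat_mul]
  simp [re_evalAt_logSeries (Set.Ioo_subset_Ico_self hx)]

lemma weight_eq (n μ : ℕ) (x : ℝ) : weight n μ x = ((‖1 - circ x ^ μ‖ / |x|) ^ n) ^ 2 := by
  rw [weight, ← circ_pow, ← pow_mul, mul_comm n 2, div_pow, pow_mul |x|, sq_abs, pow_mul x]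

lemma norm_sq_evalAt_wSeries (n μ : ℕ) {x : ℝ} (hx : x ∈ Set.Ioo (-π) π) (h0 : x ≠ 0) :
    ‖evalAt (wSeries n μ) (circ x)‖ ^ 2 = weight n μ x := by
  have h1 := abs_mul_exp_neg_logRatio (Set.Ioo_subset_Ioc_self hx)
  have h2 := congrArg norm (evalAt_geomPoly_mul μ (norm_circ x).le)
  rw [norm_mul, ← h1] at h2
  have hx0 : |x| ≠ 0 := abs_ne_zero.mpr h0
  rw [evalAt_wSeries n μ (norm_circ x).le, weight_eq, norm_mul, norm_pow,
    norm_evalAt_ratioSeries n hx, ← mul_pow, ← h2]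
  congr 2
  field_simp

/-- Almost everywhere the logarithm of the weight is 2n (log |1 - e^{-iμx}| - log |1 - e^{-ix}| -
`logRatio x`). Each of the three Herglotz integrals is known, and exponentiating gives ((1 - z^μ) /
(1 - z))^n times `ratioSeries`. -/
lemma wFun_eq {n μ : ℕ} (hμ : 1 ≤ μ) {z : ℂ} (hz : ‖z‖ < 1) :
    wFun n μ z = evalAt (wSeries n μ) z := by
  have hπ : (π : ℂ) ≠ 0 := by simp [Real.pi_ne_zero]
  have hH := (continuous_herglotz hz).continuousOn (s := Set.uIcc (-π) π)
  have hR : ∀ k, IntervalIntegrable (fun x => (Real.log ‖1 - circ x ^ k‖ : ℂ)) volume (-π) π :=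
    fun k => ⟨(intervalIntegrable_log_norm_one_sub k).1.ofReal,
      (intervalIntegrable_log_norm_one_sub k).2.ofReal⟩
  have hi1 := (hR μ).continuousOn_mul hH
  have hi2 := (hR 1).continuousOn_mul hH
  have hi3 := intervalIntegrable_logRatio.continuousOn_mul hH
  have key : ∫ x in (-π)..π, (cexp (I * x) + z) / (cexp (I * x) - z) *
      (Real.log (weight n μ x) : ℂ) =
      ∫ x in (-π)..π, (2 * n : ℂ) * (herglotz z x * Real.log ‖1 - circ x ^ μ‖ -
        herglotz z x * Real.log ‖1 - circ x ^ 1‖ - herglotz z x * logRatio x) := by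
    rw [intervalIntegral.integral_of_le (by linarith [Real.pi_pos]),
      intervalIntegral.integral_of_le (by linarith [Real.pi_pos])]
    refine integral_congr_ae ?_
    filter_upwards [ae_restrict_Ioc_ne_zero, ae_restrict_of_ae (ae_circ_pow_ne_one hμ)]
      with x hx hx1
    have h1 := abs_mul_exp_neg_logRatio (Set.Ioo_subset_Ioc_self hx.1)
    have hx0 : |x| ≠ 0 := abs_ne_zero.mpr hx.2
    have hne : ‖1 - circ x ^ μ‖ ≠ 0 := norm_ne_zero_iff.mpr (sub_ne_zero.mpr (Ne.symm hx1))
    have e : Real.log (weight n μ x) = 2 * n * (Real.log ‖1 - circ x ^ μ‖ -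
        Real.log ‖1 - circ x ^ 1‖ - logRatio x) := by
      rw [weight_eq, Real.log_pow, Real.log_pow, Real.log_div hne hx0, pow_one, ← h1,
        Real.log_mul hx0 (Real.exp_ne_zero _), Real.log_exp]
      push_cast; ring
    rw [e, herglotz]
    push_cast; ring
  rw [wFun, key, intervalIntegral.integral_const_mul, intervalIntegral.integral_sub (hi1.sub hi2)
    hi3, intervalIntegral.integral_sub hi1 hi2, integral_herglotz_log_norm hμ hz,
    integral_herglotz_log_norm le_rfl hz, integral_herglotz_logRatio hz,
    evalAt_wSeries n μ hz.le, evalAt_ratioSeries n hz.le]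
  have hz1 : 1 - z ≠ 0 := one_sub_ne_zero_of_norm_lt hz
  have hzμ : 1 - z ^ μ ≠ 0 := one_sub_ne_zero_of_norm_lt (by
    rw [norm_pow]; exact pow_lt_one₀ (norm_nonneg _) hz (by omega))
  have e : (1 / (4 * π) : ℂ) * (2 * n * (2 * π * Complex.log (1 - z ^ μ) -
      2 * π * Complex.log (1 - z ^ 1) - 2 * π * evalAt logSeries z)) =
      n * (Complex.log (1 - z ^ μ) - Complex.log (1 - z)) + -(n * evalAt logSeries z) := by
    rw [pow_one]; field_simp; ring
  rw [e, Complex.exp_add, Complex.exp_nat_mul, Complex.exp_sub, Complex.exp_log hz1,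
    Complex.exp_log hzμ, ← evalAt_geomPoly_mul μ hz.le, mul_div_cancel_right₀ _ hz1]

lemma wCoeff_eq {n μ : ℕ} (hμ : 1 ≤ μ) (k : ℕ) :
    wCoeff n μ k = PowerSeries.coeff k (wSeries n μ) :=
  (absSummable_wSeries n μ).iteratedDeriv_eq (fun _ hz => wFun_eq hμ hz) k

lemma mk_phiMu {n μ : ℕ} (hμ : 1 ≤ μ) (φ : ℕ → ℂ) :
    PowerSeries.mk (phiMu n μ φ) = wSeries n μ * PowerSeries.mk φ := by
  ext k
  rw [PowerSeries.coeff_mk, PowerSeries.coeff_mul, phiMu]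
  simp only [wCoeff_eq hμ, PowerSeries.coeff_mk]
  rw [Finset.Nat.sum_antidiagonal_eq_sum_range_succ_mk, ← Finset.sum_range_reflect]
  refine Finset.sum_congr rfl fun j hj => ?_
  simp only [Finset.mem_range] at hj
  congr 2
  congr 1; omega

/-! ### The error vector as a block of coefficients -/

/-- The coefficients `b_{μ,N}(k)`, extended by `0` to `k > N`. -/
def bSeq (n μ N : ℕ) (a : ℕ → ℂ) (k : ℕ) : ℂ :=
  ∑ j ∈ Finset.range (N + 1), if k ≤ j then dCoeff n μ (j - k) * a j else 0

lemma bVec_eq (n μ N : ℕ) (a : ℕ → ℂ) (k : Fin (N + 1)) : bVec n μ N a k = bSeq n μ N a k := by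
  rw [bVec, Matrix.mulVec, dotProduct, bSeq, Finset.sum_range]
  refine Finset.sum_congr rfl fun j _ => ?_
  simp only [matD, head, Matrix.of_apply, ite_mul, zero_mul]

lemma bSeq_eq_zero {n μ N : ℕ} {a : ℕ → ℂ} {k : ℕ} (hk : N < k) : bSeq n μ N a k = 0 :=
  Finset.sum_eq_zero fun j hj => by
    rw [if_neg]; simp only [Finset.mem_range] at hj; omega

lemma matW_mulVec_head (n μ N : ℕ) (φ : ℕ → ℂ) :
    (matW n μ N).mulVec (head N φ) = head N (phiMu n μ φ) := by
  ext j
  rw [Matrix.mulVec, dotProduct, head, phiMu]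
  simp only [matW, head, Matrix.of_apply, ite_mul, zero_mul]
  rw [← Finset.sum_range (fun k => if k ≤ (j : ℕ) then wCoeff n μ (j - k) * φ k else 0),
    ← Finset.sum_filter]
  refine Finset.sum_congr ?_ fun _ _ => rfl
  ext k
  have := j.isLt
  simp only [Finset.mem_filter, Finset.mem_range]
  omega

/-- The product D A of a triangular Toeplitz matrix and the Hankel matrix of a is the Hankel matrix
of b = D a, by the substitution m = l + j. -/
lemma errVec_eq (n μ N : ℕ) (a φ : ℕ → ℂ) (k : Fin (N + 1)) :
    errVec n μ N a φ k = ∑ j ∈ Finset.range (N + 1), bSeq n μ N a (k + j) * phiMu n μ φ j := by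
  rw [errVec, matW_mulVec_head]
  have h1 : ∀ l : Fin (N + 1), (matA N a).mulVec (head N (phiMu n μ φ)) l =
      ∑ j ∈ Finset.range (N + 1), if l + j ≤ N then a (l + j) * phiMu n μ φ j else 0 := by
    intro l
    rw [Matrix.mulVec, dotProduct, Finset.sum_range]
    refine Finset.sum_congr rfl fun j _ => ?_
    simp only [matA, head, Matrix.of_apply, ite_mul, zero_mul]
  rw [Matrix.mulVec, dotProduct]
  simp only [h1]
  have h2 : ∀ l : Fin (N + 1), matD n μ N k l * (∑ j ∈ Finset.range (N + 1),
      if (l : ℕ) + j ≤ N then a (l + j) * phiMu n μ φ j else 0) =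
      ∑ j ∈ Finset.range (N + 1), if (k : ℕ) ≤ l ∧ (l : ℕ) + j ≤ N then
        dCoeff n μ (l - k) * a (l + j) * phiMu n μ φ j else 0 := by
    intro l
    rw [Finset.mul_sum]
    refine Finset.sum_congr rfl fun j _ => ?_
    simp only [matD, Matrix.of_apply]
    by_cases hk : (k : ℕ) ≤ l <;> by_cases hj : (l : ℕ) + j ≤ N <;> simp [hk, hj, mul_assoc]
  simp only [h2]
  rw [← Finset.sum_range (fun l => ∑ j ∈ Finset.range (N + 1), if (k : ℕ) ≤ l ∧ l + j ≤ N then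
        dCoeff n μ (l - k) * a (l + j) * phiMu n μ φ j else 0), Finset.sum_comm]
  refine Finset.sum_congr rfl fun j _ => ?_
  rw [bSeq, Finset.sum_mul, ← Finset.sum_filter]
  simp only [ite_mul, zero_mul]
  rw [← Finset.sum_filter]
  refine Finset.sum_nbij' (fun l => l + j) (fun m => m - j) ?_ ?_ ?_ ?_ ?_
  · intro l hl; simp only [Finset.mem_filter, Finset.mem_range] at hl ⊢; omega
  · intro l hl; simp only [Finset.mem_filter, Finset.mem_range] at hl ⊢; omega
  · intro l hl; simp
  · intro l hl; simp only [Finset.mem_filter, Finset.mem_range] at hl ⊢; omega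
  · intro l hl
    rw [show l + j - (k + j) = l - k by omega]

/-- The reversed coefficients of `A_N(e^{ix})` as a power series. -/
def revSeries (n μ N : ℕ) (a : ℕ → ℂ) : PowerSeries ℂ :=
  PowerSeries.mk fun k => if k ≤ N then bSeq n μ N a (N - k) else 0

lemma absSummable_of_support {c : ℕ → ℂ} {N : ℕ} (h : ∀ k, N < k → c k = 0) :
    AbsSummable (PowerSeries.mk c) :=
  summable_of_ne_finset_zero (s := Finset.range (N + 1)) fun k hk => by
    simp only [Finset.mem_range, not_lt] at hk
    rw [PowerSeries.coeff_mk, h k (by omega), norm_zero]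

lemma evalAt_of_support {c : ℕ → ℂ} {N : ℕ} (h : ∀ k, N < k → c k = 0) (z : ℂ) :
    evalAt (PowerSeries.mk c) z = ∑ k ∈ Finset.range (N + 1), c k * z ^ k := by
  rw [evalAt, tsum_eq_sum (s := Finset.range (N + 1))]
  · simp
  · intro k hk
    simp only [Finset.mem_range, not_lt] at hk
    rw [PowerSeries.coeff_mk, h k (by omega), zero_mul]

lemma absSummable_revSeries (n μ N : ℕ) (a : ℕ → ℂ) : AbsSummable (revSeries n μ N a) :=
  absSummable_of_support (N := N) fun k hk => if_neg (by omega)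

lemma exp_I_mul_nat (x : ℝ) (k : ℕ) : cexp (I * x * k) = (circ x ^ k)⁻¹ := by
  rw [circ_pow, ← Complex.exp_neg, neg_neg]

lemma circ_pow_mul_exp_sum (N : ℕ) (c : ℕ → ℂ) (x : ℝ) :
    circ x ^ N * ∑ k : Fin (N + 1), c k * cexp (I * x * (k : ℕ)) =
      ∑ k ∈ Finset.range (N + 1), c (N - k) * circ x ^ k := by
  rw [← Finset.sum_range (fun k => c k * cexp (I * x * (k : ℕ))), Finset.mul_sum,
    ← Finset.sum_range_reflect]
  refine Finset.sum_congr rfl fun k hk => ?_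
  simp only [Finset.mem_range] at hk
  have hp : circ x ^ N = circ x ^ k * circ x ^ (N - k) := by rw [← pow_add]; congr 1; omega
  have hne := pow_ne_zero (N - k) (circ_ne_zero x)
  rw [exp_I_mul_nat, show N + 1 - 1 - k = N - k by omega, hp]
  field_simp

lemma circ_pow_mul_specA (n μ N : ℕ) (a : ℕ → ℂ) (x : ℝ) :
    circ x ^ N * specA n μ N a x = evalAt (revSeries n μ N a) (circ x) := by
  simp only [specA, bVec_eq]
  rw [circ_pow_mul_exp_sum, revSeries, evalAt_of_support (N := N) fun k hk => if_neg (by omega)]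
  refine Finset.sum_congr rfl fun k hk => ?_
  simp only [Finset.mem_range] at hk
  rw [if_pos (by omega)]

/-- Reversing the order of b turns the Hankel product into a Cauchy product: the error vector, read
backwards, is the block of the N + 1 lowest coefficients. -/
lemma errVec_eq_coeff {n μ N : ℕ} (a φ : ℕ → ℂ) (j : Fin (N + 1)) :
    errVec n μ N a φ j =
      PowerSeries.coeff (N - j) (revSeries n μ N a * PowerSeries.mk (phiMu n μ φ)) := by
  have hj := j.isLt
  rw [errVec_eq, PowerSeries.coeff_mul, Finset.Nat.sum_antidiagonal_eq_sum_range_succ_mk]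
  symm
  rw [← Finset.sum_range_reflect]
  refine (Finset.sum_congr rfl (g := fun i => bSeq n μ N a (j + i) * phiMu n μ φ i)
    fun i hi => ?_).trans (Finset.sum_subset (fun i hi => ?_) fun i hi hi2 => ?_)
  · simp only [Finset.mem_range] at hi
    simp only [revSeries, PowerSeries.coeff_mk]
    rw [if_pos (by omega)]
    congr 2 <;> omega
  · simp only [Finset.mem_range] at hi ⊢; omega
  · simp only [Finset.mem_range] at hi hi2
    rw [bSeq_eq_zero (by omega), zero_mul]

lemma circ_pow_mul_specR (n μ N : ℕ) (a φ : ℕ → ℂ) (x : ℝ) :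
    circ x ^ N * specR n μ N a φ x = ∑ k ∈ Finset.range (N + 1),
      PowerSeries.coeff k (revSeries n μ N a * PowerSeries.mk (phiMu n μ φ)) * circ x ^ k := by
  simp only [specR, errVec_eq_coeff]
  rw [circ_pow_mul_exp_sum N (fun j => PowerSeries.coeff (N - j)
    (revSeries n μ N a * PowerSeries.mk (phiMu n μ φ)))]
  refine Finset.sum_congr rfl fun k hk => ?_
  simp only [Finset.mem_range] at hk
  rw [show N - (N - k) = k by omega]

lemma errNormSq_eq (n μ N : ℕ) (a φ : ℕ → ℂ) :
    errNormSq n μ N a φ = ∑ k ∈ Finset.range (N + 1),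
      ‖PowerSeries.coeff k (revSeries n μ N a * PowerSeries.mk (phiMu n μ φ))‖ ^ 2 := by
  simp only [errNormSq, errVec_eq_coeff]
  rw [← Finset.sum_range (fun j => ‖PowerSeries.coeff (N - j)
    (revSeries n μ N a * PowerSeries.mk (phiMu n μ φ))‖ ^ 2), ← Finset.sum_range_reflect]
  refine Finset.sum_congr rfl fun k hk => ?_
  simp only [Finset.mem_range] at hk
  rw [show N - (N + 1 - 1 - k) = k by omega]

lemma AbsSummable.shift {F : PowerSeries ℂ} (hF : AbsSummable F) (m : ℕ) :
    AbsSummable (PowerSeries.mk fun k => PowerSeries.coeff (k + m) F) := by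
  simpa [AbsSummable] using (summable_nat_add_iff m).mpr hF

lemma AbsSummable.eval_split {F : PowerSeries ℂ} (hF : AbsSummable F) (m : ℕ) {z : ℂ}
    (hz : ‖z‖ ≤ 1) :
    evalAt F z = ∑ k ∈ Finset.range m, PowerSeries.coeff k F * z ^ k +
      z ^ m * evalAt (PowerSeries.mk fun k => PowerSeries.coeff (k + m) F) z := by
  rw [evalAt, ← (hF.summable hz).sum_add_tsum_nat_add m, evalAt, ← tsum_mul_left]
  congr 1
  refine tsum_congr fun k => ?_
  rw [PowerSeries.coeff_mk, pow_add]; ring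

/-- The coefficients of `A_N(e^{ix}) Φ_μ(e^{-ix})` of positive index in `e^{-ix}`. -/
def tailSeries (n μ N : ℕ) (a φ : ℕ → ℂ) : PowerSeries ℂ :=
  PowerSeries.mk fun k => PowerSeries.coeff (k + (N + 1))
    (revSeries n μ N a * PowerSeries.mk (phiMu n μ φ))

/-- Splits B_N Φ_μ into its powers 0, ..., N of e^{ix} and its strictly past part. Dividing the
latter by Φ_μ gives h_φ wherever Φ_μ does not vanish. -/
lemma specA_mul_symbol {n μ N : ℕ} (hμ : 1 ≤ μ) (a : ℕ → ℂ) {φ : ℕ → ℂ}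
    (hφ : AbsSummable (PowerSeries.mk φ)) (x : ℝ) :
    specA n μ N a x * evalAt (PowerSeries.mk (phiMu n μ φ)) (circ x) =
      specR n μ N a φ x + circ x * evalAt (tailSeries n μ N a φ) (circ x) := by
  have hΨ : AbsSummable (PowerSeries.mk (phiMu n μ φ)) := by
    rw [mk_phiMu hμ]; exact (absSummable_wSeries n μ).mul hφ
  have hB := absSummable_revSeries n μ N a
  refine mul_left_cancel₀ (pow_ne_zero N (circ_ne_zero x)) ?_
  rw [← mul_assoc, circ_pow_mul_specA, ← hB.eval_mul hΨ (norm_circ x).le,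
    (hB.mul hΨ).eval_split (N + 1) (norm_circ x).le, mul_add, circ_pow_mul_specR, tailSeries]
  ring

/-! ### Weighted `L₂` norms on `(-π, π]` -/

/-- Lebesgue measure on `(-π, π]`. -/
abbrev circVol : Measure ℝ := volume.restrict (Set.Ioc (-π) π)

/-- Both default values are 0 for negative `t`, so the weighted norm can be written with a square
root without a sign condition on the density. -/
lemma ofReal_sqrt_sq (t : ℝ) : ‖((Real.sqrt t : ℝ) : ℂ)‖ₑ ^ 2 = ENNReal.ofReal t := by
  rw [← ofReal_norm, ← ENNReal.ofReal_pow (norm_nonneg _), Complex.norm_real,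
    Real.norm_eq_abs, sq_abs]
  rcases le_or_gt 0 t with h | h
  · rw [Real.sq_sqrt h]
  · rw [Real.sqrt_eq_zero_of_nonpos h.le, ENNReal.ofReal_of_nonpos h.le]; simp

/-- The norm in `L₂` with the density `weight n μ x * f x`. -/
def wNorm (n μ : ℕ) (f : ℝ → ℝ) (g : ℝ → ℂ) : ℝ≥0∞ :=
  eLpNorm (fun x => g x * (Real.sqrt (weight n μ x * f x) : ℂ)) 2 circVol

lemma eLpNorm_two_sq {α : Type*} [MeasurableSpace α] (P : Measure α) (g : α → ℂ) :
    eLpNorm g 2 P ^ 2 = ∫⁻ x, ‖g x‖ₑ ^ 2 ∂P := by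
  rw [eLpNorm_eq_lintegral_rpow_enorm_toReal (by norm_num) (by norm_num), ← ENNReal.rpow_natCast,
    ← ENNReal.rpow_mul]
  simp

lemma wNorm_sq (n μ : ℕ) (f : ℝ → ℝ) (g : ℝ → ℂ) :
    wNorm n μ f g ^ 2 = ∫⁻ x in Set.Ioc (-π) π, ‖g x‖ₑ ^ 2 *
      ENNReal.ofReal (weight n μ x * f x) := by
  rw [wNorm, eLpNorm_two_sq]
  refine lintegral_congr fun x => ?_
  rw [enorm_mul, mul_pow, ofReal_sqrt_sq]

lemma measurable_weight (n μ : ℕ) : Measurable (weight n μ) := by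
  unfold weight; fun_prop

lemma aemeasurable_sqrt_weight {n μ : ℕ} {f : ℝ → ℝ} (hf : IsSpectralDensity f) :
    AEMeasurable (fun x => (Real.sqrt (weight n μ x * f x) : ℂ)) circVol := by
  have h1 : AEMeasurable f circVol := hf.1.aemeasurable
  have h2 : AEMeasurable (fun x => weight n μ x * f x) circVol :=
    (measurable_weight n μ).aemeasurable.mul h1
  exact Complex.measurable_ofReal.comp_aemeasurable (Real.continuous_sqrt.measurable.comp_aemeasurable h2)

lemma wNorm_add_le {n μ : ℕ} {f : ℝ → ℝ} (hf : IsSpectralDensity f) {g h : ℝ → ℂ}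
    (hg : AEMeasurable g circVol) (hh : AEMeasurable h circVol) :
    wNorm n μ f (fun x => g x + h x) ≤ wNorm n μ f g + wNorm n μ f h := by
  have hs := aemeasurable_sqrt_weight (n := n) (μ := μ) hf
  have := eLpNorm_add_le (p := 2) (hg.mul hs).aestronglyMeasurable
    (hh.mul hs).aestronglyMeasurable (by norm_num)
  simp only [wNorm, add_mul]
  exact this

/-- The trigonometric polynomial `∑_k c(k) e^{-ix(k+1)}`. -/
def trigPoly (c : ℕ →₀ ℂ) (x : ℝ) : ℂ := c.sum fun k z => z * cexp (-(I * x * (k + 1)))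

lemma trigPoly_eq (c : ℕ →₀ ℂ) (x : ℝ) :
    trigPoly c x = circ x * evalAt (PowerSeries.mk c) (circ x) := by
  rw [trigPoly, evalAt, tsum_eq_sum (s := c.support), Finsupp.sum, Finset.mul_sum]
  · refine Finset.sum_congr rfl fun k _ => ?_
    have := circ_pow x (k + 1)
    push_cast at this
    rw [PowerSeries.coeff_mk, ← this]; ring
  · intro k hk
    rw [PowerSeries.coeff_mk, Finsupp.notMem_support_iff.mp hk, zero_mul]

lemma absSummable_mk_finsupp (c : ℕ →₀ ℂ) : AbsSummable (PowerSeries.mk c) :=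
  summable_of_ne_finset_zero (s := c.support) fun k hk => by
    rw [PowerSeries.coeff_mk, Finsupp.notMem_support_iff.mp hk, norm_zero]

lemma continuous_trigPoly (c : ℕ →₀ ℂ) : Continuous (trigPoly c) := by
  rw [funext (trigPoly_eq c)]
  exact continuous_circ.mul (absSummable_mk_finsupp c).continuous_eval_circ

lemma continuous_specA (n μ N : ℕ) (a : ℕ → ℂ) : Continuous (specA n μ N a) := by
  unfold specA; fun_prop

lemma continuous_specR (n μ N : ℕ) (a φ : ℕ → ℂ) : Continuous (specR n μ N a φ) := by
  unfold specR; fun_prop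

lemma isSpectralCharacteristic_iff {n μ : ℕ} {f : ℝ → ℝ} {h : ℝ → ℂ} :
    IsSpectralCharacteristic n μ f h ↔ AEMeasurable h circVol ∧
      ∀ δ : ℝ≥0∞, 0 < δ → ∃ c, wNorm n μ f (fun x => h x - trigPoly c x) < δ := by
  refine and_congr_right fun _ => ⟨fun H δ hδ => ?_, fun H δ hδ => ?_⟩
  · obtain ⟨c, hc⟩ := H (δ ^ 2) (ENNReal.pow_pos hδ 2)
    refine ⟨c, ?_⟩
    change ∫⁻ x in Set.Ioc (-π) π, ‖h x - trigPoly c x‖ₑ ^ 2 * _ < _ at hc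
    rw [← wNorm_sq] at hc
    exact not_le.mp fun hle => absurd (pow_le_pow_left' hle 2) (not_le.mpr hc)
  · obtain ⟨c, hc⟩ := H (δ ^ (1 / 2 : ℝ)) (ENNReal.rpow_pos_of_nonneg hδ (by norm_num))
    refine ⟨c, ?_⟩
    change ∫⁻ x in Set.Ioc (-π) π, ‖h x - trigPoly c x‖ₑ ^ 2 * _ < _
    rw [← wNorm_sq]
    have := ENNReal.pow_lt_pow_left two_ne_zero hc
    rwa [← ENNReal.rpow_natCast (δ ^ _), ← ENNReal.rpow_mul, Nat.cast_ofNat,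
      one_div_mul_cancel two_ne_zero, ENNReal.rpow_one] at this

lemma isSpectralCharacteristic_trigPoly {n μ : ℕ} {f : ℝ → ℝ} (c : ℕ →₀ ℂ) :
    IsSpectralCharacteristic n μ f (trigPoly c) :=
  isSpectralCharacteristic_iff.mpr ⟨(continuous_trigPoly c).aemeasurable, fun δ hδ =>
    ⟨c, by simpa [wNorm] using hδ⟩⟩

lemma IsSpectralCharacteristic.of_approx {n μ : ℕ} {f : ℝ → ℝ} (hf : IsSpectralDensity f)
    {h : ℝ → ℂ} (hm : AEMeasurable h circVol)
    (H : ∀ δ : ℝ≥0∞, 0 < δ → ∃ g, IsSpectralCharacteristic n μ f g ∧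
      wNorm n μ f (fun x => h x - g x) < δ) : IsSpectralCharacteristic n μ f h := by
  refine isSpectralCharacteristic_iff.mpr ⟨hm, fun δ hδ => ?_⟩
  obtain ⟨g, hg, hlt⟩ := H (δ / 2) (ENNReal.half_pos hδ.ne')
  obtain ⟨hgm, hg2⟩ := isSpectralCharacteristic_iff.mp hg
  obtain ⟨c, hc⟩ := hg2 (δ / 2) (ENNReal.half_pos hδ.ne')
  refine ⟨c, ?_⟩
  have := wNorm_add_le (n := n) (μ := μ) hf (hm.sub hgm)
    (hgm.sub (continuous_trigPoly c).aemeasurable)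
  simp only [Pi.sub_apply, sub_add_sub_cancel] at this
  refine this.trans_lt ?_
  rw [← ENNReal.add_halves δ]
  exact ENNReal.add_lt_add hlt hc

lemma specError_eq (n μ N : ℕ) (a : ℕ → ℂ) (h : ℝ → ℂ) (f : ℝ → ℝ) :
    specError n μ N a h f = ENNReal.ofReal (1 / (2 * π)) *
      wNorm n μ f (fun x => specA n μ N a x - h x) ^ 2 := by
  rw [wNorm_sq]; rfl

/-- A lower bound on the span extends to its closure: the triangle inequality gives it up to δ in
the norm, and then δ tends to 0. -/
lemma le_specError_of_trigPoly {n μ N : ℕ} {a : ℕ → ℂ} {f : ℝ → ℝ} (hf : IsSpectralDensity f)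
    {m : ℝ≥0∞} (hm : ∀ c, m ≤ specError n μ N a (trigPoly c) f) {h : ℝ → ℂ}
    (hh : IsSpectralCharacteristic n μ f h) : m ≤ specError n μ N a h f := by
  obtain ⟨hhm, H⟩ := isSpectralCharacteristic_iff.mp hh
  have hA := (continuous_specA n μ N a).aemeasurable (μ := circVol)
  set t := wNorm n μ f (fun x => specA n μ N a x - h x) with ht
  have key : ∀ δ : ℝ≥0∞, 0 < δ → m ≤ ENNReal.ofReal (1 / (2 * π)) * (t + δ) ^ 2 := by
    intro δ hδ
    obtain ⟨c, hc⟩ := H δ hδ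
    refine (hm c).trans ?_
    rw [specError_eq]
    have := wNorm_add_le (n := n) (μ := μ) hf (hA.sub hhm)
      (hhm.sub (continuous_trigPoly c).aemeasurable)
    simp only [Pi.sub_apply, sub_add_sub_cancel] at this
    gcongr
    exact this.trans (add_le_add le_rfl hc.le)
  rw [specError_eq, ← ht]
  have hlim : Tendsto (fun δ : ℝ≥0∞ => ENNReal.ofReal (1 / (2 * π)) * (t + δ) ^ 2) (𝓝[>] 0)
      (𝓝 (ENNReal.ofReal (1 / (2 * π)) * (t + 0) ^ 2)) := by
    refine Tendsto.mono_left ?_ nhdsWithin_le_nhds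
    refine ENNReal.Tendsto.const_mul ?_ (Or.inr ENNReal.ofReal_ne_top)
    exact ENNReal.Tendsto.pow (tendsto_const_nhds.add tendsto_id)
  rw [add_zero] at hlim
  refine ge_of_tendsto hlim ?_
  filter_upwards [self_mem_nhdsWithin] with δ hδ using key δ hδ

lemma optError_eq_iInf {n μ N : ℕ} {a : ℕ → ℂ} {f : ℝ → ℝ} (hf : IsSpectralDensity f) :
    optError n μ N a f = ⨅ c, specError n μ N a (trigPoly c) f := by
  refine le_antisymm (le_iInf fun c => ?_) (le_iInf fun h => ?_)
  · exact iInf_le (fun h : {h : ℝ → ℂ // IsSpectralCharacteristic n μ f h} =>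
      specError n μ N a h f) ⟨_, isSpectralCharacteristic_trigPoly c⟩
  · exact le_specError_of_trigPoly hf (fun c => iInf_le _ c) h.2

/-! ### Errors at factorized densities -/

lemma lintegral_sq_evalAt {F : PowerSeries ℂ} (hF : AbsSummable F) :
    ENNReal.ofReal (1 / (2 * π)) * ∫⁻ x in Set.Ioc (-π) π, ‖evalAt F (circ x)‖ₑ ^ 2 =
      ENNReal.ofReal (∑' k, ‖PowerSeries.coeff k F‖ ^ 2) := by
  have hπ := Real.pi_pos
  have hc := hF.continuous_eval_circ
  have h1 : ∫⁻ x in Set.Ioc (-π) π, ‖evalAt F (circ x)‖ₑ ^ 2 =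
      ENNReal.ofReal (∫ x in (-π)..π, ‖evalAt F (circ x)‖ ^ 2) := by
    rw [intervalIntegral.integral_of_le (by linarith), ofReal_integral_eq_lintegral_ofReal]
    · refine lintegral_congr fun x => ?_
      rw [ENNReal.ofReal_pow (norm_nonneg _), ofReal_norm]
    · exact ((hc.norm.pow 2).intervalIntegrable (-π) π).1
    · exact Eventually.of_forall fun x => by positivity
  have h2 := hF.hasSum_sq_norm.tsum_eq
  rw [h1, ← h2, tsum_mul_left, ← ENNReal.ofReal_mul (by positivity)]
  congr 1
  field_simp

lemma summable_sq_coeff {F : PowerSeries ℂ} (hF : AbsSummable F) :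
    Summable fun k => ‖PowerSeries.coeff k F‖ ^ 2 := by
  have := hF.hasSum_sq_norm.summable
  rwa [summable_mul_left_iff (by simp [Real.pi_ne_zero])] at this

lemma weight_mul_eq {n μ : ℕ} (hμ : 1 ≤ μ) {φ : ℕ → ℂ} (hφ : AbsSummable (PowerSeries.mk φ))
    {f : ℝ → ℝ} (hf : ∀ᵐ x ∂circVol, f x = ‖symbol φ x‖ ^ 2) :
    ∀ᵐ x ∂circVol, weight n μ x * f x =
      ‖evalAt (PowerSeries.mk (phiMu n μ φ)) (circ x)‖ ^ 2 := by
  filter_upwards [hf, ae_restrict_Ioc_ne_zero] with x hx hx0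
  rw [hx, ← norm_sq_evalAt_wSeries n μ hx0.1 hx0.2, mk_phiMu hμ, symbol_eq_evalAt,
    (absSummable_wSeries n μ).eval_mul hφ (norm_circ x).le, norm_mul, mul_pow]

lemma absSummable_phiMu {n μ : ℕ} (hμ : 1 ≤ μ) {φ : ℕ → ℂ}
    (hφ : AbsSummable (PowerSeries.mk φ)) : AbsSummable (PowerSeries.mk (phiMu n μ φ)) := by
  rw [mk_phiMu hμ]; exact (absSummable_wSeries n μ).mul hφ

/-- After multiplication by e^{-ixN} Φ_μ, the error becomes a power series `T` in which the estimate
contributes only from index N + 1 on. By Parseval the first N + 1 coefficients, which form the error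
vector, bound the error from below. No zero-freeness of φ is needed, so the bound serves every
competitor in the extremum problem. -/
lemma ofReal_errNormSq_le_specError {n μ N : ℕ} (hμ : 1 ≤ μ) (a : ℕ → ℂ) {φ : ℕ → ℂ}
    (hφ : AbsSummable (PowerSeries.mk φ)) {f : ℝ → ℝ}
    (hf : ∀ᵐ x ∂circVol, f x = ‖symbol φ x‖ ^ 2) (c : ℕ →₀ ℂ) :
    ENNReal.ofReal (errNormSq n μ N a φ) ≤ specError n μ N a (trigPoly c) f := by
  have hΨ := absSummable_phiMu (n := n) hμ hφ
  have hB := absSummable_revSeries n μ N a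
  have hc := absSummable_mk_finsupp c
  have hXc := ((AbsSummable.X.pow (N + 1)).mul hc).mul hΨ
  set T := revSeries n μ N a * PowerSeries.mk (phiMu n μ φ) -
    PowerSeries.X ^ (N + 1) * PowerSeries.mk c * PowerSeries.mk (phiMu n μ φ) with hT
  have hTs : AbsSummable T := (hB.mul hΨ).sub hXc
  have e : specError n μ N a (trigPoly c) f = ENNReal.ofReal (1 / (2 * π)) *
      ∫⁻ x in Set.Ioc (-π) π, ‖evalAt T (circ x)‖ₑ ^ 2 := by
    rw [specError]
    congr 1
    refine lintegral_congr_ae ?_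
    filter_upwards [weight_mul_eq (n := n) hμ hφ hf] with x hx
    have hz := (norm_circ x).le
    have e1 : evalAt T (circ x) = circ x ^ N * ((specA n μ N a x - trigPoly c x) *
        evalAt (PowerSeries.mk (phiMu n μ φ)) (circ x)) := by
      rw [hT, (hB.mul hΨ).eval_sub hXc hz, hB.eval_mul hΨ hz,
        ((AbsSummable.X.pow (N + 1)).mul hc).eval_mul hΨ hz,
        (AbsSummable.X.pow (N + 1)).eval_mul hc hz, AbsSummable.X.eval_pow _ hz, evalAt_X,
        ← circ_pow_mul_specA, trigPoly_eq]
      ring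
    rw [hx, e1, enorm_mul, enorm_mul, ENNReal.ofReal_pow (norm_nonneg _), ofReal_norm, mul_pow,
      mul_pow, ← ofReal_norm (circ x ^ N), norm_circ_pow, ENNReal.ofReal_one, one_pow, one_mul]
  rw [e, lintegral_sq_evalAt hTs]
  refine ENNReal.ofReal_le_ofReal ?_
  rw [errNormSq_eq]
  refine le_trans (le_of_eq ?_) ((summable_sq_coeff hTs).sum_le_tsum (Finset.range (N + 1))
    fun _ _ => by positivity)
  refine Finset.sum_congr rfl fun k hk => ?_
  simp only [Finset.mem_range] at hk
  rw [hT, map_sub, mul_assoc, PowerSeries.coeff_X_pow_mul', if_neg (by omega), sub_zero]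

lemma ofReal_errNormSq_le_optError {n μ N : ℕ} (hμ : 1 ≤ μ) (a : ℕ → ℂ) {φ : ℕ → ℂ}
    (hφ : AbsSummable (PowerSeries.mk φ)) {f : ℝ → ℝ} (hfs : IsSpectralDensity f)
    (hf : ∀ᵐ x ∂circVol, f x = ‖symbol φ x‖ ^ 2) :
    ENNReal.ofReal (errNormSq n μ N a φ) ≤ optError n μ N a f := by
  rw [optError_eq_iInf hfs]
  exact le_iInf fun c => ofReal_errNormSq_le_specError hμ a hφ hf c

lemma weight_ne_zero {n μ : ℕ} (hμ : 1 ≤ μ) :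
    ∀ᵐ x ∂circVol, weight n μ x ≠ 0 := by
  filter_upwards [ae_restrict_Ioc_ne_zero, ae_restrict_of_ae (ae_circ_pow_ne_one hμ)] with x h0 h1
  rw [weight_eq]
  have := norm_ne_zero_iff.mpr (sub_ne_zero.mpr (Ne.symm h1))
  have := abs_ne_zero.mpr h0.2
  positivity

/-- B_N - h_φ is r_φ / Φ_μ, and the factor |w_μ|² in |Φ_μ|² cancels the weight. The error thus
becomes linear in `f` with an explicit kernel. -/
lemma specError_specChar {n μ N : ℕ} (hμ : 1 ≤ μ) (a : ℕ → ℂ) {φ : ℕ → ℂ}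
    (hφ : AbsSummable (PowerSeries.mk φ)) (f : ℝ → ℝ) :
    specError n μ N a (specChar n μ N a φ) f = ENNReal.ofReal (1 / (2 * π)) *
      ∫⁻ x in Set.Ioc (-π) π, ENNReal.ofReal (‖specR n μ N a φ x‖ ^ 2 / ‖symbol φ x‖ ^ 2 * f x) := by
  rw [specError]
  congr 1
  refine lintegral_congr_ae ?_
  filter_upwards [weight_ne_zero (n := n) hμ, weight_mul_eq (n := n) hμ hφ (f := fun x =>
    ‖symbol φ x‖ ^ 2) (Eventually.of_forall fun _ => rfl)] with x hx hx2
  have h0 : symbol (phiMu n μ φ) x = evalAt (PowerSeries.mk (phiMu n μ φ)) (circ x) :=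
    symbol_eq_evalAt _ x
  rw [specChar, sub_sub_cancel, h0, ← ofReal_norm, ← ENNReal.ofReal_pow (norm_nonneg _),
    ← ENNReal.ofReal_mul (by positivity), norm_mul, norm_inv, mul_pow, inv_pow, ← hx2]
  congr 1
  -- At a zero of the symbol both sides vanish because division by zero returns 0.
  by_cases hs : symbol φ x = 0
  · simp [hs]
  · have hs' : ‖symbol φ x‖ ≠ 0 := norm_ne_zero_iff.mpr hs
    field_simp

lemma lintegral_sq_specR (n μ N : ℕ) (a φ : ℕ → ℂ) :
    ENNReal.ofReal (1 / (2 * π)) *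
      ∫⁻ x in Set.Ioc (-π) π, ENNReal.ofReal (‖specR n μ N a φ x‖ ^ 2) =
      ENNReal.ofReal (errNormSq n μ N a φ) := by
  set c : ℕ → ℂ := fun k => if k ≤ N then
    PowerSeries.coeff k (revSeries n μ N a * PowerSeries.mk (phiMu n μ φ)) else 0 with hc
  have hc0 : ∀ k, N < k → c k = 0 := fun k hk => if_neg (by omega)
  have hcs := absSummable_of_support hc0
  have e : ∀ x, ENNReal.ofReal (‖specR n μ N a φ x‖ ^ 2) =
      ‖evalAt (PowerSeries.mk c) (circ x)‖ₑ ^ 2 := by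
    intro x
    have : evalAt (PowerSeries.mk c) (circ x) = circ x ^ N * specR n μ N a φ x := by
      rw [circ_pow_mul_specR, evalAt_of_support hc0]
      refine Finset.sum_congr rfl fun k hk => ?_
      simp only [Finset.mem_range] at hk
      rw [hc]; simp only; rw [if_pos (by omega)]
    rw [this, ← ofReal_norm, norm_mul, norm_circ_pow, one_mul, ENNReal.ofReal_pow (norm_nonneg _)]
  simp only [e]
  rw [lintegral_sq_evalAt hcs, errNormSq_eq, tsum_eq_sum (s := Finset.range (N + 1))]
  · congr 1
    refine Finset.sum_congr rfl fun k hk => ?_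
    simp only [Finset.mem_range] at hk
    rw [PowerSeries.coeff_mk, hc]; simp only; rw [if_pos (by omega)]
  · intro k hk
    simp only [Finset.mem_range] at hk
    rw [PowerSeries.coeff_mk, hc0 k (by omega), norm_zero, zero_pow two_ne_zero]

lemma symbol_ne_zero {φ : ℕ → ℂ} (h0 : ∀ z : ℂ, ‖z‖ ≤ 1 → ∑' k : ℕ, φ k * z ^ k ≠ 0) (x : ℝ) :
    symbol φ x ≠ 0 := by
  have := h0 (circ x) (norm_circ x).le
  simpa [symbol, circ_pow] using this

lemma specError_specChar_self {n μ N : ℕ} (hμ : 1 ≤ μ) (a : ℕ → ℂ) {φ : ℕ → ℂ} {f : ℝ → ℝ}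
    (hf : IsCanonicalFactor φ f) :
    specError n μ N a (specChar n μ N a φ) f = ENNReal.ofReal (errNormSq n μ N a φ) := by
  rw [specError_specChar hμ a (exists_inverse hf.radius hf.ne_zero).1, ← lintegral_sq_specR]
  congr 1
  refine lintegral_congr_ae ?_
  filter_upwards [hf.eq] with x hx
  have := norm_ne_zero_iff.mpr (symbol_ne_zero hf.ne_zero x)
  rw [hx]
  field_simp

/-! ### Membership of the spectral characteristic in all the spaces `L₂(f)` -/

lemma weight_le {n μ : ℕ} : ∀ᵐ x ∂circVol, weight n μ x ≤ coeffNorm (wSeries n μ) ^ 2 := by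
  filter_upwards [ae_restrict_Ioc_ne_zero] with x hx
  rw [← norm_sq_evalAt_wSeries n μ hx.1 hx.2]
  exact pow_le_pow_left₀ (norm_nonneg _) ((absSummable_wSeries n μ).norm_eval_le (norm_circ x).le) 2

lemma lintegral_ofReal_lt_top {f : ℝ → ℝ} (hf : IsSpectralDensity f) :
    ∫⁻ x in Set.Ioc (-π) π, ENNReal.ofReal (f x) < ∞ := by
  have := hf.1.lintegral_lt_top
  exact this

lemma lintegral_weight_lt_top {n μ : ℕ} {f : ℝ → ℝ} (hf : IsSpectralDensity f) :
    ∫⁻ x in Set.Ioc (-π) π, ENNReal.ofReal (weight n μ x * f x) < ∞ := by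
  have h : ∫⁻ x in Set.Ioc (-π) π, ENNReal.ofReal (weight n μ x * f x) ≤
      ∫⁻ x in Set.Ioc (-π) π, ENNReal.ofReal (coeffNorm (wSeries n μ) ^ 2) *
        ENNReal.ofReal (f x) := by
    refine lintegral_mono_ae ?_
    filter_upwards [weight_le (n := n) (μ := μ), hf.2] with x hx hx2
    rw [← ENNReal.ofReal_mul (by positivity)]
    exact ENNReal.ofReal_le_ofReal (mul_le_mul_of_nonneg_right hx hx2)
  refine h.trans_lt ?_
  rw [lintegral_const_mul' _ _ ENNReal.ofReal_ne_top]
  exact ENNReal.mul_lt_top ENNReal.ofReal_lt_top (lintegral_ofReal_lt_top hf)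

/-- Partial sums converge uniformly on the circle, and the weighted density has finite total mass.
The factor `circ x` keeps all powers strictly in the past. -/
lemma isSpectralCharacteristic_evalAt {n μ : ℕ} {f : ℝ → ℝ} (hf : IsSpectralDensity f)
    {M : PowerSeries ℂ} (hM : AbsSummable M) :
    IsSpectralCharacteristic n μ f fun x => circ x * evalAt M (circ x) := by
  have hm : Continuous fun x => circ x * evalAt M (circ x) :=
    continuous_circ.mul hM.continuous_eval_circ
  refine ⟨hm.aemeasurable, fun δ hδ => ?_⟩
  have hW := lintegral_weight_lt_top (n := n) (μ := μ) hf
  set W := ∫⁻ x in Set.Ioc (-π) π, ENNReal.ofReal (weight n μ x * f x) with hWdef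
  have hlim : Tendsto (fun K : ℕ => ENNReal.ofReal ((∑' k, ‖PowerSeries.coeff (k + K) M‖) ^ 2) * W)
      atTop (𝓝 (ENNReal.ofReal (0 ^ 2) * W)) :=
    ENNReal.Tendsto.mul_const (ENNReal.tendsto_ofReal
      ((tendsto_sum_nat_add fun k => ‖PowerSeries.coeff k M‖).pow 2)) (Or.inr hW.ne)
  rw [zero_pow two_ne_zero, ENNReal.ofReal_zero, zero_mul] at hlim
  obtain ⟨K, hK⟩ := ((tendsto_order.mp hlim).2 δ hδ).exists
  let c : ℕ →₀ ℂ := Finsupp.onFinset (Finset.range K)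
    (fun k => if k < K then PowerSeries.coeff k M else 0) fun k hk => by
      by_contra h
      simp only [Finset.mem_range] at h
      simp [h] at hk
  have hce : ∀ z, evalAt (PowerSeries.mk c) z =
      ∑ k ∈ Finset.range K, PowerSeries.coeff k M * z ^ k := by
    intro z
    rw [evalAt, tsum_eq_sum (s := Finset.range K)]
    · refine Finset.sum_congr rfl fun k hk => ?_
      simp only [Finset.mem_range] at hk
      simp [c, hk]
    · intro k hk
      simp only [Finset.mem_range] at hk
      simp [c, hk]
  refine ⟨c, lt_of_le_of_lt ?_ hK⟩
  rw [hWdef, ← lintegral_const_mul' _ _ ENNReal.ofReal_ne_top]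
  refine lintegral_mono fun x => ?_
  change ‖circ x * evalAt M (circ x) - trigPoly c x‖ₑ ^ 2 * _ ≤ _
  refine mul_le_mul_left ?_ _
  have hz := (norm_circ x).le
  rw [trigPoly_eq, hce, hM.eval_split K hz, ← mul_sub, add_sub_cancel_left, ← ofReal_norm,
    ← ENNReal.ofReal_pow (norm_nonneg _), norm_mul, norm_mul, norm_circ, norm_circ_pow, one_mul,
    one_mul]
  refine ENNReal.ofReal_le_ofReal (pow_le_pow_left₀ (norm_nonneg _) ?_ 2)
  refine ((hM.shift K).norm_eval_le hz).trans (le_of_eq ?_)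
  simp [coeffNorm]

lemma exists_inverse_one_sub (μ : ℕ) {ρ : ℝ} (h0 : 0 ≤ ρ) (h1 : ρ < 1) :
    ∃ Q : PowerSeries ℂ, AbsSummable Q ∧
      ∀ z : ℂ, ‖z‖ ≤ 1 → evalAt Q z * (1 - ρ * z ^ μ) = 1 := by
  set P : PowerSeries ℂ := 1 - (ρ : ℂ) • PowerSeries.X ^ μ with hP
  have hPs : AbsSummable P := AbsSummable.one.sub ((AbsSummable.X.pow μ).smul _)
  have hPe : ∀ z : ℂ, ‖z‖ ≤ 1 → evalAt P z = 1 - ρ * z ^ μ := fun z hz => by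
    rw [hP, AbsSummable.one.eval_sub ((AbsSummable.X.pow μ).smul _) hz, evalAt_one, evalAt_smul,
      AbsSummable.X.eval_pow _ hz, evalAt_X]
  have hc : ∀ k, k ∉ Finset.range (μ + 1) → PowerSeries.coeff k P = 0 := fun k hk => by
    simp only [Finset.mem_range] at hk
    rw [hP, map_sub, PowerSeries.coeff_one, if_neg (by omega)]
    simp [PowerSeries.coeff_X_pow, show k ≠ μ by omega]
  obtain ⟨-, Q, hQ, hQP⟩ := exists_inverse (φ := fun k => PowerSeries.coeff k P)
    ⟨2, one_lt_two, summable_of_ne_finset_zero (s := Finset.range (μ + 1)) fun k hk => by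
      rw [hc k hk, norm_zero, zero_mul]⟩
    (fun z hz h => by
      change evalAt P z = 0 at h
      rw [hPe z hz] at h
      refine one_sub_ne_zero_of_norm_lt ?_ h
      rw [norm_mul, norm_pow, Complex.norm_real, Real.norm_eq_abs, abs_of_nonneg h0]
      have := pow_le_one₀ (n := μ) (norm_nonneg z) hz
      nlinarith)
  refine ⟨Q, hQ, fun z hz => ?_⟩
  have hmk : PowerSeries.mk (fun k => PowerSeries.coeff k P) = P := by ext k; simp
  rw [hmk] at hQP
  rw [← hPe z hz, ← hQ.eval_mul hPs hz, hQP, evalAt_one]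

/-- Here `f` is any spectral density, not only |Φ|². The obstruction is that h_φ may have poles at
the zeros of 1 + z + ... + z^{μ-1} on the circle. They have order at most n, and the weight |w_μ|²
vanishes there to the same order. Replacing 1 / (1 - z^μ) by 1 / (1 - ρ z^μ) gives absolutely
summable approximants, which converge in the weighted norm as ρ tends to 1. -/
lemma isSpectralCharacteristic_specChar {n μ N : ℕ} (hμ : 1 ≤ μ) (a : ℕ → ℂ) {φ : ℕ → ℂ}
    (hr : ∃ R : ℝ, 1 < R ∧ Summable fun k => ‖φ k‖ * R ^ k)
    (h0 : ∀ z : ℂ, ‖z‖ ≤ 1 → ∑' k : ℕ, φ k * z ^ k ≠ 0) {f : ℝ → ℝ} (hf : IsSpectralDensity f) :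
    IsSpectralCharacteristic n μ f (specChar n μ N a φ) := by
  obtain ⟨hφ, Q, hQ, hQφ⟩ := exists_inverse hr h0
  have hΨ := absSummable_phiMu (n := n) hμ hφ
  have hq : AbsSummable (tailSeries n μ N a φ) :=
    ((absSummable_revSeries n μ N a).mul hΨ).shift (N + 1)
  have hri := absSummable_ratioInvSeries n
  have hK : AbsSummable (tailSeries n μ N a φ * Q * ratioInvSeries n) := (hq.mul hQ).mul hri
  set K := tailSeries n μ N a φ * Q * ratioInvSeries n with hKdef
  have hm : Measurable (specChar n μ N a φ) := by
    have h1 : Measurable (symbol (phiMu n μ φ)) := by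
      have : symbol (phiMu n μ φ) = fun x => evalAt (PowerSeries.mk (phiMu n μ φ)) (circ x) :=
        funext (symbol_eq_evalAt _)
      rw [this]; exact hΨ.continuous_eval_circ.measurable
    exact (continuous_specA n μ N a).measurable.sub ((continuous_specR n μ N a φ).measurable.mul
      h1.inv)
  -- Among the factors of Φ_μ, both Φ and `ratioSeries` are invertible in the algebra; only
  -- `geomPoly μ ^ n` is left in the denominator.
  have hval : ∀ x, circ x ^ μ ≠ 1 → specChar n μ N a φ x * evalAt (geomPoly μ) (circ x) ^ n =
      circ x * evalAt K (circ x) := by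
    intro x hx
    have hz := (norm_circ x).le
    have hg : evalAt (geomPoly μ) (circ x) ≠ 0 := fun h => by
      have := evalAt_geomPoly_mul μ hz
      rw [h, zero_mul] at this
      exact hx (sub_eq_zero.mp this.symm).symm
    have e1 := specA_mul_symbol (n := n) (N := N) hμ a hφ x
    have e2 : evalAt (PowerSeries.mk (phiMu n μ φ)) (circ x) = evalAt (geomPoly μ) (circ x) ^ n *
        evalAt (ratioSeries n) (circ x) * evalAt (PowerSeries.mk φ) (circ x) := by
      rw [mk_phiMu hμ, (absSummable_wSeries n μ).eval_mul hφ hz, evalAt_wSeries n μ hz]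
    have e3 : evalAt (ratioInvSeries n) (circ x) * evalAt (ratioSeries n) (circ x) = 1 := by
      rw [← hri.eval_mul (absSummable_ratioSeries n) hz, ratioSeries_mul_inv, evalAt_one]
    have e4 : evalAt Q (circ x) * evalAt (PowerSeries.mk φ) (circ x) = 1 := by
      rw [← hQ.eval_mul hφ hz, hQφ, evalAt_one]
    have hne : evalAt (PowerSeries.mk (phiMu n μ φ)) (circ x) ≠ 0 := by
      rw [e2]
      exact mul_ne_zero (mul_ne_zero (pow_ne_zero _ hg) (right_ne_zero_of_mul_eq_one e3))
        (right_ne_zero_of_mul_eq_one e4)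
    have e5 : specChar n μ N a φ x * evalAt (PowerSeries.mk (phiMu n μ φ)) (circ x) =
        circ x * evalAt (tailSeries n μ N a φ) (circ x) := by
      rw [specChar, symbol_eq_evalAt, sub_mul, inv_mul_cancel_right₀ hne, e1]; ring
    rw [hKdef, (hq.mul hQ).eval_mul hri hz, hq.eval_mul hQ hz]
    rw [e2] at e5
    linear_combination (evalAt Q (circ x) * evalAt (ratioInvSeries n) (circ x)) * e5 -
      specChar n μ N a φ x * evalAt (geomPoly μ) (circ x) ^ n * (e3 *
        (evalAt Q (circ x) * evalAt (PowerSeries.mk φ) (circ x)) + e4)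
  refine IsSpectralCharacteristic.of_approx hf hm.aemeasurable fun δ hδ => ?_
  -- The zero series is a dummy value for ρ outside [0, 1), so that `choose` yields a total family.
  have hρ : ∀ ρ : ℝ, ∃ Q : PowerSeries ℂ, AbsSummable Q ∧ (0 ≤ ρ → ρ < 1 →
      ∀ z : ℂ, ‖z‖ ≤ 1 → evalAt Q z * (1 - ρ * z ^ μ) = 1) := by
    intro ρ
    by_cases h : 0 ≤ ρ ∧ ρ < 1
    · obtain ⟨Q, h1, h2⟩ := exists_inverse_one_sub μ h.1 h.2
      exact ⟨Q, h1, fun _ _ => h2⟩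
    · exact ⟨0, by simpa using AbsSummable.of_polynomial 0, fun h1 h2 => absurd ⟨h1, h2⟩ h⟩
  choose A hA hA2 using hρ
  have hH : ∀ ρ, AbsSummable (K * ((1 - PowerSeries.X) * A ρ) ^ n) := fun ρ =>
    hK.mul ((absSummable_one_sub_X.mul (hA ρ)).pow n)
  have hev : ∀ᶠ ρ in 𝓝[<] (1 : ℝ), 0 < ρ ∧ ρ < 1 := by
    filter_upwards [Ioo_mem_nhdsLT (show (0 : ℝ) < 1 by norm_num)] with ρ hρ using hρ
  set C := coeffNorm K * coeffNorm (ratioSeries n) with hC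
  -- Multiplying the difference by w_μ cancels `geomPoly μ ^ n` and leaves the bounded factors
  -- collected in `C` times 1 - ((1 - z^μ) / (1 - ρ z^μ))^n.
  have hint : ∀ ρ : ℝ, 0 < ρ → ρ < 1 → ∀ᵐ x ∂circVol,
      ‖specChar n μ N a φ x - circ x * evalAt (K * ((1 - PowerSeries.X) * A ρ) ^ n) (circ x)‖ₑ ^ 2 *
        ENNReal.ofReal (weight n μ x * f x) ≤ ENNReal.ofReal (C ^ 2 * f x) *
          ENNReal.ofReal (‖1 - ((1 - circ x ^ μ) / (1 - ρ * circ x ^ μ)) ^ n‖ ^ 2) := by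
    intro ρ hρ0 hρ1
    filter_upwards [ae_restrict_Ioc_ne_zero, ae_restrict_of_ae (ae_circ_pow_ne_one hμ), hf.2]
      with x hx0 hx1 hfx
    have hz := (norm_circ x).le
    have hA3 := hA2 ρ hρ0.le hρ1 (circ x) hz
    have hne : 1 - (ρ : ℂ) * circ x ^ μ ≠ 0 := right_ne_zero_of_mul_eq_one hA3
    have hAe : evalAt (A ρ) (circ x) = (1 - (ρ : ℂ) * circ x ^ μ)⁻¹ :=
      eq_inv_of_mul_eq_one_left hA3
    have e1 : (specChar n μ N a φ x -
        circ x * evalAt (K * ((1 - PowerSeries.X) * A ρ) ^ n) (circ x)) *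
        evalAt (wSeries n μ) (circ x) = circ x * evalAt K (circ x) *
        evalAt (ratioSeries n) (circ x) *
          (1 - ((1 - circ x ^ μ) / (1 - ρ * circ x ^ μ)) ^ n) := by
      rw [hK.eval_mul ((absSummable_one_sub_X.mul (hA ρ)).pow n) hz,
        (absSummable_one_sub_X.mul (hA ρ)).eval_pow n hz, absSummable_one_sub_X.eval_mul (hA ρ) hz,
        evalAt_one_sub_X hz, evalAt_wSeries n μ hz, sub_mul, ← mul_assoc, hval x hx1, hAe,
        ← evalAt_geomPoly_mul μ hz, div_eq_mul_inv, mul_pow, mul_pow, mul_pow]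
      ring
    rw [← norm_sq_evalAt_wSeries n μ hx0.1 hx0.2, ENNReal.ofReal_mul (by positivity),
      ENNReal.ofReal_mul (by positivity), ENNReal.ofReal_pow (norm_nonneg _), ofReal_norm,
      ← mul_assoc, ← mul_pow, ← enorm_mul, e1, mul_right_comm (ENNReal.ofReal (C ^ 2))]
    refine mul_le_mul_left ?_ _
    rw [← ofReal_norm, ← ENNReal.ofReal_pow (norm_nonneg _), ← ENNReal.ofReal_mul (by positivity)]
    refine ENNReal.ofReal_le_ofReal ?_
    rw [norm_mul, norm_mul, norm_mul, norm_circ, one_mul, mul_pow]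
    refine mul_le_mul_of_nonneg_right (pow_le_pow_left₀ (by positivity) ?_ 2) (by positivity)
    exact mul_le_mul (hK.norm_eval_le hz) ((absSummable_ratioSeries n).norm_eval_le hz)
      (norm_nonneg _) (AbsSummable.coeffNorm_nonneg _)
  have hlim : Tendsto (fun ρ : ℝ => ∫⁻ x in Set.Ioc (-π) π, ENNReal.ofReal (C ^ 2 * f x) *
      ENNReal.ofReal (‖1 - ((1 - circ x ^ μ) / (1 - ρ * circ x ^ μ)) ^ n‖ ^ 2)) (𝓝[<] 1)
      (𝓝 (∫⁻ x in Set.Ioc (-π) π, 0)) := by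
    -- The quotient (1 - z^μ) / (1 - ρ z^μ) has modulus at most 2, whence the constant 1 + 2^n,
    -- independent of ρ.
    refine tendsto_lintegral_filter_of_dominated_convergence'
      (fun x => ENNReal.ofReal (C ^ 2 * f x) * ENNReal.ofReal ((1 + 2 ^ n) ^ 2)) ?_ ?_ ?_ ?_
    · refine Eventually.of_forall fun ρ => ?_
      have h1 := continuous_circ.measurable
      have h2 : AEMeasurable f circVol := hf.1.aemeasurable
      exact (h2.const_mul _).ennreal_ofReal.mul (Measurable.aemeasurable (by fun_prop))
    · filter_upwards [hev] with ρ hρ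
      refine Eventually.of_forall fun x => ?_
      refine mul_le_mul' le_rfl ?_
      refine ENNReal.ofReal_le_ofReal (pow_le_pow_left₀ (norm_nonneg _) ?_ 2)
      refine (norm_sub_le _ _).trans ?_
      rw [norm_one, norm_pow, norm_div]
      refine add_le_add le_rfl (pow_le_pow_left₀ (by positivity) ?_ n)
      exact div_le_of_le_mul₀ (norm_nonneg _) (by norm_num)
        (norm_one_sub_le_two_mul (norm_circ_pow x μ) hρ.1.le hρ.2.le)
    · rw [lintegral_mul_const' _ _ ENNReal.ofReal_ne_top]
      simp only [ENNReal.ofReal_mul (sq_nonneg C)]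
      rw [lintegral_const_mul' _ _ ENNReal.ofReal_ne_top]
      exact (ENNReal.mul_lt_top (ENNReal.mul_lt_top ENNReal.ofReal_lt_top
        (lintegral_ofReal_lt_top hf)) ENNReal.ofReal_lt_top).ne
    · filter_upwards [ae_restrict_of_ae (ae_circ_pow_ne_one hμ)] with x hx
      have hne : 1 - circ x ^ μ ≠ 0 := sub_ne_zero.mpr (Ne.symm hx)
      have hc : ContinuousAt (fun ρ : ℝ =>
          ‖1 - ((1 - circ x ^ μ) / (1 - (ρ : ℂ) * circ x ^ μ)) ^ n‖ ^ 2) 1 := by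
        have : ContinuousAt (fun ρ : ℝ => (1 : ℂ) - (ρ : ℂ) * circ x ^ μ) 1 := by fun_prop
        exact ((continuousAt_const.sub ((continuousAt_const.div this (by simpa using hne)).pow
          n)).norm).pow 2
      have h2 := hc.tendsto.mono_left (nhdsWithin_le_nhds (s := Set.Iio 1))
      have h3 := ENNReal.Tendsto.const_mul (a := ENNReal.ofReal (C ^ 2 * f x))
        (ENNReal.tendsto_ofReal h2) (Or.inr ENNReal.ofReal_ne_top)
      simpa [div_self hne] using h3
  rw [lintegral_zero] at hlim
  obtain ⟨ρ, hlt, hρ0, hρ1⟩ :=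
    (((tendsto_order.mp hlim).2 (δ ^ 2) (ENNReal.pow_pos hδ 2)).and hev).exists
  refine ⟨_, isSpectralCharacteristic_evalAt hf (hH ρ), ?_⟩
  refine lt_of_not_ge fun hle => absurd (pow_le_pow_left' hle 2) (not_le.mpr ?_)
  rw [wNorm_sq]
  exact (lintegral_mono_ae (hint ρ hρ0 hρ1)).trans_lt hlt

lemma optError_eq_of_isCanonicalFactor {n μ N : ℕ} (hμ : 1 ≤ μ) (a : ℕ → ℂ) {φ : ℕ → ℂ}
    {f : ℝ → ℝ} (hfs : IsSpectralDensity f) (hf : IsCanonicalFactor φ f) :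
    optError n μ N a f = ENNReal.ofReal (errNormSq n μ N a φ) := by
  refine le_antisymm ?_ (ofReal_errNormSq_le_optError hμ a
    (exists_inverse hf.radius hf.ne_zero).1 hfs hf.eq)
  rw [← specError_specChar_self hμ a hf]
  exact iInf_le (fun h : {h : ℝ → ℂ // IsSpectralCharacteristic n μ f h} =>
      specError n μ N a h f)
    ⟨_, isSpectralCharacteristic_specChar hμ a hf.radius hf.ne_zero hfs⟩

lemma isOptimal_specChar {n μ N : ℕ} (hμ : 1 ≤ μ) (a : ℕ → ℂ) {φ : ℕ → ℂ}
    {f : ℝ → ℝ} (hfs : IsSpectralDensity f) (hf : IsCanonicalFactor φ f) :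
    IsOptimal n μ N a f (specChar n μ N a φ) :=
  ⟨isSpectralCharacteristic_specChar hμ a hf.radius hf.ne_zero hfs, by
    rw [specError_specChar_self hμ a hf, optError_eq_of_isCanonicalFactor hμ a hfs hf]⟩

/-! ### The saddle point -/

lemma IsSpectralDensity.congr {f g : ℝ → ℝ} (hf : IsSpectralDensity f) (h : f =ᵐ[circVol] g) :
    IsSpectralDensity g :=
  ⟨hf.1.congr_fun_ae h, by filter_upwards [hf.2, h] with x h1 h2; rwa [← h2]⟩

lemma bandClass_congr {v u f g : ℝ → ℝ} {P₀ : ℝ} (hf : f ∈ bandClass v u P₀)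
    (h : f =ᵐ[circVol] g) : g ∈ bandClass v u P₀ := by
  obtain ⟨h1, h2, h3⟩ := hf
  refine ⟨h1.congr h, by filter_upwards [h2, h] with x a b; rwa [← b], ?_⟩
  have hπ := Real.pi_pos
  rw [intervalIntegral.integral_of_le (by linarith)] at h3 ⊢
  rwa [← integral_congr_ae h]

lemma continuous_symbol {φ : ℕ → ℂ} (hφ : AbsSummable (PowerSeries.mk φ)) :
    Continuous (symbol φ) := by
  rw [funext (symbol_eq_evalAt φ)]; exact hφ.continuous_eval_circ

lemma isSpectralDensity_symbol {φ : ℕ → ℂ} (hφ : AbsSummable (PowerSeries.mk φ)) :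
    IsSpectralDensity fun x => ‖symbol φ x‖ ^ 2 :=
  ⟨(((continuous_symbol hφ).norm.pow 2).intervalIntegrable (-π) π).1,
    Eventually.of_forall fun x => by positivity⟩

lemma integral_sq_symbol {φ : ℕ → ℂ} (hφ : AbsSummable (PowerSeries.mk φ)) :
    ∫ x in (-π)..π, ‖symbol φ x‖ ^ 2 = 2 * π * ∑' k, ‖φ k‖ ^ 2 := by
  simp only [symbol_eq_evalAt]
  rw [← hφ.hasSum_sq_norm.tsum_eq, tsum_mul_left]
  simp

section Truncated

variable {n μ N : ℕ} {a : ℕ → ℂ} {v u : ℝ → ℝ} {P₀ : ℝ} {c : ℂ} {φ : ℕ → ℂ}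

lemma isSpectralDensity_truncDensity (h : (c, φ) ∈ truncSet n μ N a v u P₀) :
    IsSpectralDensity (truncDensity n μ N a v u c φ) := by
  have hφ := (exists_inverse h.2.radius h.2.ne_zero).1
  refine (isSpectralDensity_symbol hφ).congr ?_
  filter_upwards [h.2.eq] with x hx using hx.symm

lemma integral_truncDensity (h : (c, φ) ∈ truncSet n μ N a v u P₀) :
    ∫ x in (-π)..π, truncDensity n μ N a v u c φ x = 2 * π * P₀ := by
  have hφ := (exists_inverse h.2.radius h.2.ne_zero).1
  rw [← h.1, ← integral_sq_symbol hφ, intervalIntegral.integral_of_le (by linarith [Real.pi_pos]),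
    intervalIntegral.integral_of_le (by linarith [Real.pi_pos])]
  exact integral_congr_ae h.2.eq

lemma truncDensity_mem (hvu : ∀ᵐ x ∂circVol, v x ≤ u x)
    (h : (c, φ) ∈ truncSet n μ N a v u P₀) :
    truncDensity n μ N a v u c φ ∈ bandClass v u P₀ := by
  refine ⟨isSpectralDensity_truncDensity h, ?_, ?_⟩
  · filter_upwards [hvu] with x hx
    exact ⟨le_max_left _ _, max_le hx (min_le_left _ _)⟩
  · rw [integral_truncDensity h]
    have := Real.pi_pos
    exact le_of_eq (by field_simp)

/-- The optimal spectral characteristic at the truncated density satisfies the saddle point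
inequality. -/
lemma specError_specChar_le (hμ : 1 ≤ μ) (hv : IsSpectralDensity v)
    (h : (c, φ) ∈ truncSet n μ N a v u P₀) {f : ℝ → ℝ} (hf : f ∈ bandClass v u P₀) :
    specError n μ N a (specChar n μ N a φ) f ≤ ENNReal.ofReal (errNormSq n μ N a φ) := by
  have hπ := Real.pi_pos
  have hφ := (exists_inverse h.2.radius h.2.ne_zero).1
  have hs0 : ∀ x, ‖symbol φ x‖ ≠ 0 := fun x =>
    norm_ne_zero_iff.mpr (symbol_ne_zero h.2.ne_zero x)
  rw [specError_specChar hμ a hφ, ← lintegral_sq_specR]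
  refine mul_le_mul' le_rfl ?_
  set f₀ := truncDensity n μ N a v u c φ with hf₀
  have hf₀s := isSpectralDensity_truncDensity h
  set g : ℝ → ℝ := fun x => ‖specR n μ N a φ x‖ ^ 2 / ‖symbol φ x‖ ^ 2 with hg
  have hgc : Continuous g := by
    have h1 := continuous_specR n μ N a φ
    have h2 := continuous_symbol hφ
    exact (h1.norm.pow 2).div (h2.norm.pow 2) fun x => pow_ne_zero 2 (hs0 x)
  have hg0 : ∀ x, 0 ≤ g x := fun x => by positivity
  obtain ⟨C, hC⟩ := isCompact_Icc.exists_bound_of_continuousOn (hgc.continuousOn (s := Set.Icc (-π) π))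
  have hgf : ∀ F : ℝ → ℝ, IsSpectralDensity F → Integrable (fun x => g x * F x) circVol :=
    fun F hF => hF.1.bdd_mul hgc.aestronglyMeasurable (c := C)
      ((ae_restrict_iff' measurableSet_Ioc).mpr
        (Eventually.of_forall fun x hx => hC x (Set.Ioc_subset_Icc_self hx)))
  have hgf₀ : ∀ᵐ x ∂circVol, g x * f₀ x = ‖specR n μ N a φ x‖ ^ 2 := by
    filter_upwards [h.2.eq] with x hx
    have := hs0 x
    rw [hf₀, hx, hg]; field_simp
  have hint : ∫ x, f x ∂circVol ≤ ∫ x, f₀ x ∂circVol := by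
    have h1 := hf.2.2
    have h2 := integral_truncDensity h
    rw [intervalIntegral.integral_of_le (by linarith)] at h1 h2
    rw [h2]
    rw [div_mul_eq_mul_div, one_mul, div_le_iff₀ (by positivity)] at h1
    linarith
  have key : ∫ x, g x * f x ∂circVol ≤ ∫ x, g x * f₀ x ∂circVol := by
    -- For `c = 0` the truncated density lies below every member of the class, while its integral is
    -- the largest possible; hence `f` and `f₀` agree a.e.
    by_cases hc : c = 0
    · have hfv : ∀ᵐ x ∂circVol, f₀ x ≤ f x := by
        filter_upwards [hf.2.1, hv.2] with x hx hx2
        rw [hf₀, truncDensity, hc, zero_mul, norm_zero, zero_pow two_ne_zero]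
        exact max_le hx.1 ((min_le_right _ _).trans (hx2.trans hx.1))
      have hnn : 0 ≤ᵐ[circVol] fun x => f x - f₀ x := by
        filter_upwards [hfv] with x hx using sub_nonneg.mpr hx
      have hz : ∫ x, (f x - f₀ x) ∂circVol = 0 := by
        refine le_antisymm ?_ (integral_nonneg_of_ae hnn)
        rw [integral_sub hf.1.1 hf₀s.1]
        linarith
      have hae := (integral_eq_zero_iff_of_nonneg_ae hnn (hf.1.1.sub hf₀s.1)).mp hz
      refine le_of_eq (integral_congr_ae ?_)
      filter_upwards [hae] with x hx
      rw [sub_eq_zero.mp hx]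
    · have hcpos : 0 < ‖c‖ ^ 2 := by positivity
      -- The constant |c|⁻² is the multiplier of the constraint on the integral. Since |c r_φ|² =
      -- |c|² g f₀, the sign of g - |c|⁻² tells which truncation is active: `f₀` below |c r_φ|²
      -- forces u ≤ f₀, and `f₀` above it forces f₀ ≤ v.
      have hpt : ∀ᵐ x ∂circVol, g x * f x - g x * f₀ x ≤ (‖c‖ ^ 2)⁻¹ * (f x - f₀ x) := by
        filter_upwards [hgf₀, hf.2.1, h.2.eq] with x hx hx2 hx3
        have hpos : 0 < f₀ x := by
          rw [hf₀, hx3]; have := hs0 x; positivity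
        have hr : ‖c * specR n μ N a φ x‖ ^ 2 = ‖c‖ ^ 2 * (g x * f₀ x) := by
          rw [norm_mul, mul_pow, hx]
        have hdef : f₀ x = max (v x) (min (u x) (‖c‖ ^ 2 * (g x * f₀ x))) := by
          conv_lhs => rw [hf₀, truncDensity, hr]
        rw [← mul_sub, ← sub_nonneg, ← sub_mul]
        rcases lt_trichotomy (f₀ x) (‖c‖ ^ 2 * (g x * f₀ x)) with hlt | heq | hgt
        · have h1 : u x ≤ f₀ x := by
            by_contra hlt2
            have h2 := lt_min (not_le.mp hlt2) hlt
            exact absurd (h2.trans_le (le_max_right (v x) _)) (by rw [← hdef]; exact lt_irrefl _)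
          have h3 : (‖c‖ ^ 2)⁻¹ ≤ g x := by
            rw [inv_le_iff_one_le_mul₀ hcpos]
            by_contra h4
            nlinarith [not_le.mp h4]
          exact mul_nonneg_of_nonpos_of_nonpos (sub_nonpos.mpr h3) (by linarith [hx2.2])
        · have h3 : (‖c‖ ^ 2)⁻¹ = g x := by
            refine inv_eq_of_mul_eq_one_right (mul_right_cancel₀ hpos.ne' ?_)
            linarith
          rw [h3, sub_self, zero_mul]
        · have h1 : f₀ x ≤ v x := by
            by_contra hlt2
            have h2 := max_lt (not_le.mp hlt2) ((min_le_right (u x) _).trans_lt hgt)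
            rw [← hdef] at h2
            exact lt_irrefl _ h2
          have h3 : g x ≤ (‖c‖ ^ 2)⁻¹ := by
            rw [← one_div, le_div_iff₀ hcpos]
            by_contra h4
            nlinarith [not_le.mp h4]
          exact mul_nonneg (sub_nonneg.mpr h3) (by linarith [hx2.1])
      have h1 := integral_mono_ae ((hgf f hf.1).sub (hgf f₀ hf₀s))
        ((hf.1.1.sub hf₀s.1).const_mul _) hpt
      simp only [Pi.sub_apply] at h1
      rw [integral_sub (hgf f hf.1) (hgf f₀ hf₀s), integral_const_mul,
        integral_sub hf.1.1 hf₀s.1] at h1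
      have : (‖c‖ ^ 2)⁻¹ * ((∫ x, f x ∂circVol) - ∫ x, f₀ x ∂circVol) ≤ 0 :=
        mul_nonpos_of_nonneg_of_nonpos (by positivity) (by linarith)
      linarith
  rw [← ofReal_integral_eq_lintegral_ofReal (hgf f hf.1)
    (by filter_upwards [hf.1.2] with x hx using mul_nonneg (hg0 x) hx)]
  have e : ∫⁻ x in Set.Ioc (-π) π, ENNReal.ofReal (‖specR n μ N a φ x‖ ^ 2) =
      ENNReal.ofReal (∫ x, g x * f₀ x ∂circVol) := by
    rw [ofReal_integral_eq_lintegral_ofReal (hgf f₀ hf₀s)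
      (by filter_upwards [hf₀s.2] with x hx using mul_nonneg (hg0 x) hx)]
    refine lintegral_congr_ae ?_
    filter_upwards [hgf₀] with x hx
    rw [hx]
  rw [e]
  exact ENNReal.ofReal_le_ofReal key

lemma optError_le_of_mem_truncSet (hμ : 1 ≤ μ) (hv : IsSpectralDensity v)
    (h : (c, φ) ∈ truncSet n μ N a v u P₀) {f : ℝ → ℝ} (hf : f ∈ bandClass v u P₀) :
    optError n μ N a f ≤ ENNReal.ofReal (errNormSq n μ N a φ) :=
  (iInf_le (fun h : {h : ℝ → ℂ // IsSpectralCharacteristic n μ f h} => specError n μ N a h f)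
    ⟨_, isSpectralCharacteristic_specChar hμ a h.2.radius h.2.ne_zero hf.1⟩).trans
    (specError_specChar_le hμ hv h hf)

/-- Any competitor already has error at least Δ(f₀) at `f₀`, and Δ(f₀) bounds the error of `h₀` over
the whole class, so the maximum for `h₀` is attained at `f₀`. -/
lemma isMinimaxRobust_of_saddle {D : Set (ℝ → ℝ)} {f₀ : ℝ → ℝ} {h₀ : ℝ → ℂ} (hf₀ : f₀ ∈ D)
    (hmem : ∀ f ∈ D, IsSpectralCharacteristic n μ f h₀)
    (hle : ∀ f ∈ D, specError n μ N a h₀ f ≤ optError n μ N a f₀) :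
    IsMinimaxRobust n μ N a D h₀ := by
  have hopt : ∀ h, IsSpectralCharacteristic n μ f₀ h →
      optError n μ N a f₀ ≤ specError n μ N a h f₀ := fun h hh =>
    iInf_le (fun h : {h : ℝ → ℂ // IsSpectralCharacteristic n μ f₀ h} =>
      specError n μ N a h f₀) ⟨h, hh⟩
  refine ⟨hmem, ⟨f₀, hf₀, fun f hf => (hle f hf).trans (hopt h₀ (hmem f₀ hf₀))⟩, fun h hh => ?_⟩
  refine iSup₂_le fun f hf => ?_
  refine ((hle f hf).trans (hopt h (hh f₀ hf₀))).trans ?_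
  exact le_iSup₂ (f := fun f _ => specError n μ N a h f) f₀ hf₀

lemma isMinimaxRobust_specChar (hμ : 1 ≤ μ) (hv : IsSpectralDensity v)
    (hvu : ∀ᵐ x ∂circVol, v x ≤ u x) (h : (c, φ) ∈ truncSet n μ N a v u P₀) :
    IsMinimaxRobust n μ N a (bandClass v u P₀) (specChar n μ N a φ) := by
  refine isMinimaxRobust_of_saddle (truncDensity_mem hvu h) (fun f hf =>
    isSpectralCharacteristic_specChar hμ a h.2.radius h.2.ne_zero hf.1) fun f hf => ?_
  rw [optError_eq_of_isCanonicalFactor hμ a (isSpectralDensity_truncDensity h) h.2]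
  exact specError_specChar_le hμ hv h hf

end Truncated

/-! ### The extremum problem and uniqueness of the optimal characteristic. -/

lemma errNormSq_nonneg (n μ N : ℕ) (a φ : ℕ → ℂ) : 0 ≤ errNormSq n μ N a φ :=
  Finset.sum_nonneg fun _ _ => by positivity

lemma solvesExtremum_of_optError_le {n μ N : ℕ} (hμ : 1 ≤ μ) {a φ : ℕ → ℂ} {D : Set (ℝ → ℝ)}
    (hφ : Summable fun k => ‖φ k‖) (hmem : (fun x => ‖symbol φ x‖ ^ 2) ∈ D)
    (hle : ∀ f ∈ D, optError n μ N a f ≤ ENNReal.ofReal (errNormSq n μ N a φ)) :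
    SolvesExtremum n μ N a D φ := by
  refine ⟨hφ, hmem, fun ψ hψ hψD => ?_⟩
  have hψs : AbsSummable (PowerSeries.mk ψ) := by simpa [AbsSummable] using hψ
  have h1 := (ofReal_errNormSq_le_optError (n := n) (N := N) hμ a hψs
    (isSpectralDensity_symbol hψs) (Eventually.of_forall fun _ => rfl)).trans (hle _ hψD)
  exact (ENNReal.ofReal_le_ofReal_iff (errNormSq_nonneg _ _ _ _ _)).mp h1

/-- Uniqueness of the optimal spectral characteristic. -/
lemma ae_eq_of_isOptimal {n μ N : ℕ} {a : ℕ → ℂ} {f : ℝ → ℝ} (hf : IsSpectralDensity f)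
    (hpos : ∀ᵐ x ∂circVol, 0 < weight n μ x * f x)
    (hfin : optError n μ N a f ≠ ∞) {h₁ h₂ : ℝ → ℂ}
    (H₁ : IsOptimal n μ N a f h₁) (H₂ : IsOptimal n μ N a f h₂) : h₁ =ᵐ[circVol] h₂ := by
  obtain ⟨m1, a1⟩ := isSpectralCharacteristic_iff.mp H₁.1
  obtain ⟨m2, a2⟩ := isSpectralCharacteristic_iff.mp H₂.1
  have hA := (continuous_specA n μ N a).aemeasurable (μ := circVol)
  -- The midpoint of two optimal characteristics is again a spectral characteristic, so its error is
  -- at least the optimum; the parallelogram identity then forces their distance to be 0.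
  set h : ℝ → ℂ := fun x => (1 / 2 : ℂ) * (h₁ x + h₂ x) with hh
  have hhm : AEMeasurable h circVol := (m1.add m2).const_mul _
  have hw : ∀ (z : ℂ) (g : ℝ → ℂ), wNorm n μ f (fun x => z * g x) = ‖z‖ₑ * wNorm n μ f g := by
    intro z g
    simp only [wNorm, mul_assoc]
    exact eLpNorm_const_smul z (fun x => g x * (Real.sqrt (weight n μ x * f x) : ℂ)) 2 circVol
  have hhs : IsSpectralCharacteristic n μ f h := by
    refine isSpectralCharacteristic_iff.mpr ⟨hhm, fun δ hδ => ?_⟩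
    obtain ⟨c1, hc1⟩ := a1 (δ / 2) (ENNReal.half_pos hδ.ne')
    obtain ⟨c2, hc2⟩ := a2 (δ / 2) (ENNReal.half_pos hδ.ne')
    refine ⟨(1 / 2 : ℂ) • (c1 + c2), ?_⟩
    have e : ∀ x, trigPoly ((1 / 2 : ℂ) • (c1 + c2)) x =
        (1 / 2 : ℂ) * (trigPoly c1 x + trigPoly c2 x) := by
      intro x
      have e1 : trigPoly ((1 / 2 : ℂ) • (c1 + c2)) x = (1 / 2 : ℂ) * trigPoly (c1 + c2) x := by
        rw [trigPoly, trigPoly, Finsupp.sum_smul_index (by simp), Finsupp.mul_sum]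
        simp only [mul_assoc]
      rw [e1, trigPoly, Finsupp.sum_add_index' (by simp) (by intros; ring)]
      rfl
    have hsum := wNorm_add_le (n := n) (μ := μ) hf
      (m1.sub (continuous_trigPoly c1).aemeasurable) (m2.sub (continuous_trigPoly c2).aemeasurable)
    have e2 : (fun x => h x - trigPoly ((1 / 2 : ℂ) • (c1 + c2)) x) = fun x =>
        (1 / 2 : ℂ) * ((h₁ x - trigPoly c1 x) + (h₂ x - trigPoly c2 x)) := by
      ext x; rw [e, hh]; ring
    rw [e2, hw]
    have hhalf : ‖(1 / 2 : ℂ)‖ₑ ≤ 1 := by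
      rw [← ofReal_norm]; simp
    calc _ ≤ 1 * wNorm n μ f (fun x => (h₁ x - trigPoly c1 x) + (h₂ x - trigPoly c2 x)) :=
          mul_le_mul' hhalf le_rfl
      _ ≤ _ := by rw [one_mul]; exact hsum
      _ < δ / 2 + δ / 2 := ENNReal.add_lt_add hc1 hc2
      _ = δ := ENNReal.add_halves δ
  have hge : optError n μ N a f ≤ specError n μ N a h f :=
    iInf_le (fun h : {h : ℝ → ℂ // IsSpectralCharacteristic n μ f h} => specError n μ N a h f)
      ⟨h, hhs⟩
  -- the parallelogram identity
  set S : (ℝ → ℂ) → ℝ≥0∞ := fun g => ∫⁻ x in Set.Ioc (-π) π, ‖g x‖ₑ ^ 2 *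
    ENNReal.ofReal (weight n μ x * f x) with hS
  have hωm : AEMeasurable (fun x => ENNReal.ofReal (weight n μ x * f x)) circVol :=
    ((measurable_weight n μ).aemeasurable.mul hf.1.aemeasurable).ennreal_ofReal
  have hSm : ∀ g : ℝ → ℂ, AEMeasurable g circVol → AEMeasurable (fun x => ‖g x‖ₑ ^ 2 *
      ENNReal.ofReal (weight n μ x * f x)) circVol := fun g hg =>
    (hg.enorm.pow_const 2).mul hωm
  have am1 : AEMeasurable (fun x => specA n μ N a x - h₁ x) circVol := hA.sub m1
  have am : AEMeasurable (fun x => specA n μ N a x - h x) circVol := hA.sub hhm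
  have am12 : AEMeasurable (fun x => h₁ x - h₂ x) circVol := m1.sub m2
  have hpar : S (fun x => specA n μ N a x - h₁ x) + S (fun x => specA n μ N a x - h₂ x) =
      2 * S (fun x => specA n μ N a x - h x) + ENNReal.ofReal (1 / 2) * S (fun x => h₁ x - h₂ x) := by
    simp only [hS]
    rw [← lintegral_add_left' (hSm _ am1), ← lintegral_const_mul'' _ (hSm _ am),
      ← lintegral_const_mul'' _ (hSm _ am12),
      ← lintegral_add_left' ((hSm _ am).const_mul 2)]
    refine lintegral_congr fun x => ?_
    rw [← add_mul, ← mul_assoc, ← mul_assoc, ← add_mul]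
    congr 1
    have hp := parallelogram_law_with_norm ℂ (specA n μ N a x - h₁ x) (specA n μ N a x - h₂ x)
    have e1 : specA n μ N a x - h₁ x + (specA n μ N a x - h₂ x) =
        2 * (specA n μ N a x - h x) := by rw [hh]; ring
    have e2 : ‖specA n μ N a x - h₁ x - (specA n μ N a x - h₂ x)‖ = ‖h₁ x - h₂ x‖ := by
      rw [← norm_neg]; congr 1; ring
    rw [e1, e2, norm_mul, Complex.norm_ofNat] at hp
    simp only [← ofReal_norm, ← ENNReal.ofReal_pow (norm_nonneg _)]
    rw [← ENNReal.ofReal_add (by positivity) (by positivity),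
      show (2 : ℝ≥0∞) = ENNReal.ofReal 2 by simp, ← ENNReal.ofReal_mul (by positivity),
      ← ENNReal.ofReal_mul (by positivity), ← ENNReal.ofReal_add (by positivity) (by positivity)]
    congr 1
    linarith
  have hκ : ENNReal.ofReal (1 / (2 * π)) ≠ 0 := by
    simp [Real.pi_pos]
  have hSE : ∀ g, specError n μ N a g f =
      ENNReal.ofReal (1 / (2 * π)) * S (fun x => specA n μ N a x - g x) := fun g => rfl
  set V := optError n μ N a f with hV
  have hpar2 := congrArg (fun t => ENNReal.ofReal (1 / (2 * π)) * t) hpar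
  simp only [mul_add] at hpar2
  rw [← hSE, ← hSE, H₁.2, H₂.2, ← mul_assoc _ 2, mul_comm _ 2, mul_assoc 2, ← hSE] at hpar2
  -- Cancelling `V + V` in `ℝ≥0∞` requires the finiteness `hfin`.
  have hz : ENNReal.ofReal (1 / (2 * π)) * (ENNReal.ofReal (1 / 2) * S fun x => h₁ x - h₂ x) = 0 := by
    have h1 : V + V + ENNReal.ofReal (1 / (2 * π)) *
        (ENNReal.ofReal (1 / 2) * S fun x => h₁ x - h₂ x) ≤ V + V + 0 := by
      rw [add_zero]
      conv_rhs => rw [hpar2]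
      rw [← two_mul]
      gcongr
    exact le_antisymm ((ENNReal.add_le_add_iff_left (by simp [hfin])).mp h1) zero_le
  have hz2 : S (fun x => h₁ x - h₂ x) = 0 := by
    rcases mul_eq_zero.mp hz with h' | h'
    · exact absurd h' hκ
    · rcases mul_eq_zero.mp h' with h'' | h''
      · simp at h''
      · exact h''
  rw [hS] at hz2
  simp only at hz2
  rw [lintegral_eq_zero_iff' (hSm _ am12)] at hz2
  filter_upwards [hz2, hpos] with x hx hx2
  simp only [Pi.zero_apply, mul_eq_zero, ENNReal.ofReal_eq_zero, not_le.mpr hx2, or_false] at hx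
  have := pow_eq_zero_iff (two_ne_zero) |>.mp hx
  exact sub_eq_zero.mp (enorm_eq_zero.mp this)

/-! ### The mean square error of the optimal estimate -/

lemma dSeries_mul (n : ℕ) {μ : ℕ} (hμ : 1 ≤ μ) :
    (PowerSeries.mk fun j => if μ ∣ j then (1 : ℂ) else 0) ^ n * (1 - PowerSeries.X ^ μ) ^ n = 1 := by
  have h : (PowerSeries.mk fun j => if μ ∣ j then (1 : ℂ) else 0) * (1 - PowerSeries.X ^ μ) = 1 := by
    ext k
    rw [mul_sub, mul_one, map_sub, PowerSeries.coeff_mul_X_pow', PowerSeries.coeff_one]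
    simp only [PowerSeries.coeff_mk]
    rcases lt_or_ge k μ with hk | hk
    · rw [if_neg (not_le.mpr hk), sub_zero]
      refine if_congr ⟨fun h => Nat.eq_zero_of_dvd_of_lt h hk, fun h => by simp [h]⟩ rfl rfl
    · have : μ ∣ k - μ ↔ μ ∣ k := (Nat.dvd_sub_iff_left hk dvd_rfl)
      rw [if_pos hk, if_neg (show k ≠ 0 by omega)]
      simp [this]
  rw [← mul_pow, h, one_pow]

lemma one_sub_X_pow_pow (n μ : ℕ) : (1 - PowerSeries.X ^ μ : PowerSeries ℂ) ^ n =
    ∑ l ∈ Finset.range (n + 1), ((-1 : ℂ) ^ l * (n.choose l : ℂ)) • PowerSeries.X ^ (l * μ) := by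
  rw [sub_eq_add_neg, add_comm, add_pow]
  refine Finset.sum_congr rfl fun l _ => ?_
  rw [neg_pow, one_pow, mul_one, ← pow_mul, mul_comm μ, PowerSeries.smul_eq_C_mul]
  simp only [map_mul, map_pow, map_neg, map_one, map_natCast]
  ring

/-- The coefficients d_μ are those of (1 - X^μ)^{-n}. Hence D_N^μ undoes the n-fold difference of a
sequence extended by 0 to negative indices. -/
lemma sum_bSeq_nonneg_part {n μ N : ℕ} (hμ : 1 ≤ μ) (a : ℕ → ℂ) (x : ℕ → ℂ) :
    ∑ k ∈ Finset.range (N + 1), bSeq n μ N a k * ∑ l ∈ Finset.range (n + 1),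
      (if l * μ ≤ k then (-1 : ℂ) ^ l * (n.choose l : ℂ) * x (k - l * μ) else 0) =
    ∑ j ∈ Finset.range (N + 1), a j * x j := by
  have hy : ∀ k, ∑ l ∈ Finset.range (n + 1),
      (if l * μ ≤ k then (-1 : ℂ) ^ l * (n.choose l : ℂ) * x (k - l * μ) else 0) =
      PowerSeries.coeff k ((1 - PowerSeries.X ^ μ) ^ n * PowerSeries.mk x) := by
    intro k
    rw [one_sub_X_pow_pow, Finset.sum_mul, map_sum]
    refine Finset.sum_congr rfl fun l _ => ?_
    rw [smul_mul_assoc, map_smul, PowerSeries.coeff_X_pow_mul', PowerSeries.coeff_mk, smul_eq_mul,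
      mul_ite, mul_zero]
  simp only [hy, bSeq, Finset.sum_mul]
  rw [Finset.sum_comm]
  refine Finset.sum_congr rfl fun j hj => ?_
  simp only [Finset.mem_range] at hj
  have h1 : x j = PowerSeries.coeff j ((PowerSeries.mk fun j => if μ ∣ j then (1 : ℂ) else 0) ^ n *
      ((1 - PowerSeries.X ^ μ) ^ n * PowerSeries.mk x)) := by
    rw [← mul_assoc, dSeries_mul n hμ, one_mul, PowerSeries.coeff_mk]
  rw [h1, mul_comm ((PowerSeries.mk fun j => if μ ∣ j then (1 : ℂ) else 0) ^ n),
    PowerSeries.coeff_mul, Finset.Nat.sum_antidiagonal_eq_sum_range_succ_mk, Finset.mul_sum]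
  rw [← Finset.sum_subset (Finset.range_mono (show j + 1 ≤ N + 1 by omega)) fun k _ hk2 => by
    simp only [Finset.mem_range] at hk2
    rw [if_neg (by omega), zero_mul]]
  refine Finset.sum_congr rfl fun k hk => ?_
  simp only [Finset.mem_range] at hk
  rw [if_pos (by omega), dCoeff]
  ring

/-- These are the terms of ∑ b(k) ξ^{(n)}(k, μ) with negative time index, complementary to those of
`sum_bSeq_nonneg_part`. -/
lemma sum_vCoeff {n μ N : ℕ} (a : ℕ → ℂ) (x : ℤ → ℂ) :
    ∑ i ∈ Finset.Icc 1 (μ * n), vCoeff n μ N a i * x (-(i : ℤ)) =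
    ∑ k ∈ Finset.range (N + 1), bSeq n μ N a k * ∑ l ∈ Finset.range (n + 1),
      (if l * μ ≤ k then 0 else (-1 : ℂ) ^ l * (n.choose l : ℂ) * x (k - l * μ)) := by
  have h1 : ∀ i, vCoeff n μ N a i * x (-(i : ℤ)) = ∑ k ∈ Finset.range (N + 1),
      ∑ l ∈ Finset.range (n + 1), if l * μ = i + k then
        bSeq n μ N a k * ((-1 : ℂ) ^ l * (n.choose l : ℂ) * x (-(i : ℤ))) else 0 := by
    intro i
    rw [vCoeff, Finset.sum_mul, Finset.sum_comm]
    refine Finset.sum_congr rfl fun l _ => ?_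
    simp only [bVec_eq]
    rw [← Finset.sum_range (fun k => if l * μ = i + k then
      (-1 : ℂ) ^ l * (n.choose l : ℂ) * bSeq n μ N a k else 0), Finset.sum_mul]
    refine Finset.sum_congr rfl fun k _ => ?_
    split_ifs <;> ring
  simp only [h1]
  rw [Finset.sum_comm]
  refine Finset.sum_congr rfl fun k _ => ?_
  rw [Finset.sum_comm, Finset.mul_sum]
  refine Finset.sum_congr rfl fun l hl => ?_
  simp only [Finset.mem_range] at hl
  have hlμ : l * μ ≤ μ * n := by rw [mul_comm]; exact Nat.mul_le_mul_left _ (by omega)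
  split_ifs with h
  · rw [mul_zero]
    refine Finset.sum_eq_zero fun i hi => if_neg ?_
    simp only [Finset.mem_Icc] at hi
    omega
  · rw [Finset.sum_eq_single (l * μ - k)]
    · rw [if_pos (by omega)]
      congr 3
      push_cast [Nat.cast_sub (show k ≤ l * μ by omega)]
      ring
    · intro i _ hi
      exact if_neg (by omega)
    · intro hi
      simp only [Finset.mem_Icc] at hi
      omega

/-- The initial values in the estimate complete A_N ξ to ∑ b(k) ξ^{(n)}(k, μ). The error then
involves increments only, and its second moment is determined by the spectral density. -/
lemma sub_linEstimate_eq {Ω : Type w} {n μ N : ℕ} (hμ : 1 ≤ μ) (a : ℕ → ℂ) (ξ : ℤ → Ω → ℂ)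
    (c : ℕ →₀ ℂ) (ω : Ω) :
    ∑ k ∈ Finset.range (N + 1), a k * ξ (k : ℤ) ω - linEstimate n μ N a ξ c ω =
      ∑ k ∈ Finset.range (N + 1), bSeq n μ N a k * increment n μ ξ (k : ℤ) ω -
        c.sum fun k z => z * increment n μ ξ (-1 - (k : ℤ)) ω := by
  rw [linEstimate, sum_vCoeff a (fun m => ξ m ω), ← sum_bSeq_nonneg_part (n := n) hμ a
    (fun k => ξ (k : ℤ) ω), ← sub_sub, sub_neg_eq_add, ← Finset.sum_add_distrib]
  congr 1
  refine Finset.sum_congr rfl fun k _ => ?_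
  rw [← mul_add, ← Finset.sum_add_distrib, increment]
  congr 1
  refine Finset.sum_congr rfl fun l _ => ?_
  split_ifs with h
  · rw [add_zero]
    push_cast [Nat.cast_sub h]
    rfl
  · rw [zero_add]

section Gram

variable {Ω : Type w} [MeasurableSpace Ω] {P : Measure Ω} {n : ℕ} {ξ : ℤ → Ω → ℂ} {f : ℝ → ℝ}

lemma intervalIntegrable_weight {n μ : ℕ} {f : ℝ → ℝ} (hf : IsSpectralDensity f) :
    IntervalIntegrable (fun x => ((weight n μ x * f x : ℝ) : ℂ)) volume (-π) π := by
  rw [intervalIntegrable_iff_integrableOn_Ioc_of_le (by linarith [Real.pi_pos])]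
  refine Integrable.ofReal ?_
  refine hf.1.bdd_mul (measurable_weight n μ).aestronglyMeasurable
    (c := coeffNorm (wSeries n μ) ^ 2) ?_
  filter_upwards [weight_le (n := n) (μ := μ)] with x hx
  rw [Real.norm_eq_abs, abs_of_nonneg]
  · exact hx
  · rw [weight_eq]; positivity

lemma HasSpectralDensity.integral_mul_conj (hξ : HasSpectralDensity P n ξ f) (μ : ℕ) (p q : ℤ) :
    ∫ ω, increment n μ ξ p ω * (starRingEnd ℂ) (increment n μ ξ q ω) ∂P =
      (1 / (2 * π) : ℂ) * ∫ x in (-π)..π, circ x ^ (q - p) * ((weight n μ x * f x : ℝ) : ℂ) := by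
  have h := hξ.structural q (p - q) μ μ
  rw [add_sub_cancel] at h
  rw [h]
  congr 1
  refine intervalIntegral.integral_congr fun x _ => ?_
  have e1 : cexp (I * x * ((p - q : ℤ) : ℂ)) = circ x ^ (q - p) := by
    rw [circ_zpow]; congr 1; push_cast; ring
  have e2 : cexp (-(I * ((μ : ℤ) : ℂ) * x)) = circ x ^ μ := by
    rw [circ_pow]; congr 1; push_cast; ring
  have e3 : cexp (I * ((μ : ℤ) : ℂ) * x) = (starRingEnd ℂ) (circ x ^ μ) := by
    rw [map_pow, conj_circ, inv_pow, circ_pow, ← Complex.exp_neg]; congr 1; push_cast; ring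
  have e4 : (1 - circ x ^ μ) ^ n * (1 - (starRingEnd ℂ) (circ x ^ μ)) ^ n =
      ((‖1 - circ x ^ μ‖ ^ (2 * n) : ℝ) : ℂ) := by
    rw [← mul_pow]
    have := Complex.mul_conj' (1 - circ x ^ μ)
    rw [map_sub, map_one] at this
    rw [this, ← pow_mul]; push_cast; rfl
  simp only [e1, e2, e3, weight, ← circ_pow]
  rw [mul_assoc (circ x ^ (q - p)), e4]
  push_cast
  ring

/-- The increments as elements of `L₂(P)`. -/
def incrementLp (hξ : HasSpectralDensity P n ξ f) (μ : ℕ) (m : ℤ) : Lp ℂ 2 P :=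
  (hξ.memLp μ m).toLp

lemma coeFn_incrementLp (hξ : HasSpectralDensity P n ξ f) (μ : ℕ) (m : ℤ) :
    incrementLp hξ μ m =ᵐ[P] increment n μ ξ m := MemLp.coeFn_toLp _

lemma inner_eq_integral_mul_conj (x y : Lp ℂ 2 P) {X Y : Ω → ℂ} (hX : x =ᵐ[P] X) (hY : y =ᵐ[P] Y) :
    inner ℂ x y = ∫ ω, Y ω * (starRingEnd ℂ) (X ω) ∂P := by
  rw [L2.inner_def]
  refine integral_congr_ae ?_
  filter_upwards [hX, hY] with ω h1 h2
  rw [h1, h2, RCLike.inner_apply]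

lemma inner_incrementLp (hξ : HasSpectralDensity P n ξ f) (μ : ℕ) (q p : ℤ) :
    inner ℂ (incrementLp hξ μ q) (incrementLp hξ μ p) =
      (1 / (2 * π) : ℂ) * ∫ x in (-π)..π, circ x ^ (q - p) * ((weight n μ x * f x : ℝ) : ℂ) := by
  rw [inner_eq_integral_mul_conj _ _ (coeFn_incrementLp hξ μ q) (coeFn_incrementLp hξ μ p),
    hξ.integral_mul_conj]

lemma enorm_sq_eq_lintegral (x : Lp ℂ 2 P) {X : Ω → ℂ} (hX : x =ᵐ[P] X) :
    ‖x‖ₑ ^ 2 = ∫⁻ ω, ‖X ω‖ₑ ^ 2 ∂P := by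
  rw [Lp.enorm_def, eLpNorm_two_sq]
  refine lintegral_congr_ae ?_
  filter_upwards [hX] with ω h
  rw [h]

/-- The spectral isometry on finite linear combinations of increments. -/
lemma lintegral_sum_increment (hξ : HasSpectralDensity P n ξ f) (hf : IsSpectralDensity f) (μ : ℕ)
    {ι : Type*} (s : Finset ι) (c : ι → ℂ) (p : ι → ℤ) :
    ∫⁻ ω, ‖∑ i ∈ s, c i * increment n μ ξ (p i) ω‖ₑ ^ 2 ∂P = ENNReal.ofReal (1 / (2 * π)) *
      ∫⁻ x in Set.Ioc (-π) π, ‖∑ i ∈ s, c i * circ x ^ (-p i)‖ₑ ^ 2 *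
        ENNReal.ofReal (weight n μ x * f x) := by
  have hπ := Real.pi_pos
  have hae : ((∑ i ∈ s, c i • incrementLp hξ μ (p i) : Lp ℂ 2 P) : Ω → ℂ) =ᵐ[P]
      fun ω => ∑ i ∈ s, c i * increment n μ ξ (p i) ω := by
    refine (Lp.coeFn_finsetSum _ _).trans ?_
    have h1 : ∀ i ∈ s, ∀ᵐ ω ∂P, (c i • incrementLp hξ μ (p i) : Lp ℂ 2 P) ω =
        c i * increment n μ ξ (p i) ω := fun i _ => by
      filter_upwards [Lp.coeFn_smul (c i) (incrementLp hξ μ (p i)), coeFn_incrementLp hξ μ (p i)]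
        with ω h2 h3
      rw [h2, Pi.smul_apply, h3, smul_eq_mul]
    filter_upwards [(ae_ball_iff s.countable_toSet).mpr h1] with ω hω
    rw [Finset.sum_apply]
    exact Finset.sum_congr rfl hω
  rw [← enorm_sq_eq_lintegral _ hae, ← ofReal_norm, ← ENNReal.ofReal_pow (norm_nonneg _)]
  have hint : ∀ i j, IntervalIntegrable (fun x => (starRingEnd ℂ) (c i) * c j *
      (circ x ^ (p i - p j) * ((weight n μ x * f x : ℝ) : ℂ))) volume (-π) π := fun i j =>
    ((intervalIntegrable_weight hf).continuousOn_mul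
      (continuous_circ_zpow _).continuousOn).const_mul _
  have hint2 : ∀ i, IntervalIntegrable (fun x => ∑ j ∈ s, (starRingEnd ℂ) (c i) * c j *
      (circ x ^ (p i - p j) * ((weight n μ x * f x : ℝ) : ℂ))) volume (-π) π := fun i =>
    ⟨integrable_finsetSum s fun j _ => (hint i j).1, integrable_finsetSum s fun j _ => (hint i j).2⟩
  have hexp : ∀ x, ((‖∑ i ∈ s, c i * circ x ^ (-p i)‖ ^ 2 * (weight n μ x * f x) : ℝ) : ℂ) =
      ∑ i ∈ s, ∑ j ∈ s, (starRingEnd ℂ) (c i) * c j *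
      (circ x ^ (p i - p j) * ((weight n μ x * f x : ℝ) : ℂ)) := by
    intro x
    have h1 := Complex.conj_mul' (∑ i ∈ s, c i * circ x ^ (-p i))
    rw [Complex.ofReal_mul, Complex.ofReal_pow, ← h1, map_sum, Finset.sum_mul_sum, Finset.sum_mul]
    refine Finset.sum_congr rfl fun i _ => ?_
    rw [Finset.sum_mul]
    refine Finset.sum_congr rfl fun j _ => ?_
    rw [map_mul, map_zpow₀, conj_circ, inv_zpow', neg_neg, sub_eq_add_neg,
      zpow_add₀ (circ_ne_zero x)]
    ring
  have hnorm : ((‖∑ i ∈ s, c i • incrementLp hξ μ (p i)‖ ^ 2 : ℝ) : ℂ) =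
      ((1 / (2 * π) * ∫ x in (-π)..π, ‖∑ i ∈ s, c i * circ x ^ (-p i)‖ ^ 2 *
        (weight n μ x * f x) : ℝ) : ℂ) := by
    have h1 := inner_self_eq_norm_sq_to_K (𝕜 := ℂ) (∑ i ∈ s, c i • incrementLp hξ μ (p i))
    have h2 : ((‖∑ i ∈ s, c i • incrementLp hξ μ (p i)‖ ^ 2 : ℝ) : ℂ) =
        inner ℂ (∑ i ∈ s, c i • incrementLp hξ μ (p i)) (∑ i ∈ s, c i • incrementLp hξ μ (p i)) := by
      rw [h1]; push_cast; rfl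
    rw [h2, Complex.ofReal_mul, ← intervalIntegral.integral_ofReal]
    simp only [hexp]
    rw [intervalIntegral.integral_finsetSum fun i _ => hint2 i,
      sum_inner, Finset.mul_sum]
    refine Finset.sum_congr rfl fun i _ => ?_
    rw [intervalIntegral.integral_finsetSum fun j _ => hint i j, inner_sum, Finset.mul_sum]
    refine Finset.sum_congr rfl fun j _ => ?_
    rw [inner_smul_left, inner_smul_right, inner_incrementLp, intervalIntegral.integral_const_mul]
    push_cast; ring
  rw [Complex.ofReal_inj.mp hnorm, ENNReal.ofReal_mul (by positivity),
    intervalIntegral.integral_of_le (by linarith), ofReal_integral_eq_lintegral_ofReal]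
  · congr 1
    refine lintegral_congr fun x => ?_
    rw [ENNReal.ofReal_mul (by positivity), ENNReal.ofReal_pow (norm_nonneg _), ofReal_norm]
  · have h1 : Integrable (fun x => ((‖∑ i ∈ s, c i * circ x ^ (-p i)‖ ^ 2 *
        (weight n μ x * f x) : ℝ) : ℂ)) circVol := by
      simp only [hexp]
      exact integrable_finsetSum s fun i _ => (hint2 i).1
    exact h1.re
  · filter_upwards [hf.2] with x hx
    have : 0 ≤ weight n μ x := by rw [weight_eq]; positivity
    positivity

lemma meanSquareError_eq {μ N : ℕ} (hμ : 1 ≤ μ) (a : ℕ → ℂ) (hξ : HasSpectralDensity P n ξ f)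
    (hf : IsSpectralDensity f) : meanSquareError P n μ N a ξ = optError n μ N a f := by
  rw [optError_eq_iInf hf, meanSquareError]
  refine iInf_congr fun c => ?_
  -- The target and the estimate are treated as one combination over a disjoint index set, at times
  -- `k` and `-1 - k`, so a single use of the isometry suffices.
  have h := lintegral_sum_increment hξ hf μ ((Finset.range (N + 1)).disjSum c.support)
    (Sum.elim (bSeq n μ N a) fun k => -c k) (Sum.elim (fun k => (k : ℤ)) fun k => -1 - (k : ℤ))
  simp only [Finset.sum_disjSum, Sum.elim_inl, Sum.elim_inr] at h
  rw [specError]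
  refine Eq.trans (lintegral_congr fun ω => ?_) (h.trans ?_)
  · rw [sub_linEstimate_eq hμ, sub_eq_add_neg, Finsupp.sum, ← Finset.sum_neg_distrib]
    simp only [neg_mul]
  · congr 1
    refine lintegral_congr fun x => ?_
    congr 3
    rw [sub_eq_add_neg, specA, trigPoly, Finsupp.sum, ← Finset.sum_neg_distrib]
    congr 1
    · simp only [bVec_eq]
      rw [← Finset.sum_range (fun k => bSeq n μ N a k * cexp (I * x * (k : ℕ)))]
      refine Finset.sum_congr rfl fun k _ => ?_
      rw [exp_I_mul_nat, zpow_neg, zpow_natCast]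
    · refine Finset.sum_congr rfl fun k _ => ?_
      rw [neg_mul, neg_sub, sub_neg_eq_add, circ_zpow]
      congr 3
      push_cast; ring

end Gram

/-! ### One-sided filters of bounded sequences in a Hilbert space -/

section Filter

variable {H : Type*} [NormedAddCommGroup H] [InnerProductSpace ℂ H]

/-- The one-sided filter `∑_k F(k) y(m - k)`. -/
def filt (F : PowerSeries ℂ) (y : ℤ → H) (m : ℤ) : H :=
  ∑' k : ℕ, PowerSeries.coeff k F • y (m - k)

lemma summable_norm_filt {F : PowerSeries ℂ} (hF : AbsSummable F) {y : ℤ → H} {M : ℝ}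
    (hy : ∀ m, ‖y m‖ ≤ M) (m : ℤ) : Summable fun k : ℕ => ‖PowerSeries.coeff k F • y (m - k)‖ := by
  refine Summable.of_nonneg_of_le (fun _ => norm_nonneg _) (fun k => ?_) (Summable.mul_right M hF)
  rw [norm_smul]
  exact mul_le_mul_of_nonneg_left (hy _) (norm_nonneg _)

lemma filt_one (y : ℤ → H) : filt 1 y = y := by
  ext m
  rw [filt, tsum_eq_single 0]
  · simp
  · intro k hk; simp [PowerSeries.coeff_one, hk]

lemma norm_filt_le {F : PowerSeries ℂ} (hF : AbsSummable F) {y : ℤ → H} {M : ℝ}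
    (hy : ∀ m, ‖y m‖ ≤ M) (m : ℤ) : ‖filt F y m‖ ≤ coeffNorm F * M := by
  refine (norm_tsum_le_tsum_norm (summable_norm_filt hF hy m)).trans ?_
  rw [coeffNorm, ← tsum_mul_right]
  refine (summable_norm_filt hF hy m).tsum_le_tsum (fun k => ?_) (Summable.mul_right M hF)
  rw [norm_smul]
  exact mul_le_mul_of_nonneg_left (hy _) (norm_nonneg _)

variable [CompleteSpace H]

lemma hasSum_filt {F : PowerSeries ℂ} (hF : AbsSummable F) {y : ℤ → H} {M : ℝ}
    (hy : ∀ m, ‖y m‖ ≤ M) (m : ℤ) :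
    HasSum (fun k : ℕ => PowerSeries.coeff k F • y (m - k)) (filt F y m) :=
  (summable_norm_filt hF hy m).of_norm.hasSum

lemma filt_mul {F G : PowerSeries ℂ} (hF : AbsSummable F) (hG : AbsSummable G) {y : ℤ → H} {M : ℝ}
    (hy : ∀ m, ‖y m‖ ≤ M) : filt (F * G) y = filt F (filt G y) := by
  ext m
  have hM : 0 ≤ M := (norm_nonneg _).trans (hy 0)
  have hs : Summable fun p : ℕ × ℕ =>
      (PowerSeries.coeff p.1 F * PowerSeries.coeff p.2 G) • y (m - p.1 - p.2) := by
    have h1 : Summable fun p : ℕ × ℕ => ‖PowerSeries.coeff p.1 F‖ * ‖PowerSeries.coeff p.2 G‖ :=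
      Summable.mul_of_nonneg (f := fun k => ‖PowerSeries.coeff k F‖)
        (g := fun k => ‖PowerSeries.coeff k G‖) hF hG (fun _ => norm_nonneg _)
        (fun _ => norm_nonneg _)
    refine Summable.of_norm_bounded (h1.mul_right M) fun p => ?_
    rw [norm_smul, norm_mul]
    exact mul_le_mul_of_nonneg_left (hy _) (by positivity)
  have h1 : filt F (filt G y) m = ∑' p : ℕ × ℕ,
      (PowerSeries.coeff p.1 F * PowerSeries.coeff p.2 G) • y (m - p.1 - p.2) := by
    rw [hs.tsum_prod]
    refine tsum_congr fun i => ?_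
    rw [filt, ← ((summable_norm_filt hG hy (m - i)).of_norm).tsum_const_smul]
    exact tsum_congr fun j => by rw [smul_smul]
  rw [h1, ← Finset.HasAntidiagonal.sigmaAntidiagonalEquivProd.tsum_eq]
  have hs' := Finset.HasAntidiagonal.sigmaAntidiagonalEquivProd.summable_iff.mpr hs
  refine Eq.trans ?_ (hs'.tsum_sigma' fun k => (hasSum_fintype _).summable).symm
  refine tsum_congr fun k => ?_
  rw [PowerSeries.coeff_mul, Finset.sum_smul, tsum_fintype, ← Finset.sum_coe_sort]
  refine Finset.sum_congr rfl fun p _ => ?_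
  have hp := Finset.HasAntidiagonal.mem_antidiagonal.mp p.2
  change _ = (PowerSeries.coeff (p : ℕ × ℕ).1 F * PowerSeries.coeff (p : ℕ × ℕ).2 G) •
    y (m - (p : ℕ × ℕ).1 - (p : ℕ × ℕ).2)
  rw [sub_sub, ← Nat.cast_add, hp]

/-- A filter multiplies the spectral density by |F|². The sum is pulled through one argument of the
inner product at a time, each time by `hasSum_integral`. -/
lemma inner_filt {F : PowerSeries ℂ} (hF : AbsSummable F) {y : ℤ → H} {M : ℝ}
    (hy : ∀ m, ‖y m‖ ≤ M) {W : ℝ → ℝ}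
    (hW : IntervalIntegrable (fun x => (W x : ℂ)) volume (-π) π)
    (hgram : ∀ q p, inner ℂ (y q) (y p) =
      (1 / (2 * π) : ℂ) * ∫ x in (-π)..π, circ x ^ (q - p) * (W x : ℂ)) (q p : ℤ) :
    inner ℂ (filt F y q) (filt F y p) = (1 / (2 * π) : ℂ) * ∫ x in (-π)..π, circ x ^ (q - p) *
      ((‖evalAt F (circ x)‖ ^ 2 * W x : ℝ) : ℂ) := by
  have hπ := Real.pi_pos
  have hcF := hF.continuous_eval_circ
  have hcF' : Continuous fun x => (starRingEnd ℂ) (evalAt F (circ x)) :=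
    Complex.continuous_conj.comp hcF
  have h1 : ∀ q p, inner ℂ (y q) (filt F y p) = (1 / (2 * π) : ℂ) * ∫ x in (-π)..π,
      circ x ^ (q - p) * (W x : ℂ) * evalAt F (circ x) := by
    intro q p
    have a := (hasSum_filt hF hy p).mapL (innerSL ℂ (y q))
    have b := (hF.hasSum_integral (hW.continuousOn_mul
      (continuous_circ_zpow (q - p)).continuousOn)).mul_left (1 / (2 * π) : ℂ)
    refine a.unique (b.congr_fun ?_)
    intro k
    rw [innerSL_apply_apply, inner_smul_right, hgram]
    have e : ∀ x, circ x ^ (q - (p - (k : ℤ))) * (W x : ℂ) =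
        circ x ^ (q - p) * (W x : ℂ) * circ x ^ k := fun x => by
      rw [show q - (p - (k : ℤ)) = (q - p) + k by ring, zpow_add₀ (circ_ne_zero x), zpow_natCast]
      ring
    simp only [e]; ring
  have h2 : ∀ q p, inner ℂ (filt F y q) (y p) = (1 / (2 * π) : ℂ) * ∫ x in (-π)..π,
      circ x ^ (q - p) * (W x : ℂ) * (starRingEnd ℂ) (evalAt F (circ x)) := by
    intro q p
    rw [← inner_conj_symm, h1, map_mul, intervalIntegral.integral_of_le (by linarith),
      intervalIntegral.integral_of_le (by linarith), ← integral_conj]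
    congr 1
    · have := map_ofNat (starRingEnd ℂ) 2
      simp [this]
    · refine integral_congr_ae (Eventually.of_forall fun x => ?_)
      simp only [map_mul, map_zpow₀, conj_circ, inv_zpow', Complex.conj_ofReal, neg_sub]
  have a := (hasSum_filt hF hy p).mapL (innerSL ℂ (filt F y q))
  have b := (hF.hasSum_integral ((hW.continuousOn_mul
      (continuous_circ_zpow (q - p)).continuousOn).mul_continuousOn hcF'.continuousOn)).mul_left
        (1 / (2 * π) : ℂ)
  have c : inner ℂ (filt F y q) (filt F y p) = (1 / (2 * π) : ℂ) * ∫ x in (-π)..π,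
      circ x ^ (q - p) * (W x : ℂ) * (starRingEnd ℂ) (evalAt F (circ x)) * evalAt F (circ x) := by
    refine a.unique (b.congr_fun ?_)
    intro k
    rw [innerSL_apply_apply, inner_smul_right, h2]
    have e : ∀ x, circ x ^ (q - (p - (k : ℤ))) * (W x : ℂ) * (starRingEnd ℂ) (evalAt F (circ x)) =
        circ x ^ (q - p) * (W x : ℂ) * (starRingEnd ℂ) (evalAt F (circ x)) * circ x ^ k :=
      fun x => by
        rw [show q - (p - (k : ℤ)) = (q - p) + k by ring, zpow_add₀ (circ_ne_zero x), zpow_natCast]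
        ring
    simp only [e]; ring
  rw [c]
  congr 1
  refine intervalIntegral.integral_congr fun x _ => ?_
  have := Complex.conj_mul' (evalAt F (circ x))
  simp only [mul_assoc, this]
  push_cast; ring

end Filter

/-! ### Increments with different steps -/

/-- The backward shift of two-sided sequences. -/
def backShift : Module.End ℂ (ℤ → ℂ) where
  toFun x m := x (m - 1)
  map_add' _ _ := rfl
  map_smul' _ _ := rfl

lemma backShift_pow_apply (k : ℕ) (x : ℤ → ℂ) (m : ℤ) : (backShift ^ k) x m = x (m - k) := by
  induction k generalizing m with
  | zero => simp
  | succ k ih =>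
    rw [pow_succ', Module.End.mul_apply]
    change (backShift ^ k) x (m - 1) = _
    rw [ih]; congr 1; push_cast; ring

lemma aeval_backShift_apply (p : Polynomial ℂ) (x : ℤ → ℂ) (m : ℤ) :
    Polynomial.aeval backShift p x m =
      ∑ k ∈ Finset.range (p.natDegree + 1), p.coeff k * x (m - k) := by
  rw [Polynomial.aeval_eq_sum_range]
  simp [LinearMap.sum_apply, Finset.sum_apply, backShift_pow_apply]

/-- Viewing increments as polynomials in the shift turns the polynomial identity 1 - X^s = (1 + ...
+ X^{s-1})(1 - X) into a relation between increments of step `s` and of step 1. -/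
lemma increment_eq_aeval {Ω : Type w} (n s : ℕ) (ξ : ℤ → Ω → ℂ) (m : ℤ) (ω : Ω) :
    increment n s ξ m ω =
      Polynomial.aeval backShift ((1 - Polynomial.X ^ s) ^ n : Polynomial ℂ) (fun j => ξ j ω) m := by
  rw [sub_eq_add_neg, add_comm, add_pow, map_sum, LinearMap.sum_apply, Finset.sum_apply, increment]
  refine Finset.sum_congr rfl fun l _ => ?_
  have e : (-(Polynomial.X : Polynomial ℂ) ^ s) ^ l * 1 ^ (n - l) * (n.choose l : Polynomial ℂ) =
      ((-1 : ℂ) ^ l * (n.choose l : ℂ)) • Polynomial.X ^ (l * s) := by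
    rw [neg_pow, one_pow, mul_one, ← pow_mul, mul_comm s, Polynomial.smul_eq_C_mul]
    simp only [map_mul, map_pow, map_neg, map_one, map_natCast]
    ring
  rw [e, map_smul, map_pow, Polynomial.aeval_X, LinearMap.smul_apply, Pi.smul_apply,
    backShift_pow_apply, smul_eq_mul]
  push_cast; rfl

/-- The polynomial `(∑_{j < s} X^j)^n`. -/
def stepPoly (n s : ℕ) : Polynomial ℂ := (∑ j ∈ Finset.range s, Polynomial.X ^ j) ^ n

lemma coe_stepPoly (n s : ℕ) : (stepPoly n s : PowerSeries ℂ) = geomPoly s ^ n := by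
  rw [stepPoly, geomPoly, Polynomial.coe_pow]
  congr 1
  induction s with
  | zero => simp
  | succ s ih =>
    rw [Finset.sum_range_succ, Finset.sum_range_succ, Polynomial.coe_add, ih, Polynomial.coe_pow,
      Polynomial.coe_X]

lemma increment_eq_sum_increment_one {Ω : Type w} (n s : ℕ) (ξ : ℤ → Ω → ℂ) (m : ℤ) (ω : Ω) :
    increment n s ξ m ω = ∑ k ∈ Finset.range ((stepPoly n s).natDegree + 1),
      (stepPoly n s).coeff k * increment n (1 : ℕ) ξ (m - k) ω := by
  have h : ((1 : Polynomial ℂ) - Polynomial.X ^ s) ^ n =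
      stepPoly n s * (1 - Polynomial.X ^ 1) ^ n := by
    rw [stepPoly, ← mul_pow, pow_one, geom_sum_mul_neg]
  rw [increment_eq_aeval, h, map_mul, Module.End.mul_apply, aeval_backShift_apply]
  refine Finset.sum_congr rfl fun k _ => ?_
  rw [increment_eq_aeval]

/-! ### The moving average representation -/

section Innovation

variable {Ω : Type w} [MeasurableSpace Ω] {P : Measure Ω} {n : ℕ} {ξ : ℤ → Ω → ℂ} {f : ℝ → ℝ}

lemma coeFn_sum_smul {ι : Type*} (s : Finset ι) (c : ι → ℂ) (y : ι → Lp ℂ 2 P) {Y : ι → Ω → ℂ}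
    (hY : ∀ i, y i =ᵐ[P] Y i) :
    ((∑ i ∈ s, c i • y i : Lp ℂ 2 P) : Ω → ℂ) =ᵐ[P] fun ω => ∑ i ∈ s, c i * Y i ω := by
  have h1 : ∀ i ∈ s, ∀ᵐ ω ∂P, (c i • y i : Lp ℂ 2 P) ω = c i * Y i ω := fun i _ => by
    filter_upwards [Lp.coeFn_smul (c i) (y i), hY i] with ω h2 h3
    rw [h2, Pi.smul_apply, h3, smul_eq_mul]
  filter_upwards [Lp.coeFn_finsetSum s fun i => c i • y i,
    (ae_ball_iff s.countable_toSet).mpr h1] with ω h2 hω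
  rw [h2, Finset.sum_apply]
  exact Finset.sum_congr rfl hω

lemma tendsto_lintegral_of_hasSum {x : Lp ℂ 2 P} {c : ℕ → ℂ} {y : ℕ → Lp ℂ 2 P}
    (h : HasSum (fun k => c k • y k) x) {X : Ω → ℂ} (hX : x =ᵐ[P] X) {Y : ℕ → Ω → ℂ}
    (hY : ∀ k, y k =ᵐ[P] Y k) :
    Tendsto (fun K : ℕ => ∫⁻ ω, ‖X ω - ∑ k ∈ Finset.range K, c k * Y k ω‖ₑ ^ 2 ∂P) atTop (𝓝 0) := by
  have h1 : Tendsto (fun K : ℕ => ‖x - ∑ k ∈ Finset.range K, c k • y k‖ₑ ^ 2) atTop (𝓝 0) := by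
    have := (tendsto_const_nhds (x := x)).sub h.tendsto_sum_nat
    rw [sub_self] at this
    have h2 := ENNReal.Tendsto.pow (n := 2) (this.enorm)
    simpa using h2
  refine h1.congr fun K => ?_
  refine enorm_sq_eq_lintegral _ ?_
  filter_upwards [Lp.coeFn_sub x (∑ k ∈ Finset.range K, c k • y k), hX,
    coeFn_sum_smul (Finset.range K) c y hY] with ω h2 h3 h4
  rw [h2, Pi.sub_apply, h3, h4]

lemma inClosedSpan_of_hasSum {x : Lp ℂ 2 P} {c : ℕ → ℂ} {y : ℕ → Lp ℂ 2 P}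
    (h : HasSum (fun k => c k • y k) x) {X : Ω → ℂ} (hX : x =ᵐ[P] X) {Y : ℕ → Ω → ℂ}
    (hY : ∀ k, y k =ᵐ[P] Y k) {S : Set (Ω → ℂ)} (hS : ∀ k, Y k ∈ S) : InClosedSpan P S X := by
  intro δ hδ
  obtain ⟨K, hK⟩ := ((tendsto_order.mp (tendsto_lintegral_of_hasSum h hX hY)).2 δ hδ).exists
  refine ⟨∑ k ∈ Finset.range K, c k • Y k, Submodule.sum_mem _ fun k _ =>
    Submodule.smul_mem _ _ (Submodule.subset_span (hS k)), ?_⟩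
  simpa using hK

/-- Increments with a canonical factor of the spectral density are one-sided moving averages of
an innovation sequence. -/
lemma exists_innovation [IsProbabilityMeasure P] {φ : ℕ → ℂ} (hf : IsCanonicalFactor φ f)
    (hfs : IsSpectralDensity f) (hξ : HasSpectralDensity P n ξ f) :
    ∃ e : ℤ → Lp ℂ 2 P, (∃ M, ∀ m, ‖e m‖ ≤ M) ∧ IsInnovation P n ξ (fun m => e m) ∧
      ∀ s : ℕ, 1 ≤ s → ∀ m, incrementLp hξ s m =
        filt (wSeries n s * PowerSeries.mk φ) e m := by
  obtain ⟨hφ, Q, hQ, hQφ⟩ := exists_inverse hf.radius hf.ne_zero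
  have hra := absSummable_ratioSeries n
  have hri := absSummable_ratioInvSeries n
  have hC : AbsSummable (ratioInvSeries n * Q) := hri.mul hQ
  set C := ratioInvSeries n * Q with hCdef
  -- For step 1 the polynomial factor of w_1 is 1, so the moving average filter is `ratioSeries n`
  -- times φ, invertible with inverse `C`. For larger steps it would have zeros on the circle.
  have hψ : AbsSummable (ratioSeries n * PowerSeries.mk φ) := hra.mul hφ
  set ψ := ratioSeries n * PowerSeries.mk φ with hψdef
  have hψC : ψ * C = 1 := by
    rw [hψdef, hCdef]
    calc _ = (ratioInvSeries n * ratioSeries n) * (Q * PowerSeries.mk φ) := by ring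
      _ = 1 := by rw [ratioSeries_mul_inv, hQφ, one_mul]
  set y : ℤ → Lp ℂ 2 P := incrementLp hξ 1 with hy
  have hgram := inner_incrementLp hξ 1
  have hyb : ∀ m, ‖y m‖ ≤ ‖y 0‖ := by
    intro m
    have h1 := inner_self_eq_norm_sq_to_K (𝕜 := ℂ) (y m)
    have h2 := inner_self_eq_norm_sq_to_K (𝕜 := ℂ) (y 0)
    rw [hy, hgram, sub_self] at h1
    rw [hy, hgram, sub_self, h1] at h2
    have h3 : ‖y m‖ ^ 2 = ‖y 0‖ ^ 2 := by exact_mod_cast h2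
    exact ((sq_eq_sq₀ (norm_nonneg _) (norm_nonneg _)).mp h3).le
  -- Whitening the step 1 increments: both `C` and its inverse are one-sided, so `e` and `y`
  -- generate the same past.
  set e : ℤ → Lp ℂ 2 P := filt C y with he
  have heb : ∀ m, ‖e m‖ ≤ coeffNorm C * ‖y 0‖ := norm_filt_le hC hyb
  have hye : y = filt ψ e := by rw [he, ← filt_mul hψ hC hyb, hψC, filt_one]
  have hinc : ∀ (s : ℕ) (m : ℤ), incrementLp hξ s m = filt (geomPoly s ^ n) y m := by
    intro s m
    have h1 : filt (geomPoly s ^ n) y m = ∑ k ∈ Finset.range ((stepPoly n s).natDegree + 1),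
        (stepPoly n s).coeff k • y (m - k) := by
      rw [filt, ← coe_stepPoly, tsum_eq_sum (s := Finset.range ((stepPoly n s).natDegree + 1))]
      · simp
      · intro k hk
        simp only [Finset.mem_range, not_lt] at hk
        simp [Polynomial.coeff_eq_zero_of_natDegree_lt (show (stepPoly n s).natDegree < k by omega)]
    rw [h1]
    refine Lp.ext ?_
    filter_upwards [coeFn_incrementLp hξ s m, coeFn_sum_smul
      (Finset.range ((stepPoly n s).natDegree + 1)) (stepPoly n s).coeff (fun k => y (m - k))
      fun k => coeFn_incrementLp hξ 1 (m - k)] with ω h2 h3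
    rw [h2, h3, increment_eq_sum_increment_one]
  have hince : ∀ (s : ℕ) (m : ℤ), incrementLp hξ s m =
      filt (wSeries n s * PowerSeries.mk φ) e m := by
    intro s m
    rw [hinc, hye, ← filt_mul ((absSummable_geomPoly s).pow n) hψ heb, hψdef, wSeries, mul_assoc]
  have hws : ∀ s : ℕ, AbsSummable (wSeries n s * PowerSeries.mk φ) := fun s =>
    (absSummable_wSeries n s).mul hφ
  refine ⟨e, ⟨_, heb⟩, ⟨fun m => Lp.memLp (e m), fun m => ?_, fun m k => ?_, fun t m hm => ?_,
    fun t m s hm hs => ?_⟩, fun s _ m => hince s m⟩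
  -- The mean is the inner product with the constant 1, a continuous functional that vanishes on all
  -- increments.
  · set o : Lp ℂ 2 P := (memLp_const (1 : ℂ)).toLp with ho
    have hoc : o =ᵐ[P] fun _ => (1 : ℂ) := MemLp.coeFn_toLp _
    have h1 : ∀ (x : Lp ℂ 2 P) {X : Ω → ℂ}, x =ᵐ[P] X → inner ℂ o x = ∫ ω, X ω ∂P := by
      intro x X hX
      rw [inner_eq_integral_mul_conj o x hoc hX]
      simp
    have h2 := (hasSum_filt hC hyb m).mapL (innerSL ℂ o)
    have h3 : ∀ k : ℕ, innerSL ℂ o (PowerSeries.coeff k C • y (m - k)) = 0 := by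
      intro k
      rw [innerSL_apply_apply, inner_smul_right, h1 _ (coeFn_incrementLp hξ 1 (m - k)), hξ.mean,
        mul_zero]
    simp only [h3] at h2
    rw [← h1 (e m) EventuallyEq.rfl]
    exact h2.unique hasSum_zero
  · have h1 := inner_eq_integral_mul_conj (e k) (e m) (EventuallyEq.rfl) (EventuallyEq.rfl)
    rw [← h1, he, inner_filt hC hyb (intervalIntegrable_weight hfs) hgram]
    have h2 : ∫ x in (-π)..π, circ x ^ (k - m) *
        ((‖evalAt C (circ x)‖ ^ 2 * (weight n 1 x * f x) : ℝ) : ℂ) =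
        ∫ x in (-π)..π, circ x ^ (k - m) := by
      rw [intervalIntegral.integral_of_le (by linarith [Real.pi_pos]),
        intervalIntegral.integral_of_le (by linarith [Real.pi_pos])]
      refine integral_congr_ae ?_
      filter_upwards [weight_mul_eq (n := n) le_rfl hφ hf.eq] with x hx
      have hz := (norm_circ x).le
      have h3 : wSeries n 1 * PowerSeries.mk φ = ψ := by
        rw [hψdef, wSeries]
        simp [geomPoly]
      have h4 : evalAt ψ (circ x) * evalAt C (circ x) = 1 := by
        rw [← hψ.eval_mul hC hz, hψC, evalAt_one]
      rw [hx, mk_phiMu le_rfl, h3, ← mul_pow, ← norm_mul, mul_comm (evalAt C _), h4]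
      simp
    rw [h2, integral_circ_zpow]
    by_cases hmk : m = k
    · subst hmk
      have : (π : ℂ) ≠ 0 := by simp [Real.pi_ne_zero]
      simp
      field_simp
    · rw [if_neg (by omega), if_neg hmk, mul_zero]
  · refine inClosedSpan_of_hasSum (hasSum_filt hC hyb m) EventuallyEq.rfl
      (fun k => coeFn_incrementLp hξ 1 (m - k)) fun k => ?_
    exact ⟨m - k, 1, by omega, one_pos, by simp⟩
  · lift s to ℕ using hs.le
    have h1 := hasSum_filt (hws s) heb m
    rw [← hince] at h1
    refine inClosedSpan_of_hasSum h1 (coeFn_incrementLp hξ s m)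
      (fun k => EventuallyEq.rfl) fun k => ?_
    exact ⟨m - k, by omega, rfl⟩

end Innovation

variable {n μ N : ℕ} {a φ : ℕ → ℂ} {v u : ℝ → ℝ} {P₀ : ℝ} {c : ℂ}

/-! ### Representations of the increments -/

lemma isMovingAverage_filt {Ω : Type w} [MeasurableSpace Ω] {P : Measure Ω} {F : PowerSeries ℂ}
    (hF : AbsSummable F) {e : ℤ → Lp ℂ 2 P} {M : ℝ} (he : ∀ m, ‖e m‖ ≤ M) {η : ℤ → Ω → ℂ}
    (hη : ∀ m, (filt F e m : Lp ℂ 2 P) =ᵐ[P] η m) :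
    IsMovingAverage P η (fun m => e m) fun k => PowerSeries.coeff k F := fun m =>
  tendsto_lintegral_of_hasSum (hasSum_filt hF he m) (hη m) fun _ => EventuallyEq.rfl

lemma exists_movingAverage (hμ : 1 ≤ μ) {f : ℝ → ℝ} (hf : IsCanonicalFactor φ f)
    (hfs : IsSpectralDensity f) {Ω : Type w} [MeasurableSpace Ω] {P : Measure Ω}
    [IsProbabilityMeasure P] {ξ : ℤ → Ω → ℂ} (hξ : HasSpectralDensity P n ξ f) :
    ∃ ε : ℤ → Ω → ℂ, IsInnovation P n ξ ε ∧
      IsMovingAverage P (fun m => increment n μ ξ m) ε (phiMu n μ φ) := by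
  obtain ⟨hφ, -⟩ := exists_inverse hf.radius hf.ne_zero
  obtain ⟨e, ⟨M, hM⟩, hinn, hinc⟩ := exists_innovation hf hfs hξ
  refine ⟨_, hinn, ?_⟩
  have h := isMovingAverage_filt ((absSummable_wSeries n μ).mul hφ) hM
    (η := fun m => increment n μ ξ m) fun m => by
      rw [← hinc μ hμ]; exact coeFn_incrementLp hξ μ m
  simpa [← mk_phiMu hμ] using h

lemma exists_finite_movingAverage (hμ : 1 ≤ μ) {f : ℝ → ℝ} (hsupp : ∀ k, N < k → φ k = 0)
    (hf : IsCanonicalFactor φ f) (hfs : IsSpectralDensity f) {Ω : Type w} [MeasurableSpace Ω]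
    {P : Measure Ω} [IsProbabilityMeasure P] {ξ : ℤ → Ω → ℂ} (hξ : HasSpectralDensity P n ξ f) :
    ∃ ε η : ℤ → Ω → ℂ, IsInnovation P n ξ ε ∧
      IsMovingAverage P (fun m => increment n μ ξ m) ε (phiMu n μ φ) ∧
      IsMovingAverage P η ε (wCoeff n μ) ∧
      ∀ m : ℤ, increment n μ ξ m =ᵐ[P]
        fun ω => ∑ k ∈ Finset.range (N + 1), φ k * η (m - k) ω := by
  obtain ⟨hφ, -⟩ := exists_inverse hf.radius hf.ne_zero
  obtain ⟨e, ⟨M, hM⟩, hinn, hinc⟩ := exists_innovation hf hfs hξ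
  have hw := absSummable_wSeries n μ
  refine ⟨fun m => e m, fun m => (filt (wSeries n μ) e m : Lp ℂ 2 P), hinn, ?_, ?_, fun m => ?_⟩
  · have h := isMovingAverage_filt (hw.mul hφ) hM
      (η := fun m => increment n μ ξ m) fun m => by
        rw [← hinc μ hμ]; exact coeFn_incrementLp hξ μ m
    simpa [← mk_phiMu hμ] using h
  · have h := isMovingAverage_filt hw hM
      (η := fun m => (filt (wSeries n μ) e m : Lp ℂ 2 P)) fun m => EventuallyEq.rfl
    have e1 : (fun k => PowerSeries.coeff k (wSeries n μ)) = wCoeff n μ := by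
      funext k; rw [wCoeff_eq hμ]
    rwa [e1] at h
  · have h1 : incrementLp hξ μ m =
        ∑ k ∈ Finset.range (N + 1), φ k • filt (wSeries n μ) e (m - k) := by
      -- Filters commute, so the filter w_μ can act on the innovations before the finite filter φ.
      rw [hinc μ hμ, mul_comm, filt_mul hφ hw hM, filt,
        tsum_eq_sum (s := Finset.range (N + 1)) fun k hk => ?_]
      · simp
      · rw [PowerSeries.coeff_mk, hsupp k (by simpa using hk), zero_smul]
    have h2 := coeFn_sum_smul (Finset.range (N + 1)) φ (fun k => filt (wSeries n μ) e (m - k))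
      fun _ => EventuallyEq.rfl
    rw [← h1] at h2
    exact (coeFn_incrementLp hξ μ m).symm.trans h2

/-! ### Least favorable densities -/

lemma IsCanonicalFactor.absSummable {f : ℝ → ℝ} (hf : IsCanonicalFactor φ f) :
    AbsSummable (PowerSeries.mk φ) :=
  (exists_inverse hf.radius hf.ne_zero).1

lemma isLeastFavorable_of_le (hμ : 1 ≤ μ) {f₀ : ℝ → ℝ} (hmem : f₀ ∈ bandClass v u P₀)
    (hf : IsCanonicalFactor φ f₀)
    (hle : ∀ f ∈ bandClass v u P₀, optError n μ N a f ≤ ENNReal.ofReal (errNormSq n μ N a φ)) :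
    IsLeastFavorable.{w} n μ N a (bandClass v u P₀) f₀ where
  mem := hmem
  le f h := by rw [optError_eq_of_isCanonicalFactor hμ a hmem.1 hf]; exact hle f h
  error_eq f h Ω _ P _ ξ hξ := meanSquareError_eq hμ a hξ h.1

lemma solvesExtremum_of_le (hμ : 1 ≤ μ) {f₀ : ℝ → ℝ} (hmem : f₀ ∈ bandClass v u P₀)
    (hf : IsCanonicalFactor φ f₀)
    (hle : ∀ f ∈ bandClass v u P₀, optError n μ N a f ≤ ENNReal.ofReal (errNormSq n μ N a φ)) :
    SolvesExtremum n μ N a (bandClass v u P₀) φ :=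
  solvesExtremum_of_optError_le hμ (by simpa [AbsSummable] using hf.absSummable)
    (bandClass_congr hmem hf.eq) hle

/-- Each pair is a saddle point, so its value dominates the optimal error at the truncated density
of the other. -/
lemma errNormSq_eq_of_mem_truncSet (hμ : 1 ≤ μ) (hv : IsSpectralDensity v)
    (hvu : ∀ᵐ x ∂circVol, v x ≤ u x) {c' : ℂ} {φ' : ℕ → ℂ}
    (h : (c, φ) ∈ truncSet n μ N a v u P₀) (h' : (c', φ') ∈ truncSet n μ N a v u P₀) :
    errNormSq n μ N a φ = errNormSq n μ N a φ' := by
  have key : ∀ {c₁ c₂ : ℂ} {φ₁ φ₂ : ℕ → ℂ}, (c₁, φ₁) ∈ truncSet n μ N a v u P₀ →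
      (c₂, φ₂) ∈ truncSet n μ N a v u P₀ → errNormSq n μ N a φ₁ ≤ errNormSq n μ N a φ₂ := by
    intro c₁ c₂ φ₁ φ₂ h₁ h₂
    have h := optError_le_of_mem_truncSet hμ hv h₂ (truncDensity_mem hvu h₁)
    rw [optError_eq_of_isCanonicalFactor hμ a (isSpectralDensity_truncDensity h₁) h₁.2] at h
    exact (ENNReal.ofReal_le_ofReal_iff (errNormSq_nonneg _ _ _ _ _)).mp h
  exact le_antisymm (key h h') (key h' h)

lemma nuTrunc_eq_of_mem_truncSet (hμ : 1 ≤ μ) (hv : IsSpectralDensity v)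
    (hvu : ∀ᵐ x ∂circVol, v x ≤ u x) (h : (c, φ) ∈ truncSet n μ N a v u P₀) :
    nuTrunc n μ N a v u P₀ = ((errNormSq n μ N a φ / P₀ : ℝ) : EReal) := by
  have h1 : (fun p => ((errNormSq n μ N a p.2 / P₀ : ℝ) : EReal)) '' truncSet n μ N a v u P₀ =
      {((errNormSq n μ N a φ / P₀ : ℝ) : EReal)} := by
    refine Set.eq_singleton_iff_unique_mem.mpr ⟨⟨_, h, rfl⟩, ?_⟩
    rintro _ ⟨⟨c', φ'⟩, h', rfl⟩
    simp only [errNormSq_eq_of_mem_truncSet hμ hv hvu h' h]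
  rw [nuTrunc, h1, sSup_singleton]

lemma truncSet_nonempty_of_nuTrunc_ne_bot (h : nuTrunc n μ N a v u P₀ ≠ ⊥) :
    (truncSet n μ N a v u P₀).Nonempty := by
  contrapose! h
  rw [nuTrunc, h, Set.image_empty, sSup_empty]

lemma specError_congr_ae {h₁ h₂ : ℝ → ℂ} (h : h₁ =ᵐ[circVol] h₂) (f : ℝ → ℝ) :
    specError n μ N a h₁ f = specError n μ N a h₂ f := by
  rw [specError, specError]
  congr 1
  refine lintegral_congr_ae ?_
  filter_upwards [h] with x hx
  rw [hx]

lemma weight_mul_pos (hμ : 1 ≤ μ) {f : ℝ → ℝ} (hf : IsCanonicalFactor φ f) :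
    ∀ᵐ x ∂circVol, 0 < weight n μ x * f x := by
  filter_upwards [weight_ne_zero (n := n) hμ, hf.eq] with x h1 h2
  have h3 : 0 ≤ weight n μ x := by
    rw [weight, pow_mul x]; positivity
  have h4 := norm_pos_iff.mpr (symbol_ne_zero hf.ne_zero x)
  rw [h2]
  exact mul_pos (h3.lt_of_ne' h1) (by positivity)

/-- A spectral characteristic given by a canonical factor whose error is the saddle value is
minimax-robust, by uniqueness of the optimal characteristic. -/
lemma isMinimaxRobust_of_errNormSq_eq (hμ : 1 ≤ μ) (hv : IsSpectralDensity v) {f₀ : ℝ → ℝ}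
    (hmem : f₀ ∈ bandClass v u P₀) (hf : IsCanonicalFactor φ f₀) {φ' : ℕ → ℂ}
    (h : (c, φ') ∈ truncSet n μ N a v u P₀)
    (heq : errNormSq n μ N a φ = errNormSq n μ N a φ') :
    IsMinimaxRobust n μ N a (bandClass v u P₀) (specChar n μ N a φ) := by
  have hopt := optError_eq_of_isCanonicalFactor (N := N) (n := n) hμ a hmem.1 hf
  have hchar : IsSpectralCharacteristic n μ f₀ (specChar n μ N a φ') :=
    isSpectralCharacteristic_specChar hμ a h.2.radius h.2.ne_zero hmem.1
  -- The saddle inequality bounds the error of h_{φ'} at `f₀` by its saddle value, which by `heq` is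
  -- the optimal error at `f₀`.
  have H' : IsOptimal n μ N a f₀ (specChar n μ N a φ') := by
    refine ⟨hchar, le_antisymm ?_ (iInf_le_of_le ⟨_, hchar⟩ le_rfl)⟩
    rw [hopt, heq]
    exact specError_specChar_le hμ hv h hmem
  have hae := ae_eq_of_isOptimal hmem.1 (weight_mul_pos hμ hf) (by rw [hopt]; exact
    ENNReal.ofReal_ne_top) (isOptimal_specChar hμ a hmem.1 hf) H'
  refine isMinimaxRobust_of_saddle hmem (fun f hf' =>
    isSpectralCharacteristic_specChar hμ a hf.radius hf.ne_zero hf'.1) fun f hf' => ?_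
  rw [specError_congr_ae hae, hopt, heq]
  exact specError_specChar_le hμ hv h hf'

lemma symbol_eq_sum (hsupp : ∀ k, N < k → φ k = 0) (x : ℝ) :
    symbol φ x = ∑ k ∈ Finset.range (N + 1), φ k * cexp (-(I * x * k)) :=
  tsum_eq_sum fun k hk => by rw [hsupp k (by simpa using hk), zero_mul]

lemma symbol_mem_bandClass (h : φ ∈ solutionSet n μ N a v u P₀) :
    (fun x => ‖symbol φ x‖ ^ 2) ∈ bandClass v u P₀ := by
  obtain ⟨hsupp, -, hband, hnorm, hf⟩ := h
  refine ⟨isSpectralDensity_symbol hf.absSummable, hband, ?_⟩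
  have h1 : ∑' k, ‖φ k‖ ^ 2 = P₀ := by
    rw [tsum_eq_sum (s := Finset.range (N + 1)) fun k hk => by
      rw [hsupp k (by simpa using hk), norm_zero]; simp, ← hnorm,
      Fin.sum_univ_eq_sum_range fun k => ‖φ k‖ ^ 2]
  rw [integral_sq_symbol hf.absSummable, h1]
  have := Real.pi_pos
  exact le_of_eq (by field_simp)

end

end RobustExtrapolation

/-! ### Assembly of the theorem from the saddle point. -/

open RobustExtrapolation

theorem theorem7p2 (n μ N : ℕ) (hn : 1 ≤ n) (hμ : 1 ≤ μ) (a : ℕ → ℂ) (v u : ℝ → ℝ) (P₀ : ℝ)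
    (hP₀ : 0 < P₀) (hv : IsSpectralDensity v) (hu : IsSpectralDensity u)
    (hvu : ∀ᵐ x ∂volume.restrict (Set.Ioc (-π) π), v x ≤ u x) :
    -- the moving average density
    (∀ φ ∈ solutionSet n μ N a v u P₀,
      nuSol n μ N a v u P₀ = nuTrunc n μ N a v u P₀ →
      nuTrunc n μ N a v u P₀ = ((errNormSq n μ N a φ / P₀ : ℝ) : EReal) →
        IsLeastFavorable.{w} n μ N a (bandClass v u P₀)
          (fun x => ‖∑ k ∈ Finset.range (N + 1), φ k * cexp (-(I * x * k))‖ ^ 2) ∧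
        (∀ (Ω : Type w) [MeasurableSpace Ω] (P : Measure Ω) [IsProbabilityMeasure P]
          (ξ : ℤ → Ω → ℂ),
          HasSpectralDensity P n ξ
            (fun x => ‖∑ k ∈ Finset.range (N + 1), φ k * cexp (-(I * x * k))‖ ^ 2) →
          ∃ ε η : ℤ → Ω → ℂ, IsInnovation P n ξ ε ∧
            IsMovingAverage P (fun m => increment n μ ξ m) ε (phiMu n μ φ) ∧
            IsMovingAverage P η ε (wCoeff n μ) ∧
            ∀ m : ℤ, increment n μ ξ m =ᵐ[P]
              fun ω => ∑ k ∈ Finset.range (N + 1), φ k * η (m - k) ω) ∧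
        SolvesExtremum n μ N a (bandClass v u P₀) φ ∧
        IsOptimal n μ N a
          (fun x => ‖∑ k ∈ Finset.range (N + 1), φ k * cexp (-(I * x * k))‖ ^ 2)
          (specChar n μ N a φ) ∧
        IsMinimaxRobust n μ N a (bandClass v u P₀) (specChar n μ N a φ)) ∧
    -- the truncated density
    (nuSol n μ N a v u P₀ < nuTrunc n μ N a v u P₀ →
      (truncSet n μ N a v u P₀).Nonempty ∧
      ∀ c φ, (c, φ) ∈ truncSet n μ N a v u P₀ →
        IsLeastFavorable.{w} n μ N a (bandClass v u P₀) (truncDensity n μ N a v u c φ) ∧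
        head N (phiMu n μ φ) = (matW n μ N).mulVec (head N φ) ∧
        (∀ (Ω : Type w) [MeasurableSpace Ω] (P : Measure Ω) [IsProbabilityMeasure P]
          (ξ : ℤ → Ω → ℂ), HasSpectralDensity P n ξ (truncDensity n μ N a v u c φ) →
          ∃ ε : ℤ → Ω → ℂ, IsInnovation P n ξ ε ∧
            IsMovingAverage P (fun m => increment n μ ξ m) ε (phiMu n μ φ)) ∧
        SolvesExtremum n μ N a (bandClass v u P₀) φ ∧
        ∫ x in (-π)..π, truncDensity n μ N a v u c φ x = 2 * π * P₀ ∧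
        IsOptimal n μ N a (truncDensity n μ N a v u c φ) (specChar n μ N a φ) ∧
        IsMinimaxRobust n μ N a (bandClass v u P₀) (specChar n μ N a φ)) := by
  -- A supremum strictly above another value is not -∞, so the set over which it is taken is
  -- nonempty.
  refine ⟨fun φ hφ _ hνφ => ?_, fun hlt => ⟨truncSet_nonempty_of_nuTrunc_ne_bot hlt.ne_bot,
    fun c φ h => ?_⟩⟩
  -- The supremum over S⁺ is a real number here, which provides a pair in S⁺; its saddle value is
  -- transferred to `φ` through `heq`.
  · obtain ⟨⟨c, φ'⟩, h'⟩ : (truncSet n μ N a v u P₀).Nonempty :=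
      truncSet_nonempty_of_nuTrunc_ne_bot (by rw [hνφ]; exact EReal.coe_ne_bot _)
    have heq : errNormSq n μ N a φ = errNormSq n μ N a φ' := by
      rw [nuTrunc_eq_of_mem_truncSet hμ hv hvu h', EReal.coe_eq_coe_iff] at hνφ
      exact ((div_left_inj' hP₀.ne').mp hνφ).symm
    have hle : ∀ f ∈ bandClass v u P₀,
        optError n μ N a f ≤ ENNReal.ofReal (errNormSq n μ N a φ) := fun f hf => by
      rw [heq]; exact optError_le_of_mem_truncSet hμ hv h' hf
    have hmem := symbol_mem_bandClass hφ
    obtain ⟨hsupp, -, -, -, hfac⟩ := hφ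
    simp only [← symbol_eq_sum hsupp]
    exact ⟨isLeastFavorable_of_le hμ hmem hfac hle,
      fun Ω _ P _ ξ hξ => exists_finite_movingAverage hμ hsupp hfac hmem.1 hξ,
      solvesExtremum_of_le hμ hmem hfac hle, isOptimal_specChar hμ a hmem.1 hfac,
      isMinimaxRobust_of_errNormSq_eq hμ hv hmem hfac h' heq⟩
  · have hle := fun f (hf : f ∈ bandClass v u P₀) => optError_le_of_mem_truncSet hμ hv h hf
    have hmem := truncDensity_mem hvu h
    exact ⟨isLeastFavorable_of_le hμ hmem h.2 hle, (matW_mulVec_head n μ N φ).symm,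
      fun Ω _ P _ ξ hξ => exists_movingAverage hμ h.2 hmem.1 hξ,
      solvesExtremum_of_le hμ hmem h.2 hle, integral_truncDensity h,
      isOptimal_specChar hμ a hmem.1 h.2, isMinimaxRobust_specChar hμ hv hvu h⟩
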